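/- Theorem 7.5. Let $\mathbb S^2\subset\mathbb R^3$ be the unit sphere with the round metric $g=\frac1{4\pi}g_0$ of area one, where $g_0$ is the standard metric, and let $v_g$ be its volume measure. Write $\|f\|_{W^{1,2}}^2=\int f^2dv_g+\int|df|_g^2dv_g$. A finite Borel measure $\mu$ on $\mathbb S^2$ is *admissible* if the identity map of $C^\infty(\mathbb S^2)$ extends to a compact operator $W^{1,2}(\mathbb S^2,g)\to L^2(\mathbb S^2,\mu)$, and *balanced* if $\int_{\mathbb S^2}x\,d\mu(x)=0\in\mathbb R^3$. Put $$\lambda_1(\mu)=\inf_{E}\ \sup_{0\ne f\in E}\frac{\int|df|_g^2\,dv_g}{\int f^2\,d\mu},$$ the infimum being over the two-dimensional subspaces $E\subset C^\infty(\mathbb S^2)$ that are also two-dimensional in $L^2(\mu)$. (Hersch's inequality says $\lambda_1(\mu)\mu(\mathbb S^2)\le 8\pi$.) For a measurable function or covector field $u$ on $\mathbb S^2$ let $$\|u\|_{L^2(\mathrm{Log}L)^{-1/2}}=\inf\Big\{\eta>0:\int_{\mathbb S^2}\frac{|u/\eta|^2}{\log(2+|u/\eta|)}\,dv_g\le1\Big\},\qquad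 \|f\|_{W^{1,2,-1/2}}=\|f\|_{L^2(\mathrm{Log}L)^{-1/2}}+\|df\|_{L^2(\mathrm{Log}L)^{-1/2}},$$ and for $1\le p<\infty$ let $\|f\|_{W^{1,p}}=\|f\|_{L^p(v_g)}+\|df\|_{L^p(v_g)}$. For $X=W^{1,2,-1/2}$ or $X=W^{1,p}$ and finite Borel measures $\mu,\nu$ put $$\|\mu-\nu\|_{X^*}=\sup\Big\{\Big|\int f\,d\mu-\int f\,d\nu\Big|:\ f\in C^\infty(\mathbb S^2),\ \|f\|_X\le1\Big\}\in[0,\infty].$$ Let $\mathrm{Conf}(\mathbb S^2)$ be the group of smooth conformal diffeomorphisms of $\mathbb S^2$. There is a sequence $(\mu_n)_{n\in\mathbb N}$ of admissible, balanced Borel probability measures on $\mathbb S^2$ with $\|\mu_n-v_g\|_{(W^{1,2,-1/2})^*}<\infty$ for every $n$, such that $\lambda_1(\mu_n)\to8\pi$ and $$\liminf_{n\to\infty}\|\mu_n-v_g\|_{(W^{1,2,-1/2})^*}>0.$$ Moreover, for the same sequence, $$\liminf_{n\to\infty}\ \inf_{\Phi\in\mathrm{Conf}(\mathbb S^2)}\|\Phi_*\mu_n-v_g\|_{(W^{1,2,-1/2})^*}>0,$$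 and for every $\varepsilon\in(0,1]$ $$\liminf_{n\to\infty}\ \inf_{\Phi\in\mathrm{Conf}(\mathbb S^2)}\|\Phi_*\mu_n-v_g\|_{(W^{1,2-\varepsilon})^*}>0.$$ That is, Hersch's inequality is not stable in $(W^{1,2,-1/2})^*$, nor in $(W^{1,2-\varepsilon})^*$: the $W^{-1,2}$ norm in its stability estimate cannot be replaced by either of these. -/

import Mathlib

open MeasureTheory Filter Topology Metric Set
open scoped ENNReal Manifold ContDiff RealInnerProductSpace

noncomputable section

namespace HerschStability

/-- The ambient space `ℝ³`. -/
abbrev R3 : Type := EuclideanSpace ℝ (Fin 3)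

/-- The sphere `S² ⊂ ℝ³`, realised as the set of unit vectors, with Mathlib's manifold structure. -/
abbrev S2 : Type := sphere (0 : R3) 1

/-- The space `C^∞(S²)` of smooth real functions. -/
abbrev SmoothFn : Type := C^∞⟮𝓡 2, S2; 𝓘(ℝ, ℝ), ℝ⟯

/-- A fixed unit vector (only its existence matters). -/
def basePoint : S2 := ⟨EuclideanSpace.single 0 1, by simp⟩

/-- The radial projection `y ↦ y / |y|` of `ℝ³ ∖ {0}` onto `S²` (with a junk value at `0`). -/
def radialProj (y : R3) : S2 :=
  if h : y = 0 then basePoint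
  else ⟨‖y‖⁻¹ • y, by simp [norm_smul, inv_mul_cancel₀ (norm_ne_zero_iff.2 h)]⟩

/-- The round volume measure `v_g` of total area one: Lebesgue surface measure of the unit
sphere, whose total mass is `4π`, divided by `4π`. It is the Riemannian measure of
`g = g₀ / (4π)`, where `g₀` is the metric of the unit sphere. -/
def vg : Measure S2 := ENNReal.ofReal (4 * Real.pi)⁻¹ • (volume : Measure R3).toSphere

/-- The differential of `f` for the metric `g = g₀ / (4π)`, written as a tangent vector field.
The Euclidean gradient at `x ∈ S²` of the radially constant extension `y ↦ f (y / |y|)` is the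
`g₀`-gradient of `f`. The factor `√(4π)` makes the Euclidean length of `sgrad f x`
equal to `|df|_g (x)`. -/
def sgrad (f : S2 → ℝ) (x : S2) : R3 :=
  Real.sqrt (4 * Real.pi) • gradient (fun y : R3 => f (radialProj y)) (x : R3)

lemma radialProj_coe (x : S2) : radialProj (x : R3) = x := by
  have hx : ‖(x : R3)‖ = 1 := by simp
  have h0 : (x : R3) ≠ 0 := by
    intro h
    rw [h] at hx
    simp at hx
  ext1
  simp [radialProj, h0]

lemma contMDiffAt_radialProj {y : R3} (hy : y ≠ 0) :
    ContMDiffAt 𝓘(ℝ, R3) (𝓡 2) ∞ radialProj y := by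
  have : Fact (Module.finrank ℝ R3 = 2 + 1) := ⟨by simp⟩
  let U : TopologicalSpace.Opens R3 := ⟨{0}ᶜ, isOpen_compl_singleton⟩
  let F : U → R3 := fun z => ‖(z : R3)‖⁻¹ • (z : R3)
  have hF : ContMDiff 𝓘(ℝ, R3) 𝓘(ℝ, R3) ∞ F := by
    intro z
    have hz : (z : R3) ≠ 0 := z.2
    have h1 : ContMDiffAt 𝓘(ℝ, R3) 𝓘(ℝ, R3) ∞ (fun w : R3 => ‖w‖⁻¹ • w) (z : R3) := by
      apply ContDiffAt.contMDiffAt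
      exact ((contDiffAt_norm ℝ hz).inv (norm_ne_zero_iff.2 hz)).smul contDiffAt_id
    exact contMDiffAt_subtype_iff.2 h1
  have hF' : ∀ z, F z ∈ sphere (0 : R3) 1 := by
    intro z
    have hz : (z : R3) ≠ 0 := z.2
    simp [F, norm_smul, inv_mul_cancel₀ (norm_ne_zero_iff.2 hz)]
  have key := ContMDiff.codRestrict_sphere (n := 2) hF hF'
  have heq : (fun z : U => radialProj (z : R3)) = Set.codRestrict F (sphere (0 : R3) 1) hF' := by
    funext z
    have hz : (z : R3) ≠ 0 := z.2
    ext1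
    simp [radialProj, hz, F]
  have h2 := key ⟨y, hy⟩
  rw [← heq] at h2
  exact (contMDiffAt_subtype_iff (U := U) (x := ⟨y, hy⟩)).1 h2

lemma contDiffAt_comp_radialProj (f : SmoothFn) {y : R3} (hy : y ≠ 0) :
    ContDiffAt ℝ ∞ (fun z : R3 => f (radialProj z)) y :=
  contMDiffAt_iff_contDiffAt.1 ((f.contMDiff _).comp y (contMDiffAt_radialProj hy))

lemma coe_ne_zero (x : S2) : (x : R3) ≠ 0 := by
  intro h
  have hx : ‖(x : R3)‖ = 1 := by simp
  rw [h] at hx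
  simp at hx

lemma sgrad_add (f h : SmoothFn) (x : S2) :
    sgrad (⇑(f + h)) x = sgrad f x + sgrad h x := by
  have hf := (contDiffAt_comp_radialProj f (coe_ne_zero x)).differentiableAt (by simp)
  have hh := (contDiffAt_comp_radialProj h (coe_ne_zero x)).differentiableAt (by simp)
  have := fderiv_add hf hh
  simp only [sgrad, gradient, ← smul_add, ← map_add]
  rw [← this]
  rfl

lemma sgrad_smul (c : ℝ) (f : SmoothFn) (x : S2) :
    sgrad (⇑(c • f)) x = c • sgrad f x := by
  have hf := (contDiffAt_comp_radialProj f (coe_ne_zero x)).differentiableAt (by simp)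
  have := fderiv_const_smul hf c
  simp only [sgrad, gradient]
  rw [smul_comm c]
  congr 1
  rw [← map_smul, ← this]
  rfl

lemma continuous_sgrad (f : SmoothFn) : Continuous (sgrad f) := by
  rw [continuous_iff_continuousAt]
  intro x
  have h1 := (contDiffAt_comp_radialProj f (coe_ne_zero x)).fderiv_right (m := 0) (by simp)
  have h2 : ContinuousAt (fun z : S2 => fderiv ℝ (fun z : R3 => f (radialProj z)) (z : R3)) x :=
    ContinuousAt.comp (f := ((↑) : S2 → R3)) h1.continuousAt continuous_subtype_val.continuousAt
  have h3 : ContinuousAt (fun z : S2 => gradient (fun y : R3 => f (radialProj y)) (z : R3)) x :=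
    (InnerProductSpace.toDual ℝ R3).symm.continuous.continuousAt.comp h2
  exact h3.const_smul (Real.sqrt (4 * Real.pi))

instance : IsFiniteMeasure vg := by
  unfold vg
  exact Measure.smul_finite _ ENNReal.ofReal_ne_top

/-- The inner product space `L²(v_g) × L²(v_g; ℝ³)`, in which a function is paired with its
differential. -/
abbrev L2Pair : Type := WithLp 2 (Lp ℝ 2 vg × Lp R3 2 vg)

/-- The map `f ↦ (f, df)` from `C^∞(S²)` to `L²(v_g) × L²(v_g; ℝ³)`. The induced norm on
`C^∞(S²)` is the `W^{1,2}` norm, `(∫ f² dv_g + ∫ |df|_g² dv_g)^{1/2}`. -/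
def smoothJet : SmoothFn →ₗ[ℝ] L2Pair where
  toFun f := WithLp.toLp 2
    (ContinuousMap.toLp 2 vg ℝ (⟨f, f.contMDiff.continuous⟩ : C(S2, ℝ)),
     ContinuousMap.toLp 2 vg ℝ (⟨sgrad f, continuous_sgrad f⟩ : C(S2, R3)))
  map_add' f h := by
    rw [← WithLp.toLp_add, Prod.mk_add_mk, ← map_add, ← map_add]
    congr 3
    ext1 x
    exact sgrad_add f h x
  map_smul' c f := by
    rw [RingHom.id_apply, ← WithLp.toLp_smul, Prod.smul_mk, ← map_smul, ← map_smul]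
    congr 3
    ext1 x
    exact sgrad_smul c f x

/-- The Sobolev space `W^{1,2}(S², g)`, as the completion of `C^∞(S²)` for the `W^{1,2}` norm,
realised as the closure of the smooth functions in `L²(v_g) × L²(v_g; ℝ³)`. -/
def W12 : Submodule ℝ L2Pair := (LinearMap.range smoothJet).topologicalClosure

/-- A smooth function as an element of `W^{1,2}(S², g)`. -/
def SmoothFn.toW12 (f : SmoothFn) : W12 :=
  ⟨smoothJet f, Submodule.le_topologicalClosure _ ⟨f, rfl⟩⟩

/-- A (finite Borel) measure `μ` on `S²` is admissible if the identity map of `C^∞(S²)` extends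
to a compact operator `W^{1,2}(S², g) → L²(S², μ)`. -/
def Admissible (μ : Measure S2) : Prop :=
  IsFiniteMeasure μ ∧ ∃ T : W12 →L[ℝ] Lp ℝ 2 μ, IsCompactOperator T ∧
    ∀ f : SmoothFn, ⇑(T f.toW12) =ᵐ[μ] ⇑f

/-- A measure on `S²` is balanced if its centre of mass is the origin. -/
def Balanced (μ : Measure S2) : Prop :=
  ∫ x : S2, (x : R3) ∂μ = 0

/-- The Rayleigh quotient `∫ |df|_g² dv_g / ∫ f² dμ`. -/
def rayleigh (μ : Measure S2) (f : SmoothFn) : ℝ≥0∞ :=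
  (∫⁻ x, ENNReal.ofReal (‖sgrad f x‖ ^ 2) ∂vg) / (∫⁻ x, ENNReal.ofReal (f x ^ 2) ∂μ)

/-- The `k`-th eigenvalue `λ_k(S², μ)`: the infimum of `sup_{0 ≠ f ∈ E} rayleigh μ f` over the
`(k+1)`-dimensional subspaces `E ⊂ C^∞(S²)` which remain `(k+1)`-dimensional in `L²(μ)`, i.e. on
which `f = 0` `μ`-almost everywhere forces `f = 0`. -/
def eigenvalue (k : ℕ) (μ : Measure S2) : ℝ≥0∞ :=
  ⨅ (E : Submodule ℝ SmoothFn) (_ : Module.finrank ℝ E = k + 1)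
    (_ : ∀ f ∈ E, ⇑f =ᵐ[μ] 0 → f = 0),
    ⨆ (f : SmoothFn) (_ : f ∈ E) (_ : f ≠ 0), rayleigh μ f

/-- The Luxemburg norm of `L²(Log L)^{-1/2}(S², g)` of a function `u`:
`inf {η > 0 : ∫ |u/η|² / log(2 + |u/η|) dv_g ≤ 1}`. -/
def luxemburg (u : S2 → ℝ) : ℝ≥0∞ :=
  ⨅ (η : ℝ) (_ : 0 < η)
    (_ : ∫⁻ x, ENNReal.ofReal ((|u x| / η) ^ 2 / Real.log (2 + |u x| / η)) ∂vg ≤ 1),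
    ENNReal.ofReal η

/-- The norm of the Orlicz–Sobolev space `W^{1,2,-1/2}(S², g)` on smooth functions. -/
def orliczSobolevNorm (f : SmoothFn) : ℝ≥0∞ :=
  luxemburg f + luxemburg (fun x => ‖sgrad f x‖)

/-- The norm of `W^{1,p}(S², g)` on smooth functions, `‖f‖_{L^p} + ‖df‖_{L^p}`. -/
def sobolevNorm (p : ℝ) (f : SmoothFn) : ℝ≥0∞ :=
  eLpNorm f (ENNReal.ofReal p) vg + eLpNorm (sgrad f) (ENNReal.ofReal p) vg

/-- The norm of `μ - ν` in the dual of the completion of `C^∞(S²)` for the norm `N`: the supremum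
of `|∫ f d(μ - ν)|` over the smooth `f` with `N f ≤ 1` (it is `∞` if `μ - ν` is not in the
dual). -/
def dualDist (N : SmoothFn → ℝ≥0∞) (μ ν : Measure S2) : ℝ≥0∞ :=
  ⨆ (f : SmoothFn) (_ : N f ≤ 1), ENNReal.ofReal |∫ x, f x ∂μ - ∫ x, f x ∂ν|

/-- A diffeomorphism `Φ` of `S²` is a conformal automorphism if at every `x` its differential
multiplies the round metric by a positive factor. On the tangent space `x^⊥` the differential of
`Φ` is the derivative at `x` of the radially constant extension `y ↦ Φ (y / |y|)`. -/
def IsConformal (Φ : S2 ≃ₘ⟮𝓡 2, 𝓡 2⟯ S2) : Prop :=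
  ∀ x : S2, ∃ c : ℝ, 0 < c ∧ ∀ u v : R3, ⟪(x : R3), u⟫ = 0 → ⟪(x : R3), v⟫ = 0 →
    ⟪fderiv ℝ (fun y : R3 => (Φ (radialProj y) : R3)) x u,
      fderiv ℝ (fun y : R3 => (Φ (radialProj y) : R3)) x v⟫ = c * ⟪u, v⟫

/-- The infimum of the distance, in the dual norm attached to `N`, from `v_g` to the images
`Φ_* μ` of `μ` under the conformal automorphisms `Φ` of `S²`. -/
def conformalDualDist (N : SmoothFn → ℝ≥0∞) (μ : Measure S2) : ℝ≥0∞ :=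
  ⨅ (Φ : S2 ≃ₘ⟮𝓡 2, 𝓡 2⟯ S2) (_ : IsConformal Φ), dualDist N (μ.map Φ) vg

end HerschStability

end

noncomputable section

namespace HerschStability

/-! Let `t` be the coordinate along a fixed axis. The measures (`concentrated`) are the
normalisations of `(1 + τ q) v_g` with `q = t² / ((1 - t² + δ) ℓ²)`, `ℓ = 1 + log ((1 + δ) / (1 - t²
+ δ))`, `δ = exp (-exp N)`, `τ = N^(-1/2)` and `N → ∞`. Near each pole, `q` is a regularised copy of
the critical planar Hardy weight `1 / (r log r)²`.

The first eigenvalue hardly sees the perturbation. The function `√ℓ` serves as a ground state, and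
`hardy_inequality` bounds `∫ q u²` by `∫ u² + ∫ |∇u|²` uniformly in `δ`. Hence `∫ u² dμ` exceeds `∫
u² dv_g` by at most `τ` times the energy, and the sharp Poincaré inequality `sphere_poincare` yields
`λ₁ ≥ 8π / (1 + 3τ)`. The span of `1` and `t` gives `λ₁ ≤ 8π (1 + τ)`.

The dual norm does see it, through the test function `ℓ`. The product `q ℓ` behaves like `1 / (r²
|log r|)`, whose integral down to `r ≈ √δ` is of order `log log (1/δ) ≈ N`. So `∫ ℓ dμ` is at least
of order `τ N = √N`, while `∫ ℓ dv_g` stays bounded. On the other hand `|dℓ|` is at most of order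
`1/r`, and the Young function of `κ/r` has integral of order `κ² N + κ`, which makes the norm of `ℓ`
at most of order `√N` (`luxemburg_le_half_of_poles`). The quotient is bounded below. The choice `τ =
N^(-1/2)` is what lets `τ → 0` while the pairing keeps up with the norm.

For the conformal group there is a dichotomy (`IsConformal.half_le_or_biLipschitz`). Stereographic
projection and Liouville's theorem turn a conformal map into a plane similarity, hence into an exact
identity between distances. From it, either some point is so strongly expanded that `Φ_* v_g` has
centre of mass of length at least `1/2`, or `Φ` is bi-Lipschitz with constant `8`. In the first case
a linear function separates `Φ_* μ` from `v_g`, because `μ` is close to `v_g` in total variation. In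
the second, `ℓ ∘ Φ⁻¹` works as `ℓ` did, with worse constants. The `W^{1,2-ε}` statement follows
since that norm is at most `6/ε` times the Orlicz one.

The analytic inputs are obtained from `ℝ³`. The homogeneous extension `|y| f(y/|y|)` transfers the
Gaussian Poincaré inequality to the sharp inequality on the sphere, and the Poincaré inequality on
small cubes to Rellich's theorem. Gaussian integration by parts gives the divergence formula on the
sphere and Archimedes' theorem. -/

/-! ### Polar coordinates and the round measure. -/

lemma measurable_radialProj : Measurable radialProj := by
  have h : Measurable fun y : R3 => if y = 0 then (basePoint : R3) else ‖y‖⁻¹ • y :=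
    Measurable.ite (measurableSet_singleton _) measurable_const
      (measurable_norm.inv.smul measurable_id)
  have h2 : (fun y : R3 => (radialProj y : R3)) =
      fun y : R3 => if y = 0 then (basePoint : R3) else ‖y‖⁻¹ • y := by
    funext y
    by_cases hy : y = 0 <;> simp [radialProj, hy]
  exact Measurable.subtype_mk (p := fun y => y ∈ sphere (0 : R3) 1)
    (h := fun y => (radialProj y).2) (h2 ▸ h)

lemma coe_radialProj {y : R3} (hy : y ≠ 0) : (radialProj y : R3) = ‖y‖⁻¹ • y := by
  simp [radialProj, hy]

lemma norm_smul_radialProj (y : R3) : ‖y‖ • (radialProj y : R3) = y := by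
  by_cases hy : y = 0
  · simp [hy]
  · rw [coe_radialProj hy, smul_smul, mul_inv_cancel₀ (norm_ne_zero_iff.2 hy), one_smul]

lemma radialProj_smul {c : ℝ} (hc : 0 < c) (y : R3) (hy : y ≠ 0) :
    radialProj (c • y) = radialProj y := by
  ext1
  rw [coe_radialProj hy, coe_radialProj (smul_ne_zero hc.ne' hy), norm_smul, Real.norm_eq_abs,
    abs_of_pos hc, smul_smul]
  congr 1
  field_simp

instance : IsProbabilityMeasure vg := by
  constructor
  have h4 : (0 : ℝ) < 4 * Real.pi := by positivity
  rw [vg, Measure.smul_apply, Measure.toSphere_apply_univ, EuclideanSpace.volume_ball_fin_three]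
  simp only [finrank_euclideanSpace, Fintype.card_fin, smul_eq_mul, ENNReal.ofReal_one]
  rw [one_pow, one_mul, show ((3 : ℕ) : ℝ≥0∞) = ENNReal.ofReal 3 by simp,
    ← ENNReal.ofReal_mul (by norm_num), ← ENNReal.ofReal_mul (by positivity),
    ← ENNReal.ofReal_one]
  congr 1
  field_simp

/-- Radial projection and norm are independent under Lebesgue measure. -/
lemma lintegral_norm_radialProj {a : ℝ → ℝ≥0∞} (ha : Measurable a) {b : S2 → ℝ≥0∞}
    (hb : Measurable b) :
    ∫⁻ y : R3, a ‖y‖ * b (radialProj y) = (∫⁻ y : R3, a ‖y‖) * ∫⁻ x, b x ∂vg := by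
  have key : ∀ b : S2 → ℝ≥0∞, Measurable b → ∫⁻ y : R3, a ‖y‖ * b (radialProj y) =
      (ENNReal.ofReal (4 * Real.pi) * ∫⁻ r : Ioi (0 : ℝ), a r ∂(Measure.volumeIoiPow 2)) *
        ∫⁻ x, b x ∂vg := by
    intro b hb
    have h1 : ∫⁻ y : R3, a ‖y‖ * b (radialProj y) =
        ∫⁻ y : ({0}ᶜ : Set R3), a ‖(y : R3)‖ * b (radialProj y)
          ∂(volume.comap Subtype.val) := by
      rw [lintegral_subtype_comap (measurableSet_singleton _).compl
        (fun y : R3 => a ‖y‖ * b (radialProj y)),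
        Measure.restrict_eq_self_of_ae_mem]
      exact compl_mem_ae_iff.2 (measure_singleton _)
    have mp := (volume : Measure R3).measurePreserving_homeomorphUnitSphereProd
    have h2 : ∫⁻ y : ({0}ᶜ : Set R3), a ‖(y : R3)‖ * b (radialProj y)
          ∂(volume.comap Subtype.val) =
        ∫⁻ z : S2 × Ioi (0 : ℝ), a z.2 * b z.1
          ∂((volume : Measure R3).toSphere.prod (Measure.volumeIoiPow (Module.finrank ℝ R3 - 1))) := by
      rw [← mp.lintegral_comp (by fun_prop)]
      refine lintegral_congr fun y => ?_
      have hy : (y : R3) ≠ 0 := y.2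
      have e1 : ((homeomorphUnitSphereProd R3 y).2 : ℝ) = ‖(y : R3)‖ := by simp
      have e2 : radialProj (y : R3) = (homeomorphUnitSphereProd R3 y).1 := by
        ext1
        rw [coe_radialProj hy]
        simp
      rw [e1, e2]
    have h3 : (volume : Measure R3).toSphere = ENNReal.ofReal (4 * Real.pi) • vg := by
      have h4 : (0 : ℝ) < 4 * Real.pi := by positivity
      rw [vg, smul_smul, ← ENNReal.ofReal_mul h4.le, mul_inv_cancel₀ h4.ne',
        ENNReal.ofReal_one, one_smul]
    have h5 : Module.finrank ℝ R3 - 1 = 2 := by simp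
    rw [h1, h2, h3, h5]
    simp_rw [mul_comm (a _)]
    rw [lintegral_prod_mul (μ := ENNReal.ofReal (4 * Real.pi) • vg)
      (f := b) (g := fun r : Ioi (0 : ℝ) => a r) hb.aemeasurable (by fun_prop),
      lintegral_smul_measure, smul_eq_mul]
    ring
  have h1 := key (fun _ => 1) measurable_const
  simp only [mul_one, lintegral_const, measure_univ] at h1
  rw [key b hb, h1]

lemma map_radialProj_withDensity {a : ℝ → ℝ≥0∞} (ha : Measurable a) :
    ((volume : Measure R3).withDensity fun y => a ‖y‖).map radialProj =
      (∫⁻ y : R3, a ‖y‖) • vg := by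
  ext s hs
  rw [Measure.map_apply measurable_radialProj hs,
    withDensity_apply _ (measurable_radialProj hs), Measure.smul_apply, smul_eq_mul,
    ← lintegral_indicator_one hs, ← lintegral_norm_radialProj ha (measurable_one.indicator hs),
    ← lintegral_indicator (measurable_radialProj hs)]
  refine lintegral_congr fun y => ?_
  by_cases hy : radialProj y ∈ s <;> simp [indicator, hy]

lemma integral_norm_radialProj {a : ℝ → ℝ} (ha : Measurable a) (ha0 : ∀ r, 0 ≤ a r)
    (hai : Integrable fun y : R3 => a ‖y‖) {b : S2 → ℝ} (hb : Measurable b) :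
    ∫ y : R3, a ‖y‖ * b (radialProj y) = (∫ y : R3, a ‖y‖) * ∫ x, b x ∂vg := by
  have h := map_radialProj_withDensity (a := fun r => ENNReal.ofReal (a r)) (by fun_prop)
  have h1 : ∫ x, b x ∂(((volume : Measure R3).withDensity
      fun y => ENNReal.ofReal (a ‖y‖)).map radialProj) = ∫ y : R3, a ‖y‖ * b (radialProj y) := by
    rw [integral_map measurable_radialProj.aemeasurable hb.aestronglyMeasurable,
      integral_withDensity_eq_integral_toReal_smul (by fun_prop) (by simp)]
    simp [ENNReal.toReal_ofReal (ha0 _)]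
  rw [← h1, h, integral_smul_measure, smul_eq_mul,
    integral_eq_lintegral_of_nonneg_ae (.of_forall fun y => ha0 _) hai.1]

/-- The unit ball of `ℝ³` is symmetric and radial projection is odd; `v_g` is a multiple of the
image of Lebesgue measure on that ball. -/
lemma vg_map_neg : vg.map (fun x => -x) = vg := by
  have h := map_radialProj_withDensity (a := (Iio 1).indicator 1)
    (measurable_one.indicator measurableSet_Iio)
  have h0 : ∫⁻ y : R3, (Iio (1 : ℝ)).indicator (1 : ℝ → ℝ≥0∞) ‖y‖ = volume (ball (0 : R3) 1) := by
    rw [← lintegral_indicator_one measurableSet_ball]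
    refine lintegral_congr fun y => ?_
    simp [indicator]
  rw [h0] at h
  have hc : volume (ball (0 : R3) 1) ≠ 0 := (measure_ball_pos _ _ one_pos).ne'
  have hc' : volume (ball (0 : R3) 1) ≠ ⊤ := measure_ball_lt_top.ne
  have hn : Measurable fun x : S2 => -x := by fun_prop
  have key : (volume (ball (0 : R3) 1)) • vg.map (fun x => -x) = (volume (ball (0 : R3) 1)) • vg := by
    rw [← Measure.map_smul, ← h]
    ext s hs
    rw [Measure.map_apply hn hs, Measure.map_apply measurable_radialProj (hn hs),
      Measure.map_apply measurable_radialProj hs, withDensity_apply _ (measurable_radialProj (hn hs)),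
      withDensity_apply _ (measurable_radialProj hs),
      ← lintegral_indicator (measurable_radialProj (hn hs)),
      ← lintegral_indicator (measurable_radialProj hs),
      ← lintegral_neg_eq_self]
    refine lintegral_congr_ae ?_
    filter_upwards [compl_mem_ae_iff.2 (measure_singleton (0 : R3))] with y hy
    have hy : y ≠ 0 := hy
    have e : radialProj (-y) = - radialProj y := by
      ext1
      rw [coe_radialProj (neg_ne_zero.2 hy)]
      simp [coe_radialProj hy]
    have e2 : (-y ∈ radialProj ⁻¹' ((fun x : S2 => -x) ⁻¹' s)) ↔ y ∈ radialProj ⁻¹' s := by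
      simp only [mem_preimage, e, neg_neg]
    by_cases hs' : y ∈ radialProj ⁻¹' s
    · rw [indicator_of_mem hs', indicator_of_mem (e2.2 hs'), norm_neg]
    · rw [indicator_of_notMem hs', indicator_of_notMem (mt e2.1 hs')]
  ext s hs
  have := congrArg (fun m => m s) key
  simp only [Measure.smul_apply, smul_eq_mul] at this
  exact (ENNReal.mul_right_inj hc hc').1 this

/-! ### Poincaré inequalities on the line and their tensorization. -/

/-- The double integral `∬ (F x - F y)²`, twice the variance of `F` for a probability measure. -/
def spread {α : Type*} [MeasurableSpace α] (m : Measure α) (F : α → ℝ) : ℝ≥0∞ :=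
  ∫⁻ x, ∫⁻ y, ENNReal.ofReal ((F x - F y) ^ 2) ∂m ∂m

lemma lintegral_lintegral_swap_prob {α β : Type*} [MeasurableSpace α] [MeasurableSpace β]
    {m : Measure α} {ν : Measure β} [SFinite m] [SFinite ν] {G : α → β → ℝ≥0∞}
    (hG : Measurable (Function.uncurry G)) :
    ∫⁻ x, ∫⁻ y, G x y ∂ν ∂m = ∫⁻ y, ∫⁻ x, G x y ∂m ∂ν :=
  lintegral_lintegral_swap hG.aemeasurable

lemma spread_eq_prod {α : Type*} [MeasurableSpace α] {m : Measure α} [SFinite m] {F : α → ℝ}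
    (hF : Measurable F) :
    spread m F = ∫⁻ z : α × α, ENNReal.ofReal ((F z.1 - F z.2) ^ 2) ∂(m.prod m) := by
  rw [lintegral_prod _ (by fun_prop), spread]

/-- Subadditivity of `spread` over a product of probability measures. -/
lemma spread_prod_le {α β : Type*} [MeasurableSpace α] [MeasurableSpace β]
    {m : Measure α} {ν : Measure β} [IsProbabilityMeasure m] [IsProbabilityMeasure ν]
    {F : α × β → ℝ} (hF : Measurable F) :
    spread (m.prod ν) F ≤ (∫⁻ y, spread m (fun x => F (x, y)) ∂ν) +
      ∫⁻ x, spread ν (fun y => F (x, y)) ∂m := by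
  let Q : Measure (α × α) := m.prod m
  let R : Measure (β × β) := ν.prod ν
  let a : (α × α) × (β × β) → ℝ := fun z => F (z.1.1, z.2.1)
  let b : (α × α) × (β × β) → ℝ := fun z => F (z.1.1, z.2.2)
  let c : (α × α) × (β × β) → ℝ := fun z => F (z.1.2, z.2.1)
  let d : (α × α) × (β × β) → ℝ := fun z => F (z.1.2, z.2.2)
  have ha : Measurable a := by fun_prop
  have hb : Measurable b := by fun_prop
  have hc : Measurable c := by fun_prop
  have hd : Measurable d := by fun_prop
  let I : (((α × α) × (β × β)) → ℝ) → ((α × α) × (β × β) → ℝ) → ℝ≥0∞ :=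
    fun f g => ∫⁻ z, ENNReal.ofReal ((f z - g z) ^ 2) ∂(Q.prod R)
  -- The quadrilateral inequality: for four reals, the squares of the four sides exceed those of the
  -- two diagonals by `(a - b - c + d)²`. Each diagonal integrates to the full spread, each side to
  -- one of the partial spreads.
  have hsum : I a d + I b c ≤ (I a b + I c d) + (I a c + I b d) := by
    simp only [I]
    rw [← lintegral_add_left (by fun_prop), ← lintegral_add_left (by fun_prop),
      ← lintegral_add_left (by fun_prop), ← lintegral_add_left (by fun_prop)]
    refine lintegral_mono fun z => ?_
    simp only
    rw [← ENNReal.ofReal_add (by positivity) (by positivity),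
      ← ENNReal.ofReal_add (by positivity) (by positivity),
      ← ENNReal.ofReal_add (by positivity) (by positivity),
      ← ENNReal.ofReal_add (by positivity) (by positivity)]
    refine ENNReal.ofReal_le_ofReal ?_
    nlinarith [sq_nonneg (a z - b z - c z + d z)]
  have swQ : MeasurePreserving (Prod.swap : α × α → α × α) Q Q := Measure.measurePreserving_swap
  have swR : MeasurePreserving (Prod.swap : β × β → β × β) R R := Measure.measurePreserving_swap
  have had : spread (m.prod ν) F = I a d := by
    simp only [I, Q, R]
    rw [spread, lintegral_prod _ (by fun_prop), lintegral_prod _ (by fun_prop),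
      lintegral_prod _ (by fun_prop)]
    refine lintegral_congr fun x => ?_
    rw [lintegral_lintegral_swap_prob (by fun_prop)]
    rw [lintegral_prod _ (Measurable.aemeasurable (by fun_prop))]
    refine lintegral_congr fun x' => ?_
    rw [lintegral_prod_symm' _ (by fun_prop)]
  have hbc : I b c = I a d := by
    have mp : MeasurePreserving (Prod.map id Prod.swap : (α × α) × (β × β) → _) (Q.prod R) (Q.prod R) :=
      (MeasurePreserving.id Q).prod swR
    exact mp.lintegral_comp (f := fun z => ENNReal.ofReal ((a z - d z) ^ 2)) (by fun_prop)
  have hcd : I c d = I a b := by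
    have mp : MeasurePreserving (Prod.map Prod.swap id : (α × α) × (β × β) → _) (Q.prod R) (Q.prod R) :=
      swQ.prod (MeasurePreserving.id R)
    exact mp.lintegral_comp (f := fun z => ENNReal.ofReal ((a z - b z) ^ 2)) (by fun_prop)
  have hbd : I b d = I a c := by
    have mp : MeasurePreserving (Prod.map id Prod.swap : (α × α) × (β × β) → _) (Q.prod R) (Q.prod R) :=
      (MeasurePreserving.id Q).prod swR
    exact mp.lintegral_comp (f := fun z => ENNReal.ofReal ((a z - c z) ^ 2)) (by fun_prop)
  have hab : I a b = ∫⁻ x, spread ν (fun y => F (x, y)) ∂m := by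
    simp only [I, Q]
    rw [lintegral_prod _ (by fun_prop), lintegral_prod _ (by fun_prop)]
    refine lintegral_congr fun x => ?_
    simp only [a, b, lintegral_const, measure_univ, mul_one]
    rw [spread_eq_prod (by fun_prop)]
  have hac : I a c = ∫⁻ y, spread m (fun x => F (x, y)) ∂ν := by
    simp only [I, R]
    rw [lintegral_prod_symm' _ (by fun_prop), lintegral_prod _ (by fun_prop)]
    refine lintegral_congr fun x => ?_
    simp only [a, c, lintegral_const, measure_univ, mul_one]
    rw [spread_eq_prod (by fun_prop)]
  rw [hbc, hcd, hbd, ← had, hab, hac] at hsum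
  set s := spread (m.prod ν) F
  set t := ∫⁻ x, spread ν (fun y => F (x, y)) ∂m
  set u := ∫⁻ y, spread m (fun x => F (x, y)) ∂ν
  have : 2 * s ≤ 2 * (u + t) := by
    calc 2 * s = s + s := two_mul s
      _ ≤ t + t + (u + u) := hsum
      _ = 2 * (u + t) := by ring
  exact (ENNReal.mul_le_mul_iff_right (by simp) (by simp)).1 this

/-- Cauchy–Schwarz for `f s - f t = ∫ f'`, obtained by expanding the integral of the square of `f'`
minus its mean slope. -/
lemma sq_sub_le_integral {f f' : ℝ → ℝ} (hf : ∀ x, HasDerivAt f (f' x) x) (hf' : Continuous f')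
    (s t : ℝ) : ENNReal.ofReal ((f s - f t) ^ 2) ≤
      ENNReal.ofReal |s - t| * ∫⁻ u in Set.uIoc s t, ENNReal.ofReal (f' u ^ 2) := by
  wlog hst : s ≤ t generalizing s t
  · have := this t s (le_of_not_ge hst)
    rwa [abs_sub_comm, Set.uIoc_comm, show (f t - f s) ^ 2 = (f s - f t) ^ 2 by ring] at this
  rcases hst.eq_or_lt with rfl | hst'
  · simp
  have h1 : ∫ u in s..t, f' u = f t - f s :=
    (intervalIntegral.integral_eq_sub_of_hasDerivAt (fun x _ => hf x)
      (hf'.intervalIntegrable _ _))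
  set c := (f t - f s) / (t - s)
  have hts : 0 < t - s := sub_pos.2 hst'
  have h2 : 0 ≤ ∫ u in s..t, (f' u - c) ^ 2 :=
    intervalIntegral.integral_nonneg hst fun u _ => sq_nonneg _
  have h3 : ∫ u in s..t, (f' u - c) ^ 2 =
      (∫ u in s..t, f' u ^ 2) - 2 * c * (f t - f s) + c ^ 2 * (t - s) := by
    have : ∀ u, (f' u - c) ^ 2 = f' u ^ 2 - 2 * c * f' u + c ^ 2 := fun u => by ring
    simp only [this]
    rw [intervalIntegral.integral_add, intervalIntegral.integral_sub,
      intervalIntegral.integral_const_mul, h1]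
    · simp [mul_comm]
    all_goals exact Continuous.intervalIntegrable (by fun_prop) _ _
  have hc : c * (t - s) = f t - f s := div_mul_cancel₀ _ hts.ne'
  have h4 : (f s - f t) ^ 2 ≤ (t - s) * ∫ u in s..t, f' u ^ 2 := by
    rw [h3] at h2
    have : (t - s) * ((∫ u in s..t, f' u ^ 2) - 2 * c * (f t - f s) + c ^ 2 * (t - s)) =
      (t - s) * (∫ u in s..t, f' u ^ 2) - (f s - f t) ^ 2 := by
      rw [← hc] ; rw [show f s - f t = - (c * (t - s)) by rw [hc]; ring]; ring
    nlinarith [mul_nonneg hts.le h2]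
  rw [abs_sub_comm, abs_of_pos hts, Set.uIoc_of_le hst,
    ← ofReal_integral_eq_lintegral_ofReal, ← ENNReal.ofReal_mul hts.le,
    ← intervalIntegral.integral_of_le hst]
  · exact ENNReal.ofReal_le_ofReal h4
  · exact (Continuous.integrableOn_Icc (by fun_prop)).mono_set Ioc_subset_Icc_self
  · exact .of_forall fun u => sq_nonneg _

/-- Spread is dominated by the Dirichlet integral with the kernel of the measure as weight. -/
lemma spread_le_kernel (ν : Measure ℝ) [IsProbabilityMeasure ν] {f f' : ℝ → ℝ}
    (hf : ∀ x, HasDerivAt f (f' x) x) (hf' : Continuous f') :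
    spread ν f ≤ ∫⁻ u, ENNReal.ofReal (f' u ^ 2) *
      (∫⁻ s, ∫⁻ t, ENNReal.ofReal |s - t| * (Set.uIoc s t).indicator 1 u ∂ν ∂ν) := by
  have hm : Measurable fun z : ℝ × ℝ × ℝ => ENNReal.ofReal |z.2.1 - z.2.2| *
      (Set.uIoc z.2.1 z.2.2).indicator (1 : ℝ → ℝ≥0∞) z.1 := by
    refine Measurable.mul (by fun_prop) ?_
    have : (fun z : ℝ × ℝ × ℝ => (Set.uIoc z.2.1 z.2.2).indicator (1 : ℝ → ℝ≥0∞) z.1) =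
      ({z : ℝ × ℝ × ℝ | min z.2.1 z.2.2 < z.1} ∩ {z | z.1 ≤ max z.2.1 z.2.2}).indicator 1 := by
      funext z
      simp [indicator, Set.uIoc, mem_Ioc]
    rw [this]
    exact measurable_one.indicator ((measurableSet_lt (by fun_prop) (by fun_prop)).inter
      (measurableSet_le (by fun_prop) (by fun_prop)))
  have hfm : Measurable f' := hf'.measurable
  have hpt : ∀ s t, ENNReal.ofReal ((f s - f t) ^ 2) ≤ ∫⁻ u, ENNReal.ofReal (f' u ^ 2) *
      (ENNReal.ofReal |s - t| * (Set.uIoc s t).indicator 1 u) := by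
    intro s t
    refine (sq_sub_le_integral hf hf' s t).trans (le_of_eq ?_)
    rw [← lintegral_indicator measurableSet_uIoc, ← lintegral_const_mul]
    · refine lintegral_congr fun u => ?_
      by_cases hu : u ∈ Set.uIoc s t <;> simp [hu, mul_comm]
    · exact Measurable.indicator (by fun_prop) measurableSet_uIoc
  have hm2 : ∀ s t, Measurable fun u => ENNReal.ofReal |s - t| *
      (Set.uIoc s t).indicator (1 : ℝ → ℝ≥0∞) u := fun s t =>
    hm.comp (show Measurable fun u : ℝ => (u, s, t) by fun_prop)
  calc spread ν f ≤ ∫⁻ s, ∫⁻ t, (∫⁻ u, ENNReal.ofReal (f' u ^ 2) *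
      (ENNReal.ofReal |s - t| * (Set.uIoc s t).indicator 1 u)) ∂ν ∂ν := by
        exact lintegral_mono fun s => lintegral_mono fun t => hpt s t
    _ = ∫⁻ z : ℝ × ℝ, (∫⁻ u, ENNReal.ofReal (f' u ^ 2) *
      (ENNReal.ofReal |z.1 - z.2| * (Set.uIoc z.1 z.2).indicator 1 u)) ∂(ν.prod ν) := by
        rw [lintegral_prod]
        refine Measurable.aemeasurable (Measurable.lintegral_prod_right' (f := fun z : (ℝ × ℝ) × ℝ =>
          ENNReal.ofReal (f' z.2 ^ 2) * (ENNReal.ofReal |z.1.1 - z.1.2| *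
            (Set.uIoc z.1.1 z.1.2).indicator 1 z.2)) ?_)
        exact Measurable.mul (by fun_prop)
          (hm.comp (show Measurable fun z : (ℝ × ℝ) × ℝ => (z.2, z.1) by fun_prop))
    _ = ∫⁻ u, ∫⁻ z : ℝ × ℝ, ENNReal.ofReal (f' u ^ 2) *
      (ENNReal.ofReal |z.1 - z.2| * (Set.uIoc z.1 z.2).indicator 1 u) ∂(ν.prod ν) := by
        refine lintegral_lintegral_swap_prob ?_
        exact Measurable.mul (by fun_prop)
          (hm.comp (show Measurable fun z : (ℝ × ℝ) × ℝ => (z.2, z.1) by fun_prop))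
    _ = _ := by
        refine lintegral_congr fun u => ?_
        have hu : Measurable fun z : ℝ × ℝ => ENNReal.ofReal |z.1 - z.2| *
            (Set.uIoc z.1 z.2).indicator (1 : ℝ → ℝ≥0∞) u :=
          hm.comp (show Measurable fun z : ℝ × ℝ => (u, z) by fun_prop)
        rw [lintegral_const_mul _ hu, lintegral_prod _ hu.aemeasurable]

/-- A Poincaré inequality with constant `K` for a measure on the line, in terms of `spread`. -/
def HasPoincare (ν : Measure ℝ) (K : ℝ≥0∞) : Prop :=
  ∀ f f' : ℝ → ℝ, (∀ x, HasDerivAt f (f' x) x) → Continuous f' →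
    spread ν f ≤ K * ∫⁻ x, ENNReal.ofReal (f' x ^ 2) ∂ν

/-- After Cauchy–Schwarz and Fubini only the weight of `f'(u)²` matters, so a one-dimensional
Poincaré inequality reduces to a pointwise comparison of that kernel with the density. -/
lemma hasPoincare_withDensity {ρ : ℝ → ℝ≥0∞} (hρ : Measurable ρ) {K : ℝ≥0∞}
    [IsProbabilityMeasure (volume.withDensity ρ)]
    (h : ∀ u, ∫⁻ s, ∫⁻ t, ENNReal.ofReal |s - t| * (Set.uIoc s t).indicator 1 u
      ∂(volume.withDensity ρ) ∂(volume.withDensity ρ) ≤ K * ρ u) :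
    HasPoincare (volume.withDensity ρ) K := by
  intro f f' hf hf'
  refine (spread_le_kernel _ hf hf').trans ?_
  rw [lintegral_withDensity_eq_lintegral_mul _ hρ (by fun_prop), ← lintegral_const_mul _ (by fun_prop)]
  refine lintegral_mono fun u => ?_
  calc _ ≤ ENNReal.ofReal (f' u ^ 2) * (K * ρ u) := by gcongr; exact h u
    _ = _ := by simp only [Pi.mul_apply]; ring

lemma kernel_le (s t u : ℝ) : ENNReal.ofReal |s - t| * (Set.uIoc s t).indicator 1 u ≤
    (ENNReal.ofReal (s - u) * (Iio u).indicator 1 t + (Ici u).indicator 1 s * ENNReal.ofReal (u - t))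
    + (ENNReal.ofReal (u - s) * (Ici u).indicator 1 t +
      (Iio u).indicator 1 s * ENNReal.ofReal (t - u)) := by
  by_cases hu : u ∈ Set.uIoc s t
  · rw [indicator_of_mem hu, Pi.one_apply, mul_one]
    rcases Set.mem_uIoc.1 hu with ⟨h1, h2⟩ | ⟨h1, h2⟩
    · rw [indicator_of_mem (show t ∈ Ici u from h2), indicator_of_mem (show s ∈ Iio u from h1)]
      simp only [Pi.one_apply, mul_one, one_mul]
      rw [← ENNReal.ofReal_add (by linarith) (by linarith), abs_sub_comm, abs_of_nonneg (by linarith)]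
      refine le_add_left (le_of_eq ?_)
      congr 1; ring
    · rw [indicator_of_mem (show s ∈ Ici u from h2), indicator_of_mem (show t ∈ Iio u from h1)]
      simp only [Pi.one_apply, mul_one, one_mul]
      rw [← ENNReal.ofReal_add (by linarith) (by linarith), abs_of_nonneg (by linarith)]
      refine le_add_right (le_of_eq ?_)
      congr 1; ring
  · simp [hu]

/-- If `u` separates `s` and `t`, then `|s - t| = |s - u| + |u - t|`, and each summand depends on
one variable only. The kernel is thus expressed through first moments and masses of the two
half-lines. -/
lemma lintegral_kernel_le (ν : Measure ℝ) [IsProbabilityMeasure ν] (u : ℝ) :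
    ∫⁻ s, ∫⁻ t, ENNReal.ofReal |s - t| * (Set.uIoc s t).indicator 1 u ∂ν ∂ν ≤
      2 * ((∫⁻ s, ENNReal.ofReal (s - u) ∂ν) * ν (Iio u) +
        ν (Ici u) * ∫⁻ s, ENNReal.ofReal (u - s) ∂ν) := by
  have hA : Measurable ((Ici u).indicator (1 : ℝ → ℝ≥0∞)) :=
    measurable_one.indicator measurableSet_Ici
  have hB : Measurable ((Iio u).indicator (1 : ℝ → ℝ≥0∞)) :=
    measurable_one.indicator measurableSet_Iio
  refine (lintegral_mono fun s => lintegral_mono fun t => kernel_le s t u).trans (le_of_eq ?_)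
  have : ∀ s, ∫⁻ t, (ENNReal.ofReal (s - u) * (Iio u).indicator 1 t +
      (Ici u).indicator 1 s * ENNReal.ofReal (u - t))
    + (ENNReal.ofReal (u - s) * (Ici u).indicator 1 t +
      (Iio u).indicator 1 s * ENNReal.ofReal (t - u)) ∂ν =
      (ENNReal.ofReal (s - u) * ν (Iio u) + (Ici u).indicator 1 s * ∫⁻ t, ENNReal.ofReal (u - t) ∂ν)
    + (ENNReal.ofReal (u - s) * ν (Ici u) +
      (Iio u).indicator 1 s * ∫⁻ t, ENNReal.ofReal (t - u) ∂ν) := by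
    intro s
    rw [lintegral_add_left (by fun_prop), lintegral_add_left (by fun_prop),
      lintegral_add_left (by fun_prop), lintegral_const_mul _ (by fun_prop),
      lintegral_const_mul _ (by fun_prop), lintegral_const_mul _ (by fun_prop),
      lintegral_const_mul _ (by fun_prop), lintegral_indicator_one measurableSet_Iio,
      lintegral_indicator_one measurableSet_Ici]
  simp only [this]
  rw [lintegral_add_left (by fun_prop), lintegral_add_left (by fun_prop),
    lintegral_add_left (by fun_prop), lintegral_mul_const _ (by fun_prop),
    lintegral_mul_const _ (by fun_prop), lintegral_mul_const _ (by fun_prop),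
    lintegral_mul_const _ (by fun_prop), lintegral_indicator_one measurableSet_Iio,
    lintegral_indicator_one measurableSet_Ici]
  ring

-- With `G = E(s - u)⁺`, `H = E(u - s)⁺` and `a` the mass of `[u, ∞)`, centring gives `H = G + u`,
-- and `φ' = -sφ` gives `G = φ(u) - u a`. Therefore `G (1 - a) + a H = φ(u)`: the kernel bound is
-- exactly twice the density. The constant `2` for the spread means the sharp constant `1` for the
-- variance, which is needed for the sharp constant on the sphere.
open ProbabilityTheory in
lemma hasPoincare_gaussian : HasPoincare (gaussianReal 0 1) 2 := by
  have hν : gaussianReal 0 1 = volume.withDensity (gaussianPDF 0 1) :=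
    gaussianReal_of_var_ne_zero 0 one_ne_zero
  have : IsProbabilityMeasure (volume.withDensity (gaussianPDF 0 1)) := hν ▸ inferInstance
  rw [hν]
  refine hasPoincare_withDensity (measurable_gaussianPDF 0 1) fun u => ?_
  refine (lintegral_kernel_le _ u).trans ?_
  rw [← hν]
  gcongr
  set ν := gaussianReal 0 1
  set φ := gaussianPDFReal 0 1
  have hφd : ∀ x, HasDerivAt (fun x => - φ x) (x * φ x) x := by
    intro x
    have hφ : ∀ y, φ y = (√(2 * Real.pi * (1 : NNReal)))⁻¹ *
        Real.exp (-(y ^ 2) / (2 * (1 : NNReal))) := fun y => by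
      simp [φ, gaussianPDFReal_def]
    simp only [hφ]
    have h := (((hasDerivAt_pow 2 x).neg.div_const (2 * ((1 : NNReal) : ℝ))).exp.const_mul
      (√(2 * Real.pi * (1 : NNReal)))⁻¹).neg
    refine h.congr_deriv ?_
    simp only [Pi.neg_apply]
    push_cast
    ring
  have hint : Integrable (fun s : ℝ => s) ν :=
    (memLp_id_gaussianReal (μ := 0) (v := 1) 1).integrable le_rfl
  have hmean : ∫ s, s ∂ν = 0 := by simp [ν]
  have hpos : Integrable (fun s => max (s - u) 0) ν :=
    (hint.sub (integrable_const u)).pos_part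
  have hneg : Integrable (fun s => max (u - s) 0) ν :=
    ((integrable_const u).sub hint).pos_part
  set G := ∫ s, max (s - u) 0 ∂ν
  set H := ∫ s, max (u - s) 0 ∂ν
  set a := ν.real (Ici u)
  have hb : ν.real (Iio u) = 1 - a := by
    rw [← Set.compl_Ici, measureReal_compl measurableSet_Ici, probReal_univ]
  have hG : ∫⁻ s, ENNReal.ofReal (s - u) ∂ν = ENNReal.ofReal G := by
    rw [ofReal_integral_eq_lintegral_ofReal hpos (.of_forall fun s => le_max_right _ _)]
    refine lintegral_congr fun s => ?_
    rw [ENNReal.ofReal_max]; simp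
  have hH : ∫⁻ s, ENNReal.ofReal (u - s) ∂ν = ENNReal.ofReal H := by
    rw [ofReal_integral_eq_lintegral_ofReal hneg (.of_forall fun s => le_max_right _ _)]
    refine lintegral_congr fun s => ?_
    rw [ENNReal.ofReal_max]; simp
  have hGH : G - H = - u := by
    rw [← integral_sub hpos hneg]
    have : ∀ s : ℝ, max (s - u) 0 - max (u - s) 0 = s - u := by
      intro s
      rcases le_total s u with h | h
      · rw [max_eq_right (by linarith), max_eq_left (by linarith)]; ring
      · rw [max_eq_left (by linarith), max_eq_right (by linarith)]; ring
    simp only [this]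
    rw [integral_sub hint (integrable_const u), hmean]
    simp
  have hφi : Integrable φ := integrable_gaussianPDFReal 0 1
  have hsφ : Integrable fun s => s * φ s := by
    have := (integrable_withDensity_iff_integrable_smul' (μ := volume) (f := gaussianPDF 0 1)
      (measurable_gaussianPDF 0 1) (by simp [gaussianPDF])).1 (hν ▸ hint)
    refine this.congr (.of_forall fun s => ?_)
    simp [φ, toReal_gaussianPDF, mul_comm]
  have htail : Tendsto (fun x => - φ x) atTop (𝓝 0) := by
    have h1 : Tendsto (fun x : ℝ => Real.exp (-(x - 0) ^ 2 / (2 * ((1 : NNReal) : ℝ)))) atTop (𝓝 0) := by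
      refine Real.tendsto_exp_atBot.comp ?_
      have h2 : Tendsto (fun x : ℝ => x ^ 2 / 2) atTop atTop :=
        (tendsto_pow_atTop two_ne_zero).atTop_div_const two_pos
      refine (tendsto_neg_atTop_atBot.comp h2).congr fun x => ?_
      simp [neg_div]
    have h3 := (h1.const_mul (√(2 * Real.pi * (1 : NNReal)))⁻¹).neg
    simpa [φ, gaussianPDFReal_def] using h3
  have hGval : G = φ u - u * a := by
    have h1 : ∫ s in Ioi u, s * φ s = φ u := by
      have := integral_Ioi_of_hasDerivAt_of_tendsto' (f := fun x => - φ x) (a := u)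
        (fun x _ => hφd x) hsφ.integrableOn htail
      rw [this]; ring
    have h2 : a = ∫ s in Ioi u, φ s := by
      have : ν (Ici u) = ENNReal.ofReal (∫ s in Ioi u, φ s) := by
        rw [gaussianReal_apply_eq_integral 0 one_ne_zero, integral_Ici_eq_integral_Ioi]
      rw [show a = (ν (Ici u)).toReal from rfl, this, ENNReal.toReal_ofReal]
      exact integral_nonneg fun s => gaussianPDFReal_nonneg _ _ _
    have h3 : G = ∫ s in Ioi u, (s * φ s - u * φ s) := by
      rw [← integral_indicator measurableSet_Ioi]
      simp only [G, ν]
      rw [integral_gaussianReal_eq_integral_smul one_ne_zero]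
      refine integral_congr_ae (.of_forall fun s => ?_)
      by_cases hs : s ∈ Ioi u
      · rw [indicator_of_mem hs]
        simp only [smul_eq_mul]
        rw [max_eq_left (by linarith [mem_Ioi.1 hs])]
        simp only [φ]; ring
      · rw [indicator_of_notMem hs]
        simp only [smul_eq_mul]
        rw [max_eq_right (by linarith [notMem_Ioi.1 hs]), mul_zero]
    rw [h3, integral_sub hsφ.integrableOn (hφi.const_mul u).integrableOn, h1, integral_const_mul, h2]
  have hG0 : 0 ≤ G := integral_nonneg fun s => le_max_right _ _
  have hH0 : 0 ≤ H := integral_nonneg fun s => le_max_right _ _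
  rw [hG, hH, ← ofReal_measureReal, ← ofReal_measureReal, hb,
    ← ENNReal.ofReal_mul hG0, ← ENNReal.ofReal_mul measureReal_nonneg,
    ← ENNReal.ofReal_add (mul_nonneg hG0 (hb ▸ measureReal_nonneg))
      (mul_nonneg measureReal_nonneg hH0)]
  refine ENNReal.ofReal_le_ofReal (le_of_eq ?_)
  have : H = G + u := by linarith
  rw [this, hGval]
  change _ = φ u
  ring

/-- Here the crude bound `|s - t| ≤ h` suffices: the kernel is at most `h` on the interval, which is
`h²` times the density. Only the decay as `h → 0` will be used. -/
lemma hasPoincare_uniform (a : ℝ) {h : ℝ} (hh : 0 < h) :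
    HasPoincare (volume.withDensity ((Ico a (a + h)).indicator fun _ => ENNReal.ofReal h⁻¹))
      (ENNReal.ofReal (h ^ 2)) := by
  set ρ : ℝ → ℝ≥0∞ := (Ico a (a + h)).indicator fun _ => ENNReal.ofReal h⁻¹
  have hρ : Measurable ρ := measurable_const.indicator measurableSet_Ico
  have : IsProbabilityMeasure (volume.withDensity ρ) := by
    constructor
    rw [withDensity_apply _ MeasurableSet.univ, setLIntegral_univ, lintegral_indicator measurableSet_Ico,
      lintegral_const, Measure.restrict_apply_univ, Real.volume_Ico, ← ENNReal.ofReal_mul (by positivity),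
      show h⁻¹ * (a + h - a) = 1 by field_simp; ring, ENNReal.ofReal_one]
  refine hasPoincare_withDensity hρ fun u => ?_
  have hae : ∀ᵐ s ∂(volume.withDensity ρ), s ∈ Ico a (a + h) := by
    rw [ae_withDensity_iff hρ]
    refine .of_forall fun s hs => ?_
    by_contra hc
    exact hs (indicator_of_notMem hc _)
  calc _ ≤ ∫⁻ s, ∫⁻ t, ENNReal.ofReal h * (Ico a (a + h)).indicator 1 u
        ∂(volume.withDensity ρ) ∂(volume.withDensity ρ) := by
        refine lintegral_mono_ae ?_
        filter_upwards [hae] with s hs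
        refine lintegral_mono_ae ?_
        filter_upwards [hae] with t ht
        by_cases hu : u ∈ Set.uIoc s t
        · have hu' : u ∈ Ico a (a + h) := by
            rcases Set.mem_uIoc.1 hu with h1 | h1
            · exact ⟨by linarith [hs.1, h1.1], by linarith [ht.2, h1.2]⟩
            · exact ⟨by linarith [ht.1, h1.1], by linarith [hs.2, h1.2]⟩
          rw [indicator_of_mem hu, indicator_of_mem hu']
          gcongr
          rw [abs_le]
          constructor <;> linarith [hs.1, hs.2, ht.1, ht.2]
        · simp [hu]
    _ = ENNReal.ofReal h * (Ico a (a + h)).indicator 1 u := by simp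
    _ = ENNReal.ofReal (h ^ 2) * ρ u := by
        by_cases hu : u ∈ Ico a (a + h)
        · simp only [ρ, indicator_of_mem hu, Pi.one_apply, mul_one]
          rw [← ENNReal.ofReal_mul (by positivity)]
          congr 1
          field_simp
        · simp [ρ, hu]
    _ ≤ _ := le_rfl

/-- Tensorization of the Poincaré inequality. -/
lemma spread_prod_prod_le {ν₁ ν₂ ν₃ : Measure ℝ} [IsProbabilityMeasure ν₁] [IsProbabilityMeasure ν₂]
    [IsProbabilityMeasure ν₃] {K : ℝ≥0∞} (h₁ : HasPoincare ν₁ K) (h₂ : HasPoincare ν₂ K)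
    (h₃ : HasPoincare ν₃ K) {F : ℝ × ℝ × ℝ → ℝ} (hF : Measurable F) {G₁ G₂ G₃ : ℝ × ℝ × ℝ → ℝ}
    (hG₁ : Measurable G₁) (hG₂ : Measurable G₂) (hG₃ : Measurable G₃)
    (d₁ : ∀ᵐ w ∂(ν₂.prod ν₃), (∀ x, HasDerivAt (fun x => F (x, w)) (G₁ (x, w)) x) ∧
      Continuous fun x => G₁ (x, w))
    (d₂ : ∀ᵐ x ∂ν₁, ∀ᵐ z ∂ν₃, (∀ y, HasDerivAt (fun y => F (x, y, z)) (G₂ (x, y, z)) y) ∧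
      Continuous fun y => G₂ (x, y, z))
    (d₃ : ∀ᵐ x ∂ν₁, ∀ᵐ y ∂ν₂, (∀ z, HasDerivAt (fun z => F (x, y, z)) (G₃ (x, y, z)) z) ∧
      Continuous fun z => G₃ (x, y, z)) :
    spread (ν₁.prod (ν₂.prod ν₃)) F ≤
      K * ∫⁻ w, ENNReal.ofReal (G₁ w ^ 2 + G₂ w ^ 2 + G₃ w ^ 2) ∂(ν₁.prod (ν₂.prod ν₃)) := by
  have e₁ : ∫⁻ w, spread ν₁ (fun x => F (x, w)) ∂(ν₂.prod ν₃) ≤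
      K * ∫⁻ w, ENNReal.ofReal (G₁ w ^ 2) ∂(ν₁.prod (ν₂.prod ν₃)) := by
    rw [lintegral_prod_symm' (fun w => ENNReal.ofReal (G₁ w ^ 2)) (by fun_prop),
      ← lintegral_const_mul _ (Measurable.lintegral_prod_left'
        (f := fun w : ℝ × ℝ × ℝ => ENNReal.ofReal (G₁ w ^ 2)) (by fun_prop))]
    refine lintegral_mono_ae ?_
    filter_upwards [d₁] with w hw
    exact h₁ _ _ hw.1 hw.2
  have e₂ : ∀ᵐ x ∂ν₁, ∫⁻ z, spread ν₂ (fun y => F (x, y, z)) ∂ν₃ ≤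
      K * ∫⁻ w, ENNReal.ofReal (G₂ (x, w) ^ 2) ∂(ν₂.prod ν₃) := by
    filter_upwards [d₂] with x hx
    rw [lintegral_prod_symm' (fun w => ENNReal.ofReal (G₂ (x, w) ^ 2)) (by fun_prop),
      ← lintegral_const_mul _ (Measurable.lintegral_prod_left'
        (f := fun w : ℝ × ℝ => ENNReal.ofReal (G₂ (x, w) ^ 2)) (by fun_prop))]
    refine lintegral_mono_ae ?_
    filter_upwards [hx] with z hz
    exact h₂ _ _ hz.1 hz.2
  have e₃ : ∀ᵐ x ∂ν₁, ∫⁻ y, spread ν₃ (fun z => F (x, y, z)) ∂ν₂ ≤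
      K * ∫⁻ w, ENNReal.ofReal (G₃ (x, w) ^ 2) ∂(ν₂.prod ν₃) := by
    filter_upwards [d₃] with x hx
    rw [lintegral_prod (fun w => ENNReal.ofReal (G₃ (x, w) ^ 2)) (by fun_prop),
      ← lintegral_const_mul _ (Measurable.lintegral_prod_right'
        (f := fun w : ℝ × ℝ => ENNReal.ofReal (G₃ (x, w) ^ 2)) (by fun_prop))]
    refine lintegral_mono_ae ?_
    filter_upwards [hx] with z hz
    exact h₃ _ _ hz.1 hz.2
  have e₄ : ∫⁻ x, spread (ν₂.prod ν₃) (fun w => F (x, w)) ∂ν₁ ≤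
      ∫⁻ x, (K * ∫⁻ w, ENNReal.ofReal (G₂ (x, w) ^ 2) ∂(ν₂.prod ν₃) +
        K * ∫⁻ w, ENNReal.ofReal (G₃ (x, w) ^ 2) ∂(ν₂.prod ν₃)) ∂ν₁ := by
    refine lintegral_mono_ae ?_
    filter_upwards [e₂, e₃] with x hx hx'
    exact (spread_prod_le (by fun_prop)).trans (add_le_add hx hx')
  refine (spread_prod_le hF).trans ((add_le_add e₁ e₄).trans (le_of_eq ?_))
  have e₅ : ∀ w, ENNReal.ofReal (G₁ w ^ 2 + G₂ w ^ 2 + G₃ w ^ 2) = ENNReal.ofReal (G₁ w ^ 2) +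
      ENNReal.ofReal (G₂ w ^ 2) + ENNReal.ofReal (G₃ w ^ 2) := fun w => by
    rw [ENNReal.ofReal_add (by positivity) (by positivity),
      ENNReal.ofReal_add (by positivity) (by positivity)]
  simp only [e₅]
  have m₂ : Measurable fun x => ∫⁻ w, ENNReal.ofReal (G₂ (x, w) ^ 2) ∂(ν₂.prod ν₃) :=
    Measurable.lintegral_prod_right' (f := fun w : ℝ × ℝ × ℝ => ENNReal.ofReal (G₂ w ^ 2)) (by fun_prop)
  have m₃ : Measurable fun x => ∫⁻ w, ENNReal.ofReal (G₃ (x, w) ^ 2) ∂(ν₂.prod ν₃) :=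
    Measurable.lintegral_prod_right' (f := fun w : ℝ × ℝ × ℝ => ENNReal.ofReal (G₃ w ^ 2)) (by fun_prop)
  rw [lintegral_add_left (m₂.const_mul K), lintegral_const_mul _ m₂, lintegral_const_mul _ m₃,
    lintegral_add_left (by fun_prop), lintegral_add_left (by fun_prop), mul_add, mul_add,
    lintegral_prod (fun w => ENNReal.ofReal (G₂ w ^ 2)) (by fun_prop),
    lintegral_prod (fun w => ENNReal.ofReal (G₃ w ^ 2)) (by fun_prop), add_assoc]

/-! ### Poincaré inequalities in `ℝ³`. -/

/-- The point of `ℝ³` with the given coordinates. -/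
def ofCoords (w : ℝ × ℝ × ℝ) : R3 := !₂[w.1, w.2.1, w.2.2]

lemma measurePreserving_ofCoords : MeasurePreserving ofCoords := by
  have h1 := (volume_preserving_piFinSuccAbove (fun _ : Fin 3 => ℝ) 0).symm
  have h2 := (volume_preserving_finTwoArrow ℝ).symm
  have h3 := (EuclideanSpace.volume_preserving_symm_measurableEquiv_toLp (Fin 3)).symm
  have h4 : MeasurePreserving (Prod.map id (MeasurableEquiv.finTwoArrow (α := ℝ)).symm)
    (volume : Measure (ℝ × ℝ × ℝ)) (volume : Measure (ℝ × (Fin 2 → ℝ))) :=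
    (MeasurePreserving.id volume).prod h2
  have h5 := h3.comp (h1.comp h4)
  have h6 : ofCoords = (MeasurableEquiv.toLp 2 (Fin 3 → ℝ)).symm.symm ∘
      ((MeasurableEquiv.piFinSuccAbove (fun _ : Fin 3 => ℝ) 0).symm ∘
        Prod.map id (MeasurableEquiv.finTwoArrow (α := ℝ)).symm) := by
    funext w
    ext i
    fin_cases i <;> rfl
  rw [h6]
  exact h5

@[fun_prop]
lemma measurable_ofCoords : Measurable ofCoords := measurePreserving_ofCoords.measurable

lemma spread_map {α β : Type*} [MeasurableSpace α] [MeasurableSpace β] {m : Measure α} [SFinite m]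
    {e : α → β} (he : Measurable e) {F : β → ℝ} (hF : Measurable F) :
    spread (m.map e) F = spread m (F ∘ e) := by
  rw [spread, lintegral_map _ he]
  · refine lintegral_congr fun x => ?_
    rw [lintegral_map (by fun_prop) he]
    rfl
  · exact Measurable.lintegral_prod_right' (f := fun z : β × β => ENNReal.ofReal ((F z.1 - F z.2) ^ 2))
      (by fun_prop)

lemma ofCoords_ne_zero {w : ℝ × ℝ × ℝ} (h : w.1 ≠ 0 ∨ w.2.1 ≠ 0) : ofCoords w ≠ 0 := by
  intro h0
  have e0 : w.1 = 0 := congrArg (fun y : R3 => y 0) h0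
  have e1 : w.2.1 = 0 := congrArg (fun y : R3 => y 1) h0
  tauto

lemma norm_gradient_sq (F : R3 → ℝ) (y : R3) : ‖gradient F y‖ ^ 2 =
    fderiv ℝ F y (EuclideanSpace.single 0 1) ^ 2 + fderiv ℝ F y (EuclideanSpace.single 1 1) ^ 2 +
      fderiv ℝ F y (EuclideanSpace.single 2 1) ^ 2 := by
  have h : ∀ i, gradient F y i = fderiv ℝ F y (EuclideanSpace.single i 1) := by
    intro i
    have h2 := EuclideanSpace.inner_single_right (𝕜 := ℝ) i 1 (gradient F y)
    rw [gradient, InnerProductSpace.toDual_symm_apply] at h2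
    simpa [gradient] using h2.symm
  rw [EuclideanSpace.norm_sq_eq, Fin.sum_univ_three, h, h, h]
  simp

lemma hasDerivAt_slice {F : R3 → ℝ} {c : ℝ → R3} {v : R3} (hc : ∀ x, HasDerivAt c v x)
    (hF : ∀ x, ContDiffAt ℝ 1 F (c x)) :
    (∀ x, HasDerivAt (fun x => F (c x)) (fderiv ℝ F (c x) v) x) ∧
      Continuous fun x => fderiv ℝ F (c x) v := by
  refine ⟨fun x => ((hF x).differentiableAt one_ne_zero).hasFDerivAt.comp_hasDerivAt x (hc x), ?_⟩
  have hcc : Continuous c := continuous_iff_continuousAt.2 fun x => (hc x).continuousAt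
  have : Continuous fun x => fderiv ℝ F (c x) := continuous_iff_continuousAt.2 fun x =>
    ContinuousAt.comp (f := c) ((hF x).fderiv_right (m := 0) (by simp)).continuousAt hcc.continuousAt
  exact this.clm_apply continuous_const

lemma hasDerivAt_line (a v : R3) (x : ℝ) : HasDerivAt (fun x : ℝ => a + x • v) v x := by
  simpa using ((hasDerivAt_id x).smul_const v).const_add a

/-- The Poincaré inequality in `ℝ³` for products of measures on the line, for functions which
are `C¹` away from the origin. -/
lemma spread_le_gradient {ν₁ ν₂ ν₃ : Measure ℝ} [IsProbabilityMeasure ν₁] [IsProbabilityMeasure ν₂]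
    [IsProbabilityMeasure ν₃] (hν₁ : ν₁ {0} = 0) (hν₂ : ν₂ {0} = 0)
    {K : ℝ≥0∞} (h₁ : HasPoincare ν₁ K) (h₂ : HasPoincare ν₂ K)
    (h₃ : HasPoincare ν₃ K) {F : R3 → ℝ} (hFm : Measurable F)
    (hF : ∀ y, y ≠ 0 → ContDiffAt ℝ 1 F y) :
    spread ((ν₁.prod (ν₂.prod ν₃)).map ofCoords) F ≤
      K * ∫⁻ y, ENNReal.ofReal (‖gradient F y‖ ^ 2) ∂((ν₁.prod (ν₂.prod ν₃)).map ofCoords) := by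
  have hd : ∀ v, Measurable fun w => fderiv ℝ F (ofCoords w) v := fun v =>
    (measurable_fderiv_apply_const ℝ F v).comp measurable_ofCoords
  -- Almost every line parallel to an axis misses the origin: lines in the first direction because
  -- the second coordinate is nonzero, the others because the first one is.
  have hae₁ : ∀ᵐ x ∂ν₁, x ≠ 0 := compl_mem_ae_iff.2 hν₁
  have hae₂ : ∀ᵐ x ∂ν₂, x ≠ 0 := compl_mem_ae_iff.2 hν₂
  have c₁ : ∀ w x, ofCoords (x, w) = ofCoords (0, w) + x • EuclideanSpace.single 0 1 := by
    intro w x; ext i; fin_cases i <;> simp [ofCoords]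
  have c₂ : ∀ x z y, ofCoords (x, y, z) = ofCoords (x, 0, z) + y • EuclideanSpace.single 1 1 := by
    intro x z y; ext i; fin_cases i <;> simp [ofCoords]
  have c₃ : ∀ x y z, ofCoords (x, y, z) = ofCoords (x, y, 0) + z • EuclideanSpace.single 2 1 := by
    intro x y z; ext i; fin_cases i <;> simp [ofCoords]
  have key := spread_prod_prod_le h₁ h₂ h₃ (F := F ∘ ofCoords) (by fun_prop)
    (hd (EuclideanSpace.single 0 1)) (hd (EuclideanSpace.single 1 1)) (hd (EuclideanSpace.single 2 1))
    (by
      have := (Measure.quasiMeasurePreserving_fst (μ := ν₂) (ν := ν₃)).ae hae₂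
      filter_upwards [this] with w hw
      have := hasDerivAt_slice (F := F) (c := fun x => ofCoords (x, w)) (v := EuclideanSpace.single 0 1)
        (fun x => by rw [funext (c₁ w)]; exact hasDerivAt_line _ _ _)
        (fun x => hF _ (ofCoords_ne_zero (Or.inr hw)))
      exact this)
    (by
      filter_upwards [hae₁] with x hx
      refine .of_forall fun z => ?_
      have := hasDerivAt_slice (F := F) (c := fun y => ofCoords (x, y, z))
        (v := EuclideanSpace.single 1 1)
        (fun y => by rw [funext (c₂ x z)]; exact hasDerivAt_line _ _ _)
        (fun y => hF _ (ofCoords_ne_zero (Or.inl hx)))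
      exact this)
    (by
      filter_upwards [hae₁] with x hx
      refine .of_forall fun y => ?_
      have := hasDerivAt_slice (F := F) (c := fun z => ofCoords (x, y, z))
        (v := EuclideanSpace.single 2 1)
        (fun z => by rw [funext (c₃ x y)]; exact hasDerivAt_line _ _ _)
        (fun z => hF _ (ofCoords_ne_zero (Or.inl hx)))
      exact this)
  rw [spread_map measurable_ofCoords hFm]
  refine key.trans (le_of_eq ?_)
  have hm : Measurable fun y => ENNReal.ofReal (‖gradient F y‖ ^ 2) := by
    simp only [norm_gradient_sq]
    have := fun v => measurable_fderiv_apply_const ℝ F v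
    fun_prop
  rw [lintegral_map hm measurable_ofCoords]
  simp only [norm_gradient_sq]

/-- For a probability measure, `spread` is twice the variance. -/
lemma spread_eq {α : Type*} [MeasurableSpace α] {m : Measure α} [IsProbabilityMeasure m] {F : α → ℝ}
    (hF : MemLp F 2 m) (hFm : Measurable F) :
    spread m F = ENNReal.ofReal (2 * ∫ x, F x ^ 2 ∂m - 2 * (∫ x, F x ∂m) ^ 2) := by
  have i2 : Integrable (fun x => F x ^ 2) m := hF.integrable_sq
  have i1 : Integrable F m := hF.integrable (by norm_num)
  have j : Integrable (fun z : α × α => (F z.1 - F z.2) ^ 2) (m.prod m) := by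
    have e : (fun z : α × α => (F z.1 - F z.2) ^ 2) =
        fun z : α × α => F z.1 ^ 2 - 2 * (F z.1 * F z.2) + F z.2 ^ 2 := by
      funext z; ring
    rw [e]
    exact ((i2.comp_fst m).sub ((i1.mul_prod i1).const_mul 2)).add (i2.comp_snd m)
  rw [spread_eq_prod hFm, ← ofReal_integral_eq_lintegral_ofReal j (.of_forall fun z => sq_nonneg _)]
  congr 1
  have e : (fun z : α × α => (F z.1 - F z.2) ^ 2) =
      fun z : α × α => F z.1 ^ 2 - 2 * (F z.1 * F z.2) + F z.2 ^ 2 := by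
    funext z; ring
  have j1 : Integrable (fun z : α × α => F z.1 ^ 2 - 2 * (F z.1 * F z.2)) (m.prod m) :=
    (i2.comp_fst m).sub ((i1.mul_prod i1).const_mul 2)
  rw [e, integral_add j1 (i2.comp_snd m),
    integral_sub (i2.comp_fst m) ((i1.mul_prod i1).const_mul 2), integral_const_mul, integral_prod_mul,
    integral_fun_fst (fun x => F x ^ 2), integral_fun_snd (fun x => F x ^ 2)]
  simp
  ring

/-! ### The gradient on the sphere. -/

/-- The gradient of a function on the sphere for the metric of the unit sphere. -/
def roundGrad (f : S2 → ℝ) (x : S2) : R3 := gradient (fun y : R3 => f (radialProj y)) (x : R3)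

lemma sgrad_eq (f : S2 → ℝ) (x : S2) : sgrad f x = Real.sqrt (4 * Real.pi) • roundGrad f x := rfl

lemma norm_sgrad_sq (f : S2 → ℝ) (x : S2) :
    ‖sgrad f x‖ ^ 2 = 4 * Real.pi * ‖roundGrad f x‖ ^ 2 := by
  rw [sgrad_eq, norm_smul, mul_pow, Real.norm_eq_abs, sq_abs, Real.sq_sqrt (by positivity)]

lemma norm_coe_S2 (x : S2) : ‖(x : R3)‖ = 1 := by simp

lemma inner_self_S2 (x : S2) : ⟪(x : R3), (x : R3)⟫ = 1 := by simp

lemma continuous_roundGrad (f : SmoothFn) : Continuous (roundGrad f) := by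
  have h := (continuous_sgrad f).const_smul (Real.sqrt (4 * Real.pi))⁻¹
  have h4 : Real.sqrt (4 * Real.pi) ≠ 0 := by positivity
  refine h.congr fun x => ?_
  rw [Pi.smul_apply, sgrad_eq, smul_smul, inv_mul_cancel₀ h4, one_smul]

lemma fderiv_roundGrad (f : S2 → ℝ) (x : S2) (v : R3) :
    fderiv ℝ (fun y : R3 => f (radialProj y)) (x : R3) v = ⟪roundGrad f x, v⟫ := by
  rw [roundGrad, gradient, InnerProductSpace.toDual_symm_apply]

/-- The radially constant extension is homogeneous of degree zero, so its gradient is homogeneous of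
degree `-1` and is determined by its values on the sphere. -/
lemma fderiv_comp_radialProj (f : SmoothFn) {y : R3} (hy : y ≠ 0) (v : R3) :
    fderiv ℝ (fun z : R3 => f (radialProj z)) y v = ‖y‖⁻¹ * ⟪roundGrad f (radialProj y), v⟫ := by
  have hn : 0 < ‖y‖⁻¹ := inv_pos.2 (norm_pos_iff.2 hy)
  rw [← fderiv_roundGrad]
  have hd := ((contDiffAt_comp_radialProj f (coe_ne_zero (radialProj y))).differentiableAt
    (by simp)).hasFDerivAt
  have e : (radialProj y : R3) = ‖y‖⁻¹ • y := coe_radialProj hy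
  have hs : HasFDerivAt (fun z : R3 => ‖y‖⁻¹ • z) (‖y‖⁻¹ • ContinuousLinearMap.id ℝ R3) y :=
    (hasFDerivAt_id (𝕜 := ℝ) y).const_smul ‖y‖⁻¹
  have hc := HasFDerivAt.comp y (by rw [← e]; exact hd) hs
  have heq : (fun z : R3 => f (radialProj z)) =ᶠ[𝓝 y]
      ((fun z : R3 => f (radialProj z)) ∘ fun z => ‖y‖⁻¹ • z) := by
    filter_upwards [isOpen_ne.mem_nhds hy] with z hz
    simp only [Function.comp, radialProj_smul hn z hz]
  rw [(hc.congr_of_eventuallyEq heq).fderiv]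
  simp

lemma inner_roundGrad_self (f : SmoothFn) (x : S2) : ⟪roundGrad f x, (x : R3)⟫ = 0 := by
  rw [← fderiv_roundGrad]
  have hd := ((contDiffAt_comp_radialProj f (coe_ne_zero x)).differentiableAt (by simp)).hasFDerivAt
  have hl := hasDerivAt_line (0 : R3) (x : R3) 1
  have hc := HasFDerivAt.comp_hasDerivAt (1 : ℝ) (by simpa using hd) hl
  have heq : (fun _ : ℝ => f x) =ᶠ[𝓝 1]
      ((fun z : R3 => f (radialProj z)) ∘ fun t : ℝ => (0 : R3) + t • (x : R3)) := by
    filter_upwards [lt_mem_nhds (zero_lt_one (α := ℝ))] with t ht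
    simp only [Function.comp, zero_add, radialProj_smul ht _ (coe_ne_zero x), radialProj_coe]
  have := (hc.congr_of_eventuallyEq heq).unique (hasDerivAt_const 1 (f x))
  exact this

/-- Restriction to the sphere of a function which is smooth near the sphere. -/
def restrictSphere (G : R3 → ℝ) (hG : ∀ x : S2, ContDiffAt ℝ ∞ G x) : SmoothFn :=
  ⟨fun x => G x, fun x => by
    have : Fact (Module.finrank ℝ R3 = 2 + 1) := ⟨by simp⟩
    exact (hG x).contMDiffAt.comp x (contMDiff_coe_sphere x)⟩

/-- At a point of the sphere the differential of `y ↦ y / |y|` is the projection onto the tangent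
plane. -/
lemma hasFDerivAt_radialProj_apply (x : S2) (v : R3) :
    HasDerivAt (fun t : ℝ => (radialProj ((x : R3) + t • v) : R3)) (v - ⟪(x : R3), v⟫ • (x : R3)) 0 := by
  have hx := coe_ne_zero x
  have h1 : HasDerivAt (fun t : ℝ => (x : R3) + t • v) v 0 := hasDerivAt_line _ _ _
  have hx0 : (x : R3) + (0 : ℝ) • v = x := by simp
  have h2 : HasDerivAt (fun t : ℝ => ‖(x : R3) + t • v‖ ^ 2) (2 * ⟪(x : R3), v⟫) 0 := by
    have := h1.norm_sq
    rwa [hx0] at this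
  have h3 : HasDerivAt (fun t : ℝ => ‖(x : R3) + t • v‖⁻¹) (- ⟪(x : R3), v⟫) 0 := by
    have hne : ‖(x : R3) + (0 : ℝ) • v‖ ^ 2 ≠ 0 := by rw [hx0, norm_coe_S2]; norm_num
    have h4 := (h2.sqrt hne).inv (by rw [hx0, norm_coe_S2]; simp)
    simp only [Real.sqrt_sq (norm_nonneg _)] at h4
    refine (h4.congr_deriv ?_).congr_of_eventuallyEq (.of_forall fun t => ?_)
    · simp
    · simp
  have h5 := h3.smul h1
  refine (h5.congr_deriv ?_).congr_of_eventuallyEq ?_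
  · simp [sub_eq_add_neg]
  · have hcont : Tendsto (fun t : ℝ => (x : R3) + t • v) (𝓝 0) (𝓝 x) := by
      have := h1.continuousAt.tendsto
      rwa [hx0] at this
    filter_upwards [hcont.eventually (isOpen_ne.mem_nhds hx)] with t ht
    exact coe_radialProj ht

lemma inner_roundGrad_restrict {G : R3 → ℝ} (hG : ∀ x : S2, ContDiffAt ℝ ∞ G x) (x : S2) (v : R3) :
    ⟪roundGrad (restrictSphere G hG) x, v⟫ = fderiv ℝ G x (v - ⟪(x : R3), v⟫ • (x : R3)) := by
  rw [← fderiv_roundGrad]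
  have hd := ((contDiffAt_comp_radialProj (restrictSphere G hG) (coe_ne_zero x)).differentiableAt
    (by simp)).hasFDerivAt
  have h1 := HasFDerivAt.comp_hasDerivAt (0 : ℝ) (f := fun t : ℝ => (x : R3) + t • v)
    (by simpa using hd) (hasDerivAt_line _ v 0)
  have h2 := HasFDerivAt.comp_hasDerivAt (0 : ℝ)
    (by simpa [radialProj_coe] using ((hG x).differentiableAt (by simp)).hasFDerivAt)
    (hasFDerivAt_radialProj_apply x v)
  exact h1.unique h2

/-- The product rule on the sphere. -/
lemma roundGrad_mul (f h : SmoothFn) (x : S2) :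
    roundGrad (⇑(f * h)) x = f x • roundGrad h x + h x • roundGrad f x := by
  have hf := (contDiffAt_comp_radialProj f (coe_ne_zero x)).differentiableAt (by simp)
  have hh := (contDiffAt_comp_radialProj h (coe_ne_zero x)).differentiableAt (by simp)
  refine ext_inner_right ℝ fun v => ?_
  rw [inner_add_left, inner_smul_left, inner_smul_left, ← fderiv_roundGrad, ← fderiv_roundGrad,
    ← fderiv_roundGrad]
  have := congrArg (fun L => L v) (fderiv_mul hf hh)
  simp only [radialProj_coe] at this
  exact this

/-! ### The Gaussian measure and the sharp Poincaré inequality on the sphere. -/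

lemma map_ofCoords_withDensity {ρ : R3 → ℝ≥0∞} (hρ : Measurable ρ) :
    ((volume : Measure (ℝ × ℝ × ℝ)).withDensity (ρ ∘ ofCoords)).map ofCoords =
      volume.withDensity ρ := by
  ext s hs
  rw [Measure.map_apply measurable_ofCoords hs, withDensity_apply _ (measurable_ofCoords hs),
    withDensity_apply _ hs]
  exact measurePreserving_ofCoords.setLIntegral_comp_preimage hs hρ

/-- The radial profile of the standard Gaussian density on `ℝ³`. -/
def gaussProfile (r : ℝ) : ℝ := (√(2 * Real.pi))⁻¹ ^ 3 * Real.exp (-(r ^ 2) / 2)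

@[fun_prop]
lemma continuous_gaussProfile : Continuous gaussProfile := by
  unfold gaussProfile; fun_prop

lemma gaussProfile_pos (r : ℝ) : 0 < gaussProfile r := by
  unfold gaussProfile; positivity

/-- The standard Gaussian measure on `ℝ³`. -/
def gauss3 : Measure R3 := volume.withDensity fun y => ENNReal.ofReal (gaussProfile ‖y‖)

open ProbabilityTheory in
lemma gauss3_eq : gauss3 = ((gaussianReal 0 1).prod ((gaussianReal 0 1).prod (gaussianReal 0 1))).map
    ofCoords := by
  have hν : gaussianReal 0 1 = (volume : Measure ℝ).withDensity (gaussianPDF 0 1) :=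
    gaussianReal_of_var_ne_zero 0 one_ne_zero
  have : IsProbabilityMeasure ((volume : Measure ℝ).withDensity (gaussianPDF 0 1)) :=
    hν ▸ inferInstance
  have hm := measurable_gaussianPDF 0 1
  rw [hν, prod_withDensity hm hm, prod_withDensity hm (by fun_prop), gauss3,
    ← map_ofCoords_withDensity (by fun_prop)]
  congr 2
  funext w
  have h1 : ‖ofCoords w‖ ^ 2 = w.1 ^ 2 + w.2.1 ^ 2 + w.2.2 ^ 2 := by
    rw [EuclideanSpace.norm_sq_eq, Fin.sum_univ_three]
    simp [ofCoords]
  simp only [Function.comp, gaussProfile, h1, gaussianPDF, gaussianPDFReal_def]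
  rw [← ENNReal.ofReal_mul (by positivity), ← ENNReal.ofReal_mul (by positivity)]
  congr 1
  have : -(w.1 ^ 2 + w.2.1 ^ 2 + w.2.2 ^ 2) / 2 = -w.1 ^ 2 / 2 + (-w.2.1 ^ 2 / 2 + -w.2.2 ^ 2 / 2) := by
    ring
  rw [this, Real.exp_add, Real.exp_add]
  simp
  ring

open ProbabilityTheory in
instance : IsProbabilityMeasure gauss3 := by
  rw [gauss3_eq]
  exact Measure.isProbabilityMeasure_map measurable_ofCoords.aemeasurable

open ProbabilityTheory in
lemma spread_gauss3_le {F : R3 → ℝ} (hFm : Measurable F) (hF : ∀ y, y ≠ 0 → ContDiffAt ℝ 1 F y) :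
    spread gauss3 F ≤ 2 * ∫⁻ y, ENNReal.ofReal (‖gradient F y‖ ^ 2) ∂gauss3 := by
  have h0 : gaussianReal 0 1 {0} = 0 :=
    gaussianReal_absolutelyContinuous 0 one_ne_zero (measure_singleton _)
  rw [gauss3_eq]
  exact spread_le_gradient h0 h0 hasPoincare_gaussian hasPoincare_gaussian hasPoincare_gaussian hFm hF

lemma lintegral_gauss3 {β : ℝ → ℝ≥0∞} (hβ : Measurable β) {b : S2 → ℝ≥0∞} (hb : Measurable b) :
    ∫⁻ y, β ‖y‖ * b (radialProj y) ∂gauss3 = (∫⁻ y, β ‖y‖ ∂gauss3) * ∫⁻ x, b x ∂vg := by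
  have := measurable_radialProj
  rw [gauss3, lintegral_withDensity_eq_lintegral_mul _ (by fun_prop) (by fun_prop),
    lintegral_withDensity_eq_lintegral_mul _ (by fun_prop) (by fun_prop)]
  have h := lintegral_norm_radialProj (a := fun r => ENNReal.ofReal (gaussProfile r) * β r)
    (by fun_prop) hb
  simp only [Pi.mul_apply, mul_assoc] at h ⊢
  exact h

lemma integral_gauss3 {β : ℝ → ℝ} (hβ : Measurable β) (hβ0 : ∀ r, 0 ≤ β r)
    (hβi : Integrable (fun y : R3 => β ‖y‖) gauss3) {b : S2 → ℝ} (hb : Measurable b) :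
    ∫ y, β ‖y‖ * b (radialProj y) ∂gauss3 = (∫ y, β ‖y‖ ∂gauss3) * ∫ x, b x ∂vg := by
  have hg : Measurable fun y : R3 => ENNReal.ofReal (gaussProfile ‖y‖) := by fun_prop
  rw [gauss3] at hβi ⊢
  rw [integral_withDensity_eq_integral_toReal_smul hg (by simp),
    integral_withDensity_eq_integral_toReal_smul hg (by simp)]
  rw [integrable_withDensity_iff_integrable_smul' hg (by simp)] at hβi
  simp only [ENNReal.toReal_ofReal (gaussProfile_pos _).le, smul_eq_mul] at hβi ⊢
  have h := integral_norm_radialProj (a := fun r => gaussProfile r * β r) (by fun_prop)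
    (fun r => mul_nonneg (gaussProfile_pos r).le (hβ0 r)) hβi hb
  simp only [mul_assoc] at h
  exact h

open ProbabilityTheory in
lemma lintegral_norm_sq_gauss3 : ∫⁻ y, ENNReal.ofReal (‖y‖ ^ 2) ∂gauss3 = 3 := by
  have hi : Integrable (fun x : ℝ => x ^ 2) (gaussianReal 0 1) :=
    (memLp_id_gaussianReal (μ := 0) (v := 1) 2).integrable_sq
  have h1 : ∫⁻ x, ENNReal.ofReal (x ^ 2) ∂(gaussianReal 0 1) = 1 := by
    rw [← ofReal_integral_eq_lintegral_ofReal hi (.of_forall fun x => sq_nonneg _)]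
    have := variance_id_gaussianReal (μ := 0) (v := 1)
    rw [variance_eq_sub (memLp_id_gaussianReal' _ (by simp))] at this
    simp at this
    simp [this]
  rw [gauss3_eq, lintegral_map (by fun_prop) measurable_ofCoords]
  have h2 : ∀ w, ENNReal.ofReal (‖ofCoords w‖ ^ 2) = ENNReal.ofReal (w.1 ^ 2) +
      (ENNReal.ofReal (w.2.1 ^ 2) + ENNReal.ofReal (w.2.2 ^ 2)) := by
    intro w
    rw [EuclideanSpace.norm_sq_eq, Fin.sum_univ_three, ← ENNReal.ofReal_add (by positivity) (by positivity),
      ← ENNReal.ofReal_add (by positivity) (by positivity)]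
    simp [ofCoords, add_assoc]
  simp only [h2]
  rw [lintegral_add_left (by fun_prop), lintegral_add_left (by fun_prop),
    lintegral_prod _ (by fun_prop), lintegral_prod _ (by fun_prop), lintegral_prod _ (by fun_prop)]
  simp only [lintegral_const, measure_univ, mul_one, h1]
  rw [lintegral_prod _ (by fun_prop), lintegral_prod _ (by fun_prop)]
  simp only [lintegral_const, measure_univ, mul_one, h1]
  norm_num

/-- The extension of `f` which is homogeneous of degree one. -/
def coneExt (f : S2 → ℝ) (y : R3) : ℝ := ‖y‖ * f (radialProj y)

lemma measurable_coneExt (f : SmoothFn) : Measurable (coneExt f) :=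
  measurable_norm.mul (f.contMDiff.continuous.measurable.comp measurable_radialProj)

lemma contDiffAt_coneExt (f : SmoothFn) {y : R3} (hy : y ≠ 0) : ContDiffAt ℝ 1 (coneExt f) y :=
  (contDiffAt_norm ℝ hy).mul ((contDiffAt_comp_radialProj f hy).of_le (by simp))

/-- The gradient of a function homogeneous of degree one splits into the radial part `f` and the
tangential part `∇f`, which are orthogonal. Its length does not depend on `|y|`. -/
lemma norm_gradient_coneExt_sq (f : SmoothFn) {y : R3} (hy : y ≠ 0) :
    ‖gradient (coneExt f) y‖ ^ 2 = f (radialProj y) ^ 2 + ‖roundGrad f (radialProj y)‖ ^ 2 := by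
  have hny : ‖y‖ ≠ 0 := norm_ne_zero_iff.2 hy
  have e : gradient (coneExt f) y = f (radialProj y) • (radialProj y : R3) + roundGrad f (radialProj y) := by
    refine ext_inner_right ℝ fun v => ?_
    have h1 : HasFDerivAt (fun z : R3 => ‖z‖) (fderiv ℝ (fun z : R3 => ‖z‖) y) y :=
      ((contDiffAt_norm ℝ hy (n := 1)).differentiableAt one_ne_zero).hasFDerivAt
    have h2 := ((contDiffAt_comp_radialProj f hy).differentiableAt (by simp)).hasFDerivAt
    have h3 := (h1.mul h2).fderiv
    have h4 : fderiv ℝ (fun z : R3 => ‖z‖) y v = ⟪(radialProj y : R3), v⟫ := by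
      have h5 : HasDerivAt (fun t : ℝ => y + t • v) v 0 := hasDerivAt_line _ _ _
      have h6 := HasFDerivAt.comp_hasDerivAt (0 : ℝ) (f := fun t : ℝ => y + t • v)
        (by simpa using h1) h5
      have h7 := (h5.norm_sq).sqrt (by simpa using hny)
      simp only [Real.sqrt_sq (norm_nonneg _)] at h7
      have h8 := h6.unique h7
      simp only [zero_smul, add_zero] at h8
      rw [h8, coe_radialProj hy, inner_smul_left]
      simp
      field_simp
    rw [gradient, InnerProductSpace.toDual_symm_apply]
    change fderiv ℝ (fun z : R3 => ‖z‖ * f (radialProj z)) y v = _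
    rw [show (fun z : R3 => ‖z‖ * f (radialProj z)) = (fun z : R3 => ‖z‖) * fun z => f (radialProj z)
      from rfl, h3]
    simp only [_root_.add_apply, _root_.smul_apply, smul_eq_mul]
    rw [h4, fderiv_comp_radialProj f hy, inner_add_left, inner_smul_left]
    simp only [conj_trivial]
    field_simp
    ring
  rw [e, @norm_add_sq_real, norm_smul, norm_coe_S2, inner_smul_left, real_inner_comm,
    inner_roundGrad_self]
  simp

lemma SmoothFn.exists_bound (f : SmoothFn) : ∃ C, 0 ≤ C ∧ ∀ x, |f x| ≤ C := by
  obtain ⟨C, hC⟩ := isCompact_univ.exists_bound_of_continuousOn f.contMDiff.continuous.continuousOn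
  exact ⟨C, (abs_nonneg _).trans (hC basePoint trivial), fun x => hC x trivial⟩

lemma integrable_of_continuous {f : S2 → ℝ} (hf : Continuous f) (μ : Measure S2) [IsFiniteMeasure μ] :
    Integrable f μ :=
  hf.integrable_of_hasCompactSupport (HasCompactSupport.of_compactSpace f)

lemma integrable_norm_sq_gauss3 : Integrable (fun y : R3 => ‖y‖ ^ 2) gauss3 := by
  refine ⟨by fun_prop, ?_⟩
  rw [hasFiniteIntegral_iff_ofReal (.of_forall fun y => by positivity), lintegral_norm_sq_gauss3]
  simp

lemma integral_norm_sq_gauss3 : ∫ y, ‖y‖ ^ 2 ∂gauss3 = 3 := by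
  rw [integral_eq_lintegral_of_nonneg_ae (.of_forall fun y => by positivity) (by fun_prop),
    lintegral_norm_sq_gauss3]
  simp

lemma memLp_norm_gauss3 : MemLp (fun y : R3 => ‖y‖) 2 gauss3 :=
  (memLp_two_iff_integrable_sq (by fun_prop)).2 integrable_norm_sq_gauss3

lemma memLp_coneExt (f : SmoothFn) : MemLp (coneExt f) 2 gauss3 := by
  obtain ⟨C, hC0, hC⟩ := f.exists_bound
  refine memLp_norm_gauss3.of_le_mul (c := C) (measurable_coneExt f).aestronglyMeasurable
    (.of_forall fun y => ?_)
  rw [coneExt, norm_mul, norm_norm, mul_comm]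
  exact mul_le_mul_of_nonneg_right (hC _) (norm_nonneg _)

/-- The sharp Poincaré inequality on the unit sphere. -/
theorem sphere_poincare (f : SmoothFn) (h0 : ∫ x, f x ∂vg = 0) :
    2 * ∫ x, f x ^ 2 ∂vg ≤ ∫ x, ‖roundGrad f x‖ ^ 2 ∂vg := by
  have hfc : Continuous f := f.contMDiff.continuous
  have hfm : Measurable f := hfc.measurable
  have hgc := continuous_roundGrad f
  have hgm := hgc.measurable
  -- Since `E|y|² = 3`, the extension has second moment `3 ∫ f²` and energy `∫ f² + ∫ |∇f|²`; its
  -- mean vanishes with that of `f`. The Gaussian inequality then reads `3 ∫ f² ≤ ∫ f² + ∫ |∇f|²`.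
  have h1 := spread_gauss3_le (measurable_coneExt f) fun y hy => contDiffAt_coneExt f hy
  rw [spread_eq (memLp_coneExt f) (measurable_coneExt f)] at h1
  have h2 : ∫ y, coneExt f y ∂gauss3 = 0 := by
    -- The profile must be nonnegative on the whole line, hence `|r|` in place of `r`.
    have := integral_gauss3 (β := fun r => |r|) (by fun_prop) (fun r => abs_nonneg r)
      (by simpa using memLp_norm_gauss3.integrable one_le_two) hfm
    simp only [abs_norm] at this
    rw [h0, mul_zero] at this
    exact this
  have h3 : ∫ y, coneExt f y ^ 2 ∂gauss3 = 3 * ∫ x, f x ^ 2 ∂vg := by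
    have := integral_gauss3 (β := fun r => r ^ 2) (by fun_prop) (fun r => sq_nonneg r)
      integrable_norm_sq_gauss3 (b := fun x => f x ^ 2) (by fun_prop)
    rw [integral_norm_sq_gauss3] at this
    rw [← this]
    simp only [coneExt, mul_pow]
  have h4 : ∫⁻ y, ENNReal.ofReal (‖gradient (coneExt f) y‖ ^ 2) ∂gauss3 =
      ENNReal.ofReal (∫ x, (f x ^ 2 + ‖roundGrad f x‖ ^ 2) ∂vg) := by
    rw [ofReal_integral_eq_lintegral_ofReal (integrable_of_continuous (by fun_prop) _)
      (.of_forall fun x => by positivity)]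
    have := lintegral_gauss3 (β := fun _ => 1) measurable_const
      (b := fun x => ENNReal.ofReal (f x ^ 2 + ‖roundGrad f x‖ ^ 2)) (by fun_prop)
    simp only [one_mul, lintegral_const, measure_univ] at this
    rw [← this]
    refine lintegral_congr_ae ?_
    have hne : ∀ᵐ y ∂gauss3, y ≠ 0 := by
      refine compl_mem_ae_iff.2 ?_
      exact withDensity_absolutelyContinuous _ _ (measure_singleton _)
    filter_upwards [hne] with y hy
    rw [norm_gradient_coneExt_sq f hy]
  have h5 : ∀ t : ℝ, 2 * ENNReal.ofReal t = ENNReal.ofReal (2 * t) := fun t => by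
    rw [ENNReal.ofReal_mul two_pos.le]; simp
  rw [h4, h2, h3, h5,
    ENNReal.ofReal_le_ofReal_iff (mul_nonneg two_pos.le (integral_nonneg fun x => by positivity)),
    integral_add (integrable_of_continuous (by fun_prop) _)
      (integrable_of_continuous (by fun_prop) _)] at h1
  linarith

/-! ### Integration by parts on the sphere and Archimedes' theorem. -/

lemma integrable_pow_mul_gaussProfile (k : ℕ) :
    Integrable fun y : R3 => ‖y‖ ^ k * gaussProfile ‖y‖ := by
  have h := integrable_fun_norm_addHaar (volume : Measure R3) (f := fun r => r ^ k * gaussProfile r)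
  refine h.2 ?_
  have h2 := integrableOn_rpow_mul_exp_neg_mul_sq (b := 1 / 2) (by norm_num)
    (s := (k + 2 : ℝ)) (by linarith [k.cast_nonneg (α := ℝ)])
  refine IntegrableOn.congr_fun (h2.const_mul ((√(2 * Real.pi))⁻¹ ^ 3)) ?_ measurableSet_Ioi
  intro r hr
  have hr : 0 < r := hr
  simp only [gaussProfile, finrank_euclideanSpace, Fintype.card_fin, smul_eq_mul]
  rw [show (k + 2 : ℝ) = ((k + 2 : ℕ) : ℝ) by push_cast; ring, Real.rpow_natCast, pow_add,
    show -(1 / 2 : ℝ) * r ^ 2 = -r ^ 2 / 2 by ring]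
  norm_num
  ring

lemma fderiv_gaussProfile_norm (y v : R3) :
    DifferentiableAt ℝ (fun y : R3 => gaussProfile ‖y‖) y ∧
    fderiv ℝ (fun y : R3 => gaussProfile ‖y‖) y v = - (⟪y, v⟫ * gaussProfile ‖y‖) := by
  have h1 : HasFDerivAt (fun y : R3 => ‖y‖ ^ 2) (2 • (innerSL ℝ y)) y := by
    simpa using (hasFDerivAt_id (𝕜 := ℝ) y).norm_sq
  have h2 : HasDerivAt (fun s : ℝ => (√(2 * Real.pi))⁻¹ ^ 3 * Real.exp (-s / 2))
      (-(1 / 2) * gaussProfile ‖y‖) (‖y‖ ^ 2) := by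
    refine ((((hasDerivAt_id (‖y‖ ^ 2)).neg.div_const 2).exp).const_mul _).congr_deriv ?_
    simp only [gaussProfile, id, Pi.neg_apply]
    ring
  have h3 : HasFDerivAt (fun y : R3 => gaussProfile ‖y‖)
      ((-(1 / 2) * gaussProfile ‖y‖) • (2 • (innerSL ℝ y))) y :=
    HasDerivAt.comp_hasFDerivAt (h₂ := fun s : ℝ => (√(2 * Real.pi))⁻¹ ^ 3 * Real.exp (-s / 2)) y h2 h1
  refine ⟨h3.differentiableAt, ?_⟩
  rw [h3.fderiv]
  simp
  ring

/-- `|y|² f(y / |y|)` and its derivative. -/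
lemma hasFDerivAt_sq_mul (f : SmoothFn) (y v : R3) :
    DifferentiableAt ℝ (fun y : R3 => ‖y‖ ^ 2 * f (radialProj y)) y ∧
    fderiv ℝ (fun y : R3 => ‖y‖ ^ 2 * f (radialProj y)) y v =
      ‖y‖ * (2 * (⟪(radialProj y : R3), v⟫ * f (radialProj y)) + ⟪roundGrad f (radialProj y), v⟫) := by
  by_cases hy : y = 0
  · obtain ⟨C, hC0, hC⟩ := f.exists_bound
    have h : HasFDerivAt (fun y : R3 => ‖y‖ ^ 2 * f (radialProj y)) (0 : R3 →L[ℝ] ℝ) 0 := by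
      rw [hasFDerivAt_iff_isLittleO_nhds_zero]
      refine Asymptotics.IsBigO.trans_isLittleO (g := fun h : R3 => ‖h‖ ^ 2) ?_ ?_
      · refine Asymptotics.IsBigO.of_bound C (.of_forall fun h => ?_)
        simp only [zero_add, norm_zero, _root_.zero_apply, sub_zero]
        simp only [ne_eq, OfNat.ofNat_ne_zero, not_false_eq_true, zero_pow, zero_mul, sub_zero,
          norm_mul, norm_pow, norm_norm]
        rw [mul_comm]
        exact mul_le_mul_of_nonneg_right (hC _) (by positivity)
      · exact Asymptotics.isLittleO_norm_pow_id one_lt_two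
    subst hy
    refine ⟨h.differentiableAt, ?_⟩
    rw [h.fderiv]
    simp
  · have h1 : HasFDerivAt (fun y : R3 => ‖y‖ ^ 2) (2 • (innerSL ℝ y)) y := by
      simpa using (hasFDerivAt_id (𝕜 := ℝ) y).norm_sq
    have h2 := ((contDiffAt_comp_radialProj f hy).differentiableAt (by simp)).hasFDerivAt
    have h3 := h1.mul h2
    refine ⟨h3.differentiableAt, ?_⟩
    have h4 := h3.fderiv
    rw [show (fun y : R3 => ‖y‖ ^ 2 * f (radialProj y)) =
      (fun y : R3 => ‖y‖ ^ 2) * fun y => f (radialProj y) from rfl, h4]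
    have hny : ‖y‖ ≠ 0 := norm_ne_zero_iff.2 hy
    have h5 : ⟪y, v⟫ = ‖y‖ * ⟪(radialProj y : R3), v⟫ := by
      conv_lhs => rw [← norm_smul_radialProj y]
      rw [inner_smul_left]; simp
    simp only [_root_.add_apply, _root_.smul_apply, smul_eq_mul]
    rw [fderiv_comp_radialProj f hy]
    simp only [innerSL_apply_apply, h5, nsmul_eq_mul]
    field_simp
    push_cast
    ring

lemma integrable_pow_mul_radialProj (k : ℕ) {b : S2 → ℝ} (hb : Continuous b) :
    Integrable fun y : R3 => ‖y‖ ^ k * gaussProfile ‖y‖ * b (radialProj y) := by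
  obtain ⟨C, hC⟩ := isCompact_univ.exists_bound_of_continuousOn hb.continuousOn
  exact (integrable_pow_mul_gaussProfile k).mul_bdd (c := C)
    (hb.measurable.comp measurable_radialProj).aestronglyMeasurable (.of_forall fun y => hC _ trivial)

lemma integral_pow_mul_radialProj (k : ℕ) {b : S2 → ℝ} (hb : Continuous b) :
    ∫ y : R3, ‖y‖ ^ k * gaussProfile ‖y‖ * b (radialProj y) =
      (∫ y : R3, ‖y‖ ^ k * gaussProfile ‖y‖) * ∫ x, b x ∂vg := by
  have h := integral_norm_radialProj (a := fun r => |r| ^ k * gaussProfile r) (by fun_prop)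
    (fun r => mul_nonneg (by positivity) (gaussProfile_pos r).le)
    (by simpa using integrable_pow_mul_gaussProfile k) hb.measurable
  simpa only [abs_norm] using h

lemma continuous_inner_coe (v : R3) : Continuous fun x : S2 => ⟪(x : R3), v⟫ := by fun_prop

/-- Integrate by parts the `v`-derivative of `|y|² f(y/|y|)` against the Gaussian density and
separate radius from direction. The factor `|y|²` makes the extension differentiable at the origin
too. -/
lemma gaussian_moment_ibp (f : SmoothFn) (v : R3) :
    (∫ y : R3, ‖y‖ ^ 1 * gaussProfile ‖y‖) *
      (2 * ∫ x, ⟪(x : R3), v⟫ * f x ∂vg + ∫ x, ⟪roundGrad f x, v⟫ ∂vg) =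
    (∫ y : R3, ‖y‖ ^ 3 * gaussProfile ‖y‖) * ∫ x, ⟪(x : R3), v⟫ * f x ∂vg := by
  have hfc : Continuous f := f.contMDiff.continuous
  have hgc := continuous_roundGrad f
  have hic : Continuous fun x : S2 => ⟪(x : R3), v⟫ * f x := (continuous_inner_coe v).mul hfc
  have hb1 : Continuous fun x : S2 => 2 * (⟪(x : R3), v⟫ * f x) + ⟪roundGrad f x, v⟫ := by fun_prop
  have e1 : ∀ y : R3, gaussProfile ‖y‖ * fderiv ℝ (fun y : R3 => ‖y‖ ^ 2 * f (radialProj y)) y v =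
      ‖y‖ ^ 1 * gaussProfile ‖y‖ * (2 * (⟪(radialProj y : R3), v⟫ * f (radialProj y)) +
        ⟪roundGrad f (radialProj y), v⟫) := fun y => by
    rw [(hasFDerivAt_sq_mul f y v).2]; ring
  have e2 : ∀ y : R3, fderiv ℝ (fun y : R3 => gaussProfile ‖y‖) y v * (‖y‖ ^ 2 * f (radialProj y)) =
      -(‖y‖ ^ 3 * gaussProfile ‖y‖ * (⟪(radialProj y : R3), v⟫ * f (radialProj y))) := fun y => by
    rw [(fderiv_gaussProfile_norm y v).2]
    have h5 : ⟪y, v⟫ = ‖y‖ * ⟪(radialProj y : R3), v⟫ := by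
      conv_lhs => rw [← norm_smul_radialProj y]
      rw [inner_smul_left]; simp
    rw [h5]; ring
  have e3 : ∀ y : R3, gaussProfile ‖y‖ * (‖y‖ ^ 2 * f (radialProj y)) =
      ‖y‖ ^ 2 * gaussProfile ‖y‖ * f (radialProj y) := fun y => by ring
  have h := integral_mul_fderiv_eq_neg_fderiv_mul_of_integrable (μ := (volume : Measure R3))
    (f := fun y : R3 => gaussProfile ‖y‖) (g := fun y : R3 => ‖y‖ ^ 2 * f (radialProj y)) (v := v)
    (by simp only [e2]; exact (integrable_pow_mul_radialProj 3 hic).neg)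
    (by simp only [e1]; exact integrable_pow_mul_radialProj 1 hb1)
    (by simp only [e3]; exact integrable_pow_mul_radialProj 2 hfc)
    (fun y _ => (fderiv_gaussProfile_norm y v).1) (fun y _ => (hasFDerivAt_sq_mul f y v).1)
  simp only [e1, e2] at h
  rw [integral_neg, neg_neg, integral_pow_mul_radialProj 1 hb1, integral_pow_mul_radialProj 3 hic,
    integral_add (integrable_of_continuous (by fun_prop) _) (integrable_of_continuous (by fun_prop) _),
    integral_const_mul] at h
  exact h

/-- A linear function on the sphere. -/
def linFn (v : R3) : SmoothFn :=
  restrictSphere (fun y => ⟪v, y⟫) fun _ => (contDiff_const.inner ℝ contDiff_id).contDiffAt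

@[simp] lemma linFn_apply (v : R3) (x : S2) : linFn v x = ⟪v, (x : R3)⟫ := rfl

lemma roundGrad_linFn (v : R3) (x : S2) : roundGrad (linFn v) x = v - ⟪v, (x : R3)⟫ • (x : R3) := by
  refine ext_inner_right ℝ fun w => ?_
  rw [linFn, inner_roundGrad_restrict]
  have : fderiv ℝ (fun y : R3 => ⟪v, y⟫) (x : R3) = innerSL ℝ v := (innerSL ℝ v).fderiv
  rw [this, innerSL_apply_apply, inner_sub_left, inner_sub_right, inner_smul_left, inner_smul_right]
  simp [mul_comm]

lemma integral_gaussProfile_pos : 0 < ∫ y : R3, ‖y‖ ^ 1 * gaussProfile ‖y‖ := by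
  refine (integral_pos_iff_support_of_nonneg
    (fun y => mul_nonneg (by positivity) (gaussProfile_pos _).le)
    (integrable_pow_mul_gaussProfile 1)).2 ?_
  have hs : Function.support (fun y : R3 => ‖y‖ ^ 1 * gaussProfile ‖y‖) = {0}ᶜ := by
    ext y
    simp [(gaussProfile_pos _).ne']
  rw [hs]
  exact isOpen_compl_singleton.measure_pos _ ⟨basePoint, coe_ne_zero _⟩

/-- Neither radial moment has to be computed. The previous identity for linear functions gives `(B -
A) ∫ ⟪x, w⟫² = A` for every unit `w`, so the integral does not depend on `w`. Over an orthonormal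
basis these integrals add up to `1`, so each is `1/3`, and then `B = 4 A`. -/
lemma integral_linFn_sq {v : R3} (hv : ‖v‖ = 1) : ∫ x : S2, ⟪(x : R3), v⟫ ^ 2 ∂vg = 1 / 3 ∧
    (∫ y : R3, ‖y‖ ^ 3 * gaussProfile ‖y‖) = 4 * ∫ y : R3, ‖y‖ ^ 1 * gaussProfile ‖y‖ := by
  set A := ∫ y : R3, ‖y‖ ^ 1 * gaussProfile ‖y‖
  set B := ∫ y : R3, ‖y‖ ^ 3 * gaussProfile ‖y‖
  have hA : 0 < A := integral_gaussProfile_pos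
  have key : ∀ w : R3, ‖w‖ = 1 → A * (∫ x : S2, ⟪(x : R3), w⟫ ^ 2 ∂vg + 1) =
      B * ∫ x : S2, ⟪(x : R3), w⟫ ^ 2 ∂vg := by
    intro w hw
    have h := gaussian_moment_ibp (linFn w) w
    simp only [linFn_apply, roundGrad_linFn, inner_sub_left, inner_smul_left] at h
    have e : ∀ x : S2, ⟪w, w⟫ - (starRingEnd ℝ) ⟪w, (x : R3)⟫ * ⟪(x : R3), w⟫ =
        1 - ⟪(x : R3), w⟫ ^ 2 := fun x => by
      rw [real_inner_self_eq_norm_sq, hw, real_inner_comm w]; simp; ring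
    have e' : ∀ x : S2, ⟪(x : R3), w⟫ * ⟪w, (x : R3)⟫ = ⟪(x : R3), w⟫ ^ 2 := fun x => by
      rw [real_inner_comm w]; ring
    simp only [e, e'] at h
    rw [integral_sub (integrable_const 1) (integrable_of_continuous (by fun_prop) _)] at h
    simp only [integral_const, probReal_univ, smul_eq_mul, mul_one] at h
    rw [← h]
    ring
  have hi : ∀ w : R3, ‖w‖ = 1 → (B - A) * ∫ x : S2, ⟪(x : R3), w⟫ ^ 2 ∂vg = A := fun w hw => by
    linarith [key w hw]
  have hBA : B - A ≠ 0 := by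
    intro h0
    have := hi v hv
    rw [h0, zero_mul] at this
    exact hA.ne this
  have hconst : ∀ w : R3, ‖w‖ = 1 → ∫ x : S2, ⟪(x : R3), w⟫ ^ 2 ∂vg =
      ∫ x : S2, ⟪(x : R3), v⟫ ^ 2 ∂vg := fun w hw =>
    mul_left_cancel₀ hBA ((hi w hw).trans (hi v hv).symm)
  have hsum : ∑ i : Fin 3, ∫ x : S2, ⟪(x : R3), EuclideanSpace.single i (1 : ℝ)⟫ ^ 2 ∂vg = 1 := by
    rw [← integral_finsetSum _ fun i _ => integrable_of_continuous (by fun_prop) _]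
    have : ∀ x : S2, ∑ i : Fin 3, ⟪(x : R3), EuclideanSpace.single i (1 : ℝ)⟫ ^ 2 = 1 := fun x => by
      have := EuclideanSpace.norm_sq_eq (x : R3)
      rw [norm_coe_S2] at this
      simp only [EuclideanSpace.inner_single_right]
      simpa using this.symm
    simp [this]
  have h3 : ∫ x : S2, ⟪(x : R3), v⟫ ^ 2 ∂vg = 1 / 3 := by
    simp only [hconst _ (show ‖EuclideanSpace.single _ (1 : ℝ)‖ = 1 by simp)] at hsum
    simp at hsum
    linarith
  refine ⟨h3, ?_⟩
  have := key v hv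
  rw [h3] at this
  linarith

/-- Integration by parts on the sphere. -/
theorem integral_inner_roundGrad (f : SmoothFn) {v : R3} (hv : ‖v‖ = 1) :
    ∫ x, ⟪roundGrad f x, v⟫ ∂vg = 2 * ∫ x, ⟪(x : R3), v⟫ * f x ∂vg := by
  have h := gaussian_moment_ibp f v
  have hB := (integral_linFn_sq hv).2
  set A := ∫ y : R3, ‖y‖ ^ 1 * gaussProfile ‖y‖
  have hA : A ≠ 0 := integral_gaussProfile_pos.ne'
  rw [hB] at h
  have : A * (∫ x, ⟪roundGrad f x, v⟫ ∂vg) = A * (2 * ∫ x, ⟪(x : R3), v⟫ * f x ∂vg) := by linarith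
  exact mul_left_cancel₀ hA this

lemma inner_mem_Icc (x : S2) {v : R3} (hv : ‖v‖ = 1) : ⟪(x : R3), v⟫ ∈ Icc (-1 : ℝ) 1 := by
  have := abs_real_inner_le_norm (x : R3) v
  rw [norm_coe_S2, hv, mul_one] at this
  exact abs_le.1 this

/-- A smooth function of one coordinate on the sphere. -/
def zonal (h : ℝ → ℝ) (hh : ∀ t ∈ Icc (-1 : ℝ) 1, ContDiffAt ℝ ∞ h t) (v : R3) (hv : ‖v‖ = 1) :
    SmoothFn :=
  restrictSphere (fun y => h ⟪y, v⟫) fun x =>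
    (hh _ (inner_mem_Icc x hv)).comp (x : R3) (contDiff_id.inner ℝ contDiff_const).contDiffAt

@[simp] lemma zonal_apply (h : ℝ → ℝ) (hh : ∀ t ∈ Icc (-1 : ℝ) 1, ContDiffAt ℝ ∞ h t) (v : R3)
    (hv : ‖v‖ = 1) (x : S2) : zonal h hh v hv x = h ⟪(x : R3), v⟫ := rfl

lemma roundGrad_zonal {h : ℝ → ℝ} (hh : ∀ t ∈ Icc (-1 : ℝ) 1, ContDiffAt ℝ ∞ h t) {v : R3}
    (hv : ‖v‖ = 1) (x : S2) {h' : ℝ} (hd : HasDerivAt h h' ⟪(x : R3), v⟫) :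
    roundGrad (zonal h hh v hv) x = h' • (v - ⟪(x : R3), v⟫ • (x : R3)) := by
  refine ext_inner_right ℝ fun w => ?_
  rw [zonal, inner_roundGrad_restrict]
  have h1 : HasFDerivAt (fun y : R3 => ⟪y, v⟫) (innerSL ℝ v) (x : R3) := by
    have := (innerSL ℝ v).hasFDerivAt (x := (x : R3))
    refine this.congr_of_eventuallyEq (.of_forall fun y => ?_)
    simp [real_inner_comm]
  have h2 : HasFDerivAt (fun y : R3 => h ⟪y, v⟫) _ (x : R3) := hd.comp_hasFDerivAt (x : R3) h1
  rw [h2.fderiv]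
  simp only [_root_.smul_apply, innerSL_apply_apply, smul_eq_mul, inner_sub_right, inner_smul_left,
    inner_sub_left, inner_smul_right, conj_trivial, real_inner_comm v]
  ring

/-- The divergence formula for functions of one coordinate; `1 - t²` is the squared length of the
gradient of `t`. -/
lemma integral_zonal_ibp {h h' : ℝ → ℝ} (hh : ∀ t ∈ Icc (-1 : ℝ) 1, ContDiffAt ℝ ∞ h t) {v : R3}
    (hv : ‖v‖ = 1) (hd : ∀ t ∈ Icc (-1 : ℝ) 1, HasDerivAt h (h' t) t) :
    ∫ x : S2, h' ⟪(x : R3), v⟫ * (1 - ⟪(x : R3), v⟫ ^ 2) ∂vg =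
      2 * ∫ x : S2, ⟪(x : R3), v⟫ * h ⟪(x : R3), v⟫ ∂vg := by
  have := integral_inner_roundGrad (zonal h hh v hv) hv
  simp only [zonal_apply] at this
  rw [← this]
  refine integral_congr_ae (.of_forall fun x => ?_)
  simp only
  rw [roundGrad_zonal hh hv x (hd _ (inner_mem_Icc x hv)), inner_smul_left, inner_sub_left,
    inner_smul_left, real_inner_self_eq_norm_sq, hv]
  simp only [conj_trivial]
  ring

/-- Integration by parts with `h = t^(k+1)` relates the moments of order `k + 2` and `k` by the
factor `(k + 1) / (k + 3)`, as for the uniform law on `[-1, 1]`. -/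
lemma integral_pow_inner {v : R3} (hv : ‖v‖ = 1) (k : ℕ) :
    ∫ x : S2, ⟪(x : R3), v⟫ ^ k ∂vg = (1 / 2) * ∫ t in (-1 : ℝ)..1, t ^ k := by
  have hrec : ∀ k : ℕ, (k + 3 : ℝ) * ∫ x : S2, ⟪(x : R3), v⟫ ^ (k + 2) ∂vg =
      (k + 1) * ∫ x : S2, ⟪(x : R3), v⟫ ^ k ∂vg := by
    intro k
    have h := integral_zonal_ibp (h := fun t => t ^ (k + 1)) (h' := fun t => (k + 1 : ℕ) * t ^ k)
      (fun t _ => (contDiff_id.pow _).contDiffAt) hv (fun t _ => by simpa using hasDerivAt_pow (k + 1) t)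
    have e1 : ∀ t : ℝ, ((k + 1 : ℕ) : ℝ) * t ^ k * (1 - t ^ 2) = (k + 1) * t ^ k - (k + 1) * t ^ (k + 2) :=
      fun t => by push_cast; ring
    have e2 : ∀ t : ℝ, t * t ^ (k + 1) = t ^ (k + 2) := fun t => by ring
    simp only [e1, e2] at h
    rw [integral_sub (integrable_of_continuous (by fun_prop) _) (integrable_of_continuous (by fun_prop) _),
      integral_const_mul, integral_const_mul] at h
    linarith
  have h1 : ∫ x : S2, ⟪(x : R3), v⟫ ∂vg = 0 := by
    have h := integral_zonal_ibp (h := fun _ => 1) (h' := fun _ => 0)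
      (fun t _ => contDiffAt_const) hv (fun t _ => hasDerivAt_const _ _)
    simpa using h
  induction k using Nat.twoStepInduction with
  | zero => simp; norm_num
  | one => simp [h1]
  | more k ih _ =>
    have h3 : (k + 3 : ℝ) ≠ 0 := by positivity
    have h4 : (k + 1 : ℝ) ≠ 0 := by positivity
    refine mul_left_cancel₀ h3 ?_
    rw [hrec k, ih, integral_pow, integral_pow]
    push_cast
    have : (k : ℝ) + 2 + 1 = k + 3 := by ring
    rw [this]
    field_simp
    ring

/-- Archimedes' theorem, for continuous functions. -/
theorem integral_inner_continuous {v : R3} (hv : ‖v‖ = 1) {h : ℝ → ℝ} (hh : Continuous h) :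
    ∫ x : S2, h ⟪(x : R3), v⟫ ∂vg = (1 / 2) * ∫ t in (-1 : ℝ)..1, h t := by
  have hpoly : ∀ P : Polynomial ℝ, ∫ x : S2, P.eval ⟪(x : R3), v⟫ ∂vg =
      (1 / 2) * ∫ t in (-1 : ℝ)..1, P.eval t := by
    intro P
    simp only [Polynomial.eval_eq_sum_range]
    rw [integral_finsetSum _ fun i _ => integrable_of_continuous (by fun_prop) _,
      intervalIntegral.integral_finsetSum fun i _ => Continuous.intervalIntegrable (by fun_prop) _ _,
      Finset.mul_sum]
    refine Finset.sum_congr rfl fun i _ => ?_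
    rw [integral_const_mul, integral_pow_inner hv, intervalIntegral.integral_const_mul]
    ring
  refine eq_of_forall_dist_le fun ε hε => ?_
  obtain ⟨P, hP⟩ := exists_polynomial_near_of_continuousOn (-1) 1 h hh.continuousOn (ε / 2) (by positivity)
  have h1 : dist (∫ x : S2, h ⟪(x : R3), v⟫ ∂vg) (∫ x : S2, P.eval ⟪(x : R3), v⟫ ∂vg) ≤ ε / 2 := by
    have hPc : Continuous fun x : S2 => P.eval ⟪(x : R3), v⟫ :=
      P.continuous.comp (continuous_inner_coe v)
    have hhc : Continuous fun x : S2 => h ⟪(x : R3), v⟫ := hh.comp (continuous_inner_coe v)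
    rw [dist_eq_norm, ← integral_sub (integrable_of_continuous hhc _)
      (integrable_of_continuous hPc _)]
    refine (norm_integral_le_of_norm_le_const (C := ε / 2) (.of_forall fun x => ?_)).trans (by simp)
    rw [Real.norm_eq_abs, abs_sub_comm]
    exact (hP _ (inner_mem_Icc x hv)).le
  have h2 : dist ((1 / 2) * ∫ t in (-1 : ℝ)..1, P.eval t) ((1 / 2) * ∫ t in (-1 : ℝ)..1, h t) ≤ ε / 2 := by
    rw [dist_eq_norm, ← mul_sub, ← intervalIntegral.integral_sub (P.continuous.intervalIntegrable _ _)
      (hh.intervalIntegrable _ _), norm_mul]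
    have := intervalIntegral.norm_integral_le_of_norm_le_const (a := (-1 : ℝ)) (b := 1) (C := ε / 2)
      (f := fun t => P.eval t - h t) (fun t ht => by
        rw [Set.uIoc_of_le (by norm_num)] at ht
        exact (hP t ⟨ht.1.le, ht.2⟩).le)
    norm_num at this ⊢
    linarith
  rw [hpoly P] at h1
  linarith [dist_triangle (∫ x : S2, h ⟪(x : R3), v⟫ ∂vg) ((1 / 2) * ∫ t in (-1 : ℝ)..1, P.eval t)
    ((1 / 2) * ∫ t in (-1 : ℝ)..1, h t)]

/-- Archimedes' theorem: a coordinate is uniformly distributed. -/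
theorem vg_map_inner {v : R3} (hv : ‖v‖ = 1) :
    vg.map (fun x : S2 => ⟪(x : R3), v⟫) = ENNReal.ofReal (1 / 2) • volume.restrict (Icc (-1 : ℝ) 1) := by
  have hm : Measurable fun x : S2 => ⟪(x : R3), v⟫ := (continuous_inner_coe v).measurable
  have : IsFiniteMeasure (ENNReal.ofReal (1 / 2) • (volume : Measure ℝ).restrict (Icc (-1 : ℝ) 1)) :=
    Measure.smul_finite _ ENNReal.ofReal_ne_top
  refine ext_of_forall_integral_eq_of_IsFiniteMeasure fun h => ?_
  rw [integral_map hm.aemeasurable h.continuous.aestronglyMeasurable,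
    integral_inner_continuous hv h.continuous, integral_smul_measure,
    intervalIntegral.integral_of_le (by norm_num), integral_Icc_eq_integral_Ioc]
  simp

/-! ### The critical Hardy inequality. -/

/-- A weighted Hardy inequality on the sphere. -/
theorem hardy_of_ibp {ψ ψ' : ℝ → ℝ} (hψ : ∀ t ∈ Icc (-1 : ℝ) 1, ContDiffAt ℝ ∞ ψ t)
    (hd : ∀ t ∈ Icc (-1 : ℝ) 1, HasDerivAt ψ (ψ' t) t) {q : ℝ → ℝ}
    (hq : ContinuousOn q (Icc (-1) 1))
    (hqψ : ∀ t ∈ Icc (-1 : ℝ) 1, q t ≤ 1 + (ψ' t * (1 - t ^ 2) - 2 * t * ψ t - (1 - t ^ 2) * ψ t ^ 2))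
    {v : R3} (hv : ‖v‖ = 1) (u : SmoothFn) :
    ∫ x : S2, q ⟪(x : R3), v⟫ * u x ^ 2 ∂vg ≤
      ∫ x, u x ^ 2 ∂vg + ∫ x, ‖roundGrad u x‖ ^ 2 ∂vg := by
  set z := zonal ψ hψ v hv
  set w : SmoothFn := z * (u * u) with hw
  have hz : ∀ x, roundGrad z x = ψ' ⟪(x : R3), v⟫ • (v - ⟪(x : R3), v⟫ • (x : R3)) := fun x =>
    roundGrad_zonal hψ hv x (hd _ (inner_mem_Icc x hv))
  have huc : Continuous u := u.contMDiff.continuous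
  have hgc := continuous_roundGrad u
  have hgf := continuous_roundGrad w
  have hfc : Continuous w := w.contMDiff.continuous
  have ibp := integral_inner_roundGrad w hv
  have hqc : Continuous fun x : S2 => q ⟪(x : R3), v⟫ :=
    hq.comp_continuous (continuous_inner_coe v) fun x => inner_mem_Icc x hv
  -- Let `X = ψ(t) ∇t`, so that `div X = ψ' (1 - t²) - 2 t ψ` and `|X|² = (1 - t²) ψ²`. The bound is
  -- `-2 u ⟪X, ∇u⟫ ≤ |∇u|² + |X|² u²` with the divergence of `u² X` added, and that divergence
  -- integrates to zero.
  have key : ∀ x : S2, q ⟪(x : R3), v⟫ * u x ^ 2 ≤ (u x ^ 2 + ‖roundGrad u x‖ ^ 2) +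
      (⟪roundGrad w x, v⟫ - 2 * (⟪(x : R3), v⟫ * w x)) := by
    intro x
    have h1 := hqψ _ (inner_mem_Icc x hv)
    have e1 : w x = ψ ⟪(x : R3), v⟫ * (u x * u x) := rfl
    have e2 : (⇑(u * u : SmoothFn)) x = u x * u x := rfl
    have e5 : roundGrad w x = z x • roundGrad (⇑(u * u : SmoothFn)) x + (⇑(u * u : SmoothFn)) x • roundGrad z x :=
      roundGrad_mul z (u * u) x
    have e6 : roundGrad (⇑(u * u : SmoothFn)) x = u x • roundGrad u x + u x • roundGrad u x :=
      roundGrad_mul u u x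
    have e3 : z x = ψ ⟪(x : R3), v⟫ := rfl
    have e4 : ⟪v - ⟪(x : R3), v⟫ • (x : R3), v⟫ = 1 - ⟪(x : R3), v⟫ ^ 2 := by
      rw [inner_sub_left, inner_smul_left, real_inner_self_eq_norm_sq, hv]
      simp; ring
    rw [e5, e6, hz, e1, e2, e3]
    simp only [inner_add_left, inner_smul_left, conj_trivial, e4, smul_add]
    set t := ⟪(x : R3), v⟫
    set G := ⟪roundGrad u x, v⟫
    have hG : G ^ 2 ≤ ‖roundGrad u x‖ ^ 2 * (1 - t ^ 2) := by
      have g1 : G = ⟪roundGrad u x, v - t • (x : R3)⟫ := by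
        rw [inner_sub_right, inner_smul_right, inner_roundGrad_self]; simp [G]
      have g2 : ‖v - t • (x : R3)‖ ^ 2 = 1 - t ^ 2 := by
        rw [@norm_sub_sq_real, norm_smul, hv, norm_coe_S2, inner_smul_right, real_inner_comm]
        simp [t]; ring
      rw [g1, ← g2, ← mul_pow]
      exact sq_le_sq' (neg_le_of_abs_le (abs_real_inner_le_norm _ _)) (real_inner_le_norm _ _)
    have ht : 0 ≤ 1 - t ^ 2 := by
      have := inner_mem_Icc x hv
      nlinarith [this.1, this.2]
    have hY : -(2 * ψ t * u x * G) ≤ ‖roundGrad u x‖ ^ 2 + (1 - t ^ 2) * ψ t ^ 2 * u x ^ 2 := by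
      set n := ‖roundGrad u x‖
      set a := ψ t * u x
      have h5 : (a * G) ^ 2 ≤ n ^ 2 * ((1 - t ^ 2) * a ^ 2) := by nlinarith [sq_nonneg a]
      have h6 : 0 ≤ (1 - t ^ 2) * a ^ 2 := by positivity
      have h7 : |2 * (a * G)| ≤ n ^ 2 + (1 - t ^ 2) * a ^ 2 := by
        refine abs_le_of_sq_le_sq ?_ (by positivity)
        nlinarith [sq_nonneg (n ^ 2 - (1 - t ^ 2) * a ^ 2)]
      have h8 := neg_abs_le (2 * (a * G))
      have h9 : (1 - t ^ 2) * ψ t ^ 2 * u x ^ 2 = (1 - t ^ 2) * a ^ 2 := by ring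
      rw [h9]
      have h10 : 2 * ψ t * u x * G = 2 * (a * G) := by ring
      rw [h10]
      linarith
    nlinarith [mul_le_mul_of_nonneg_right h1 (sq_nonneg (u x))]
  have hint : ∫ x, (⟪roundGrad w x, v⟫ - 2 * (⟪(x : R3), v⟫ * w x)) ∂vg = 0 := by
    rw [integral_sub (integrable_of_continuous (by fun_prop) _) (integrable_of_continuous (by fun_prop) _),
      integral_const_mul, ibp, sub_self]
  calc _ ≤ ∫ x, ((u x ^ 2 + ‖roundGrad u x‖ ^ 2) +
      (⟪roundGrad w x, v⟫ - 2 * (⟪(x : R3), v⟫ * w x))) ∂vg :=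
        integral_mono (integrable_of_continuous (hqc.mul (huc.pow 2)) _)
          (integrable_of_continuous (by fun_prop) _) key
    _ = _ := by
      rw [integral_add (integrable_of_continuous (by fun_prop) _)
        (integrable_of_continuous (by fun_prop) _), hint, add_zero,
        integral_add (integrable_of_continuous (by fun_prop) _)
        (integrable_of_continuous (by fun_prop) _)]

/-- The logarithmic profile `1 + log ((1 + δ) / (1 - t² + δ))`. -/
def logProfile (δ t : ℝ) : ℝ := 1 + Real.log (1 + δ) - Real.log (1 - t ^ 2 + δ)

/-- The regularized critical Hardy weight `t² / ((1 - t² + δ) logProfile²)`. -/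
def hardyWeight (δ t : ℝ) : ℝ := t ^ 2 / ((1 - t ^ 2 + δ) * logProfile δ t ^ 2)

section Profile

variable {δ t : ℝ}

lemma one_sub_sq_nonneg (ht : t ∈ Icc (-1 : ℝ) 1) : 0 ≤ 1 - t ^ 2 := by
  nlinarith [ht.1, ht.2]

lemma base_pos (hδ : 0 < δ) (ht : t ∈ Icc (-1 : ℝ) 1) : 0 < 1 - t ^ 2 + δ := by
  linarith [one_sub_sq_nonneg ht]

lemma one_le_logProfile (hδ : 0 < δ) (ht : t ∈ Icc (-1 : ℝ) 1) : 1 ≤ logProfile δ t := by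
  have : Real.log (1 - t ^ 2 + δ) ≤ Real.log (1 + δ) :=
    Real.log_le_log (base_pos hδ ht) (by nlinarith [sq_nonneg t])
  unfold logProfile
  linarith

lemma hasDerivAt_base (δ t : ℝ) : HasDerivAt (fun t : ℝ => 1 - t ^ 2 + δ) (-(2 * t)) t := by
  have := ((hasDerivAt_pow 2 t).const_sub 1).add_const δ
  simpa using this

lemma hasDerivAt_logProfile (hδ : 0 < δ) (ht : t ∈ Icc (-1 : ℝ) 1) :
    HasDerivAt (logProfile δ) (2 * t / (1 - t ^ 2 + δ)) t := by
  have := ((hasDerivAt_base δ t).log (base_pos hδ ht).ne').const_sub (1 + Real.log (1 + δ))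
  refine this.congr_deriv ?_
  ring

lemma contDiffAt_base (δ t : ℝ) : ContDiffAt ℝ ∞ (fun t : ℝ => 1 - t ^ 2 + δ) t := by
  fun_prop

lemma contDiffAt_logProfile (hδ : 0 < δ) (ht : t ∈ Icc (-1 : ℝ) 1) :
    ContDiffAt ℝ ∞ (logProfile δ) t :=
  contDiffAt_const.sub ((contDiffAt_base δ t).log (base_pos hδ ht).ne')

lemma continuousOn_logProfile (hδ : 0 < δ) : ContinuousOn (logProfile δ) (Icc (-1) 1) := fun _ ht =>
  (contDiffAt_logProfile hδ ht).continuousAt.continuousWithinAt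

lemma hardyWeight_nonneg (hδ : 0 < δ) (ht : t ∈ Icc (-1 : ℝ) 1) : 0 ≤ hardyWeight δ t := by
  have := base_pos hδ ht
  unfold hardyWeight
  positivity

lemma continuousOn_hardyWeight (hδ : 0 < δ) : ContinuousOn (hardyWeight δ) (Icc (-1) 1) := by
  refine ContinuousOn.div (by fun_prop) ?_ fun t ht => ?_
  · exact ContinuousOn.mul (by fun_prop) ((continuousOn_logProfile hδ).pow 2)
  · have := base_pos hδ ht
    have := one_le_logProfile hδ ht
    positivity

lemma hardyWeight_neg (δ t : ℝ) : hardyWeight δ (-t) = hardyWeight δ t := by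
  simp [hardyWeight, logProfile]

end Profile

/-- The uniform Hardy inequality for `hardyWeight`. -/
theorem hardy_inequality {δ : ℝ} (hδ : 0 < δ) {v : R3} (hv : ‖v‖ = 1) (u : SmoothFn) :
    ∫ x : S2, hardyWeight δ ⟪(x : R3), v⟫ * u x ^ 2 ∂vg ≤
      ∫ x, u x ^ 2 ∂vg + ∫ x, ‖roundGrad u x‖ ^ 2 ∂vg := by
  have hpos : ∀ t ∈ Icc (-1 : ℝ) 1, (1 - t ^ 2 + δ) * logProfile δ t ≠ 0 := fun t ht => by
    have := base_pos hδ ht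
    have := one_le_logProfile hδ ht
    positivity
  -- This `ψ` is minus the logarithmic derivative of `√ℓ`, that is `-ℓ' / (2 ℓ)`: the ground state
  -- is the square root of the logarithmic profile.
  refine hardy_of_ibp (ψ := fun t => -t / ((1 - t ^ 2 + δ) * logProfile δ t))
    (ψ' := fun t => ((-1) * ((1 - t ^ 2 + δ) * logProfile δ t) -
      (-t) * (-(2 * t) * logProfile δ t + (1 - t ^ 2 + δ) * (2 * t / (1 - t ^ 2 + δ)))) /
      ((1 - t ^ 2 + δ) * logProfile δ t) ^ 2)
    (fun t ht => ?_) (fun t ht => ?_) (continuousOn_hardyWeight hδ) (fun t ht => ?_) hv u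
  · exact contDiffAt_id.neg.div ((contDiffAt_base δ t).mul (contDiffAt_logProfile hδ ht)) (hpos t ht)
  · exact (hasDerivAt_id t).neg.div ((hasDerivAt_base δ t).mul (hasDerivAt_logProfile hδ ht)) (hpos t ht)
  · have hp := base_pos hδ ht
    have hl := one_le_logProfile hδ ht
    have hs := one_sub_sq_nonneg ht
    unfold hardyWeight
    set l := logProfile δ t
    set p := 1 - t ^ 2 + δ with hpdef
    have hl0 : 0 < l := by linarith
    -- The surplus over the weight is a sum of two fractions with nonnegative numerators, because `l
    -- ≥ 1` and `p ≥ 1 - t²`. Nothing is lost as `δ → 0`.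
    have e : 1 + (((-1) * (p * l) - (-t) * (-(2 * t) * l + p * (2 * t / p))) / (p * l) ^ 2 * (1 - t ^ 2)
        - 2 * t * (-t / (p * l)) - (1 - t ^ 2) * (-t / (p * l)) ^ 2) - t ^ 2 / (p * l ^ 2) =
        (p * l - (1 - t ^ 2)) / (p * l) + t ^ 2 * δ * (2 * l - 1) / (p * l) ^ 2 := by
      have hδe : δ = p - (1 - t ^ 2) := by rw [hpdef]; ring
      rw [hδe]
      field_simp
      ring
    have h1 : 0 ≤ (p * l - (1 - t ^ 2)) / (p * l) := by
      refine div_nonneg ?_ (by positivity)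
      nlinarith
    have h2 : 0 ≤ t ^ 2 * δ * (2 * l - 1) / (p * l) ^ 2 := by
      refine div_nonneg (mul_nonneg (by positivity) (by linarith)) (by positivity)
    linarith

/-! ### The perturbed measures. -/

/-- The polar axis. -/
abbrev axis : R3 := (basePoint : R3)

lemma norm_axis : ‖axis‖ = 1 := norm_coe_S2 _

lemma continuous_zonal {h : ℝ → ℝ} (hh : ContinuousOn h (Icc (-1) 1)) :
    Continuous fun x : S2 => h ⟪(x : R3), axis⟫ :=
  hh.comp_continuous (continuous_inner_coe _) fun x => inner_mem_Icc x norm_axis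

/-- The total mass of the Hardy weight. -/
def hardyMass (δ : ℝ) : ℝ := ∫ x : S2, hardyWeight δ ⟪(x : R3), axis⟫ ∂vg

lemma hardyMass_nonneg {δ : ℝ} (hδ : 0 < δ) : 0 ≤ hardyMass δ :=
  integral_nonneg fun x => hardyWeight_nonneg hδ (inner_mem_Icc x norm_axis)

lemma roundGrad_const (c : ℝ) (x : S2) : roundGrad (fun _ => c) x = 0 := by
  simp [roundGrad, gradient]

/-- The Hardy inequality tested on the constant `1`. -/
lemma hardyMass_le_one {δ : ℝ} (hδ : 0 < δ) : hardyMass δ ≤ 1 := by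
  have := hardy_inequality hδ norm_axis (1 : SmoothFn)
  have e : ⇑(1 : SmoothFn) = fun _ => 1 := rfl
  simp only [e, roundGrad_const] at this
  simpa [hardyMass] using this

/-- The perturbed density. -/
def density (δ τ t : ℝ) : ℝ := (1 + τ * hardyWeight δ t) / (1 + τ * hardyMass δ)

/-- The perturbed measures. -/
def perturbed (δ τ : ℝ) : Measure S2 :=
  vg.withDensity fun x => ENNReal.ofReal (density δ τ ⟪(x : R3), axis⟫)

section Perturbed

variable {δ τ : ℝ}

lemma continuousOn_density (hδ : 0 < δ) : ContinuousOn (density δ τ) (Icc (-1) 1) :=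
  ((continuousOn_const).add (continuousOn_const.mul (continuousOn_hardyWeight hδ))).div_const _

lemma denom_pos (hδ : 0 < δ) (hτ : 0 ≤ τ) : 0 < 1 + τ * hardyMass δ := by
  have := mul_nonneg hτ (hardyMass_nonneg hδ)
  linarith

lemma density_nonneg (hδ : 0 < δ) (hτ : 0 ≤ τ) {t : ℝ} (ht : t ∈ Icc (-1 : ℝ) 1) :
    0 ≤ density δ τ t := by
  have h1 := mul_nonneg hτ (hardyWeight_nonneg hδ ht)
  exact div_nonneg (by linarith) (denom_pos hδ hτ).le

lemma continuous_density (hδ : 0 < δ) : Continuous fun x : S2 => density δ τ ⟪(x : R3), axis⟫ :=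
  continuous_zonal (continuousOn_density hδ)

lemma continuous_hardyWeight (hδ : 0 < δ) : Continuous fun x : S2 => hardyWeight δ ⟪(x : R3), axis⟫ :=
  continuous_zonal (continuousOn_hardyWeight hδ)

lemma integral_density (hδ : 0 < δ) (hτ : 0 ≤ τ) :
    ∫ x : S2, density δ τ ⟪(x : R3), axis⟫ ∂vg = 1 := by
  simp only [density]
  rw [integral_div, integral_add (integrable_const _)
    ((integrable_of_continuous (continuous_hardyWeight hδ) _).const_mul _), integral_const_mul]
  simp only [integral_const, probReal_univ, smul_eq_mul, mul_one]
  exact div_self (denom_pos hδ hτ).ne'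

lemma isProbabilityMeasure_perturbed (hδ : 0 < δ) (hτ : 0 ≤ τ) :
    IsProbabilityMeasure (perturbed δ τ) := by
  constructor
  rw [perturbed, withDensity_apply _ MeasurableSet.univ, setLIntegral_univ,
    ← ofReal_integral_eq_lintegral_ofReal (integrable_of_continuous (continuous_density hδ) _)
      (.of_forall fun x => density_nonneg hδ hτ (inner_mem_Icc x norm_axis)), integral_density hδ hτ,
    ENNReal.ofReal_one]

lemma integral_perturbed {E : Type*} [NormedAddCommGroup E] [NormedSpace ℝ E] (hδ : 0 < δ) (hτ : 0 ≤ τ)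
    (f : S2 → E) :
    ∫ x, f x ∂(perturbed δ τ) = ∫ x : S2, density δ τ ⟪(x : R3), axis⟫ • f x ∂vg := by
  have hm : Measurable fun x : S2 => ENNReal.ofReal (density δ τ ⟪(x : R3), axis⟫) :=
    (continuous_density hδ).measurable.ennreal_ofReal
  rw [perturbed, integral_withDensity_eq_integral_toReal_smul hm (by simp)]
  refine integral_congr_ae (.of_forall fun x => ?_)
  simp only
  rw [ENNReal.toReal_ofReal (density_nonneg hδ hτ (inner_mem_Icc x norm_axis))]

lemma perturbed_le (hδ : 0 < δ) : ∃ C : ℝ, 0 < C ∧ perturbed δ τ ≤ ENNReal.ofReal C • vg := by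
  obtain ⟨C, hC⟩ := isCompact_univ.exists_bound_of_continuousOn
    (continuous_density (τ := τ) hδ).continuousOn
  have hC0 : 0 ≤ C := (norm_nonneg _).trans (hC basePoint trivial)
  refine ⟨C + 1, by linarith, ?_⟩
  rw [← withDensity_const, perturbed]
  refine withDensity_mono (.of_forall fun x => ENNReal.ofReal_le_ofReal ?_)
  have := hC x trivial
  linarith [le_abs_self (density δ τ ⟪(x : R3), axis⟫), Real.norm_eq_abs (density δ τ ⟪(x : R3), axis⟫)]

/-- The density is even in `t`, so the measure is invariant under the antipodal map. -/
lemma balanced_perturbed (hδ : 0 < δ) (hτ : 0 ≤ τ) : Balanced (perturbed δ τ) := by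
  rw [Balanced, integral_perturbed hδ hτ]
  have hn : Measurable fun x : S2 => -x := by fun_prop
  have hc : Continuous fun x : S2 => density δ τ ⟪(x : R3), axis⟫ • (x : R3) :=
    (continuous_density hδ).smul continuous_subtype_val
  have h : ∫ x : S2, density δ τ ⟪(x : R3), axis⟫ • (x : R3) ∂vg =
      - ∫ x : S2, density δ τ ⟪(x : R3), axis⟫ • (x : R3) ∂vg := by
    conv_lhs => rw [← vg_map_neg]
    rw [integral_map hn.aemeasurable hc.aestronglyMeasurable, ← integral_neg]
    refine integral_congr_ae (.of_forall fun x => ?_)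
    have e : ∀ t, density δ τ (-t) = density δ τ t := fun t => by
      simp [density, hardyWeight_neg]
    simp [inner_neg_left, e]
  have h2 : (2 : ℝ) • ∫ x : S2, density δ τ ⟪(x : R3), axis⟫ • (x : R3) ∂vg = 0 := by
    rw [two_smul]
    nth_rewrite 1 [h]
    exact neg_add_cancel _
  exact (smul_eq_zero.1 h2).resolve_left two_ne_zero

/-- The normalising denominator is at least `1`, so the density is at most `1 + τ q`, and the Hardy
inequality absorbs the weight. -/
lemma integral_sq_perturbed_le (hδ : 0 < δ) (hτ : 0 ≤ τ) (f : SmoothFn) :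
    ∫ x, f x ^ 2 ∂(perturbed δ τ) ≤
      (1 + τ) * ∫ x, f x ^ 2 ∂vg + τ * ∫ x, ‖roundGrad f x‖ ^ 2 ∂vg := by
  have hfc : Continuous f := f.contMDiff.continuous
  have hh := hardy_inequality hδ norm_axis f
  have hw := continuous_hardyWeight hδ
  rw [integral_perturbed hδ hτ]
  have h1 : ∫ x : S2, density δ τ ⟪(x : R3), axis⟫ • f x ^ 2 ∂vg ≤
      ∫ x : S2, (f x ^ 2 + τ * (hardyWeight δ ⟪(x : R3), axis⟫ * f x ^ 2)) ∂vg := by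
    refine integral_mono (integrable_of_continuous ((continuous_density hδ).smul (hfc.pow 2)) _)
      (integrable_of_continuous (by fun_prop) _) fun x => ?_
    have hx := hardyWeight_nonneg hδ (inner_mem_Icc x norm_axis)
    have hd : density δ τ ⟪(x : R3), axis⟫ ≤ 1 + τ * hardyWeight δ ⟪(x : R3), axis⟫ := by
      refine div_le_self (by positivity) ?_
      linarith [mul_nonneg hτ (hardyMass_nonneg hδ)]
    have := mul_le_mul_of_nonneg_right hd (sq_nonneg (f x))
    simp only [smul_eq_mul]
    linarith
  rw [integral_add (integrable_of_continuous (by fun_prop) _) (integrable_of_continuous (by fun_prop) _),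
    integral_const_mul] at h1
  nlinarith

end Perturbed

/-! ### Convergence of the first eigenvalue to `8π`. -/

section Eigenvalue

variable {δ τ : ℝ}

lemma lintegral_sgrad_sq (f : SmoothFn) : ∫⁻ x, ENNReal.ofReal (‖sgrad f x‖ ^ 2) ∂vg =
    ENNReal.ofReal (4 * Real.pi * ∫ x, ‖roundGrad f x‖ ^ 2 ∂vg) := by
  have hgc := continuous_roundGrad f
  simp only [norm_sgrad_sq]
  rw [← ofReal_integral_eq_lintegral_ofReal (integrable_of_continuous (by fun_prop) _)
    (.of_forall fun x => by positivity), integral_const_mul]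

lemma lintegral_sq (f : SmoothFn) (μ : Measure S2) [IsFiniteMeasure μ] :
    ∫⁻ x, ENNReal.ofReal (f x ^ 2) ∂μ = ENNReal.ofReal (∫ x, f x ^ 2 ∂μ) := by
  have hfc : Continuous f := f.contMDiff.continuous
  rw [← ofReal_integral_eq_lintegral_ofReal (integrable_of_continuous (by fun_prop) _)
    (.of_forall fun x => by positivity)]

lemma integral_sq_pos {f : SmoothFn} {μ : Measure S2} [IsFiniteMeasure μ] (h : ¬ ⇑f =ᵐ[μ] 0) :
    0 < ∫ x, f x ^ 2 ∂μ := by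
  have hfc : Continuous f := f.contMDiff.continuous
  refine lt_of_le_of_ne (integral_nonneg fun x => sq_nonneg _) fun h0 => h ?_
  have := (integral_eq_zero_iff_of_nonneg (μ := μ) (f := fun x => f x ^ 2) (fun x => sq_nonneg _)
    (integrable_of_continuous (by fun_prop) _)).1 h0.symm
  filter_upwards [this] with x hx
  simpa using hx

lemma exists_mean_zero {E : Submodule ℝ SmoothFn} (hE : Module.finrank ℝ E = 2) :
    ∃ f ∈ E, f ≠ 0 ∧ ∫ x, f x ∂vg = 0 := by
  have : Module.Finite ℝ E := Module.finite_of_finrank_pos (by omega)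
  let L : E →ₗ[ℝ] ℝ :=
    { toFun := fun f => ∫ x, (f : SmoothFn) x ∂vg
      map_add' := fun f g => integral_add
        (integrable_of_continuous (f : SmoothFn).contMDiff.continuous _)
        (integrable_of_continuous (g : SmoothFn).contMDiff.continuous _)
      map_smul' := fun c f => integral_const_mul c _ }
  have hker : LinearMap.ker L ≠ ⊥ := LinearMap.ker_ne_bot_of_finrank_lt (by simp [hE])
  obtain ⟨f, hf, hf0⟩ := Submodule.exists_mem_ne_zero_of_ne_bot hker
  exact ⟨f, f.2, fun h => hf0 (Subtype.ext h), hf⟩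

lemma le_eigenvalue_perturbed (hδ : 0 < δ) (hτ : 0 ≤ τ) :
    ENNReal.ofReal (8 * Real.pi / (1 + 3 * τ)) ≤ eigenvalue 1 (perturbed δ τ) := by
  have := isProbabilityMeasure_perturbed hδ hτ
  refine le_iInf fun E => le_iInf fun hE => le_iInf fun hinj => ?_
  -- The competitor has mean zero for `v_g`, not for the perturbed measure, so the sharp inequality
  -- on the round sphere applies to it.
  obtain ⟨f, hfE, hf0, hmean⟩ := exists_mean_zero hE
  refine le_iSup_of_le f (le_iSup_of_le hfE (le_iSup_of_le hf0 ?_))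
  have hpos : 0 < ∫ x, f x ^ 2 ∂(perturbed δ τ) :=
    integral_sq_pos fun h => hf0 (hinj f hfE h)
  have hp := sphere_poincare f hmean
  have hle := integral_sq_perturbed_le hδ hτ f
  rw [rayleigh, lintegral_sgrad_sq, lintegral_sq, ← ENNReal.ofReal_div_of_pos hpos]
  refine ENNReal.ofReal_le_ofReal ?_
  rw [div_le_div_iff₀ (by positivity) hpos]
  have hg : 0 ≤ ∫ x, ‖roundGrad f x‖ ^ 2 ∂vg := integral_nonneg fun x => sq_nonneg _
  have : 2 * ∫ x, f x ^ 2 ∂(perturbed δ τ) ≤ (1 + 3 * τ) * ∫ x, ‖roundGrad f x‖ ^ 2 ∂vg := by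
    nlinarith
  nlinarith [Real.pi_pos]

/-- The weight is nonnegative and of mass at most `1`, so the density is at least `1 / (1 + τ)`
everywhere; the factor `1/3` is `∫ t² dv_g`. -/
lemma one_third_le_integral_sq (hδ : 0 < δ) (hτ : 0 ≤ τ) :
    1 / (3 * (1 + τ)) ≤ ∫ x, linFn axis x ^ 2 ∂(perturbed δ τ) := by
  have hfc : Continuous (linFn axis) := (linFn axis).contMDiff.continuous
  rw [integral_perturbed hδ hτ]
  have h1 : ∫ x : S2, (1 / (1 + τ)) * linFn axis x ^ 2 ∂vg ≤
      ∫ x : S2, density δ τ ⟪(x : R3), axis⟫ • linFn axis x ^ 2 ∂vg := by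
    refine integral_mono (integrable_of_continuous (by fun_prop) _)
      (integrable_of_continuous ((continuous_density hδ).smul (hfc.pow 2)) _) fun x => ?_
    have hx := hardyWeight_nonneg hδ (inner_mem_Icc x norm_axis)
    have hd : 1 / (1 + τ) ≤ density δ τ ⟪(x : R3), axis⟫ := by
      refine div_le_div₀ (by positivity) ?_ (denom_pos hδ hτ) ?_
      · linarith [mul_nonneg hτ hx]
      · nlinarith [hardyMass_le_one hδ]
    exact mul_le_mul_of_nonneg_right hd (sq_nonneg _)
  refine le_trans (le_of_eq ?_) h1
  have h2 := (integral_linFn_sq norm_axis).1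
  have h3 : ∀ x : S2, linFn axis x = ⟪(x : R3), axis⟫ := fun x => by
    rw [linFn_apply, real_inner_comm]
  simp only [h3]
  rw [integral_const_mul, h2]
  field_simp

/-- The span of the constants and one coordinate function. -/
def affineFn : ℝ × ℝ →ₗ[ℝ] SmoothFn :=
  (LinearMap.toSpanSingleton ℝ SmoothFn 1).coprod (LinearMap.toSpanSingleton ℝ SmoothFn (linFn axis))

lemma affineFn_apply (a b : ℝ) (x : S2) : affineFn (a, b) x = a + b * ⟪axis, (x : R3)⟫ := by
  have : affineFn (a, b) = a • (1 : SmoothFn) + b • linFn axis := by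
    simp [affineFn, LinearMap.coprod_apply]
  rw [this]
  change a * 1 + b * _ = _
  rw [mul_one, linFn_apply]

lemma affineFn_integral_sq (hδ : 0 < δ) (hτ : 0 ≤ τ) (a b : ℝ) :
    ∫ x, affineFn (a, b) x ^ 2 ∂(perturbed δ τ) =
      a ^ 2 + b ^ 2 * ∫ x, linFn axis x ^ 2 ∂(perturbed δ τ) := by
  have := isProbabilityMeasure_perturbed hδ hτ
  have hb : ∫ x : S2, ⟪axis, (x : R3)⟫ ∂(perturbed δ τ) = 0 := by
    have h := balanced_perturbed hδ hτ
    rw [Balanced] at h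
    have hi := integral_inner (𝕜 := ℝ) (μ := perturbed δ τ) (f := fun x : S2 => (x : R3))
      (continuous_subtype_val.integrable_of_hasCompactSupport (HasCompactSupport.of_compactSpace _)) axis
    rw [hi, h, inner_zero_right]
  have e : ∀ x : S2, affineFn (a, b) x ^ 2 =
      a ^ 2 + 2 * a * b * ⟪axis, (x : R3)⟫ + b ^ 2 * ⟪axis, (x : R3)⟫ ^ 2 := fun x => by
    rw [affineFn_apply]; ring
  simp only [e, linFn_apply]
  rw [integral_add (integrable_of_continuous (by fun_prop) _) (integrable_of_continuous (by fun_prop) _),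
    integral_add (integrable_of_continuous (by fun_prop) _) (integrable_of_continuous (by fun_prop) _),
    integral_const_mul, integral_const_mul, hb]
  simp

lemma affineFn_energy (a b : ℝ) : ∫ x, ‖roundGrad (affineFn (a, b)) x‖ ^ 2 ∂vg = 2 / 3 * b ^ 2 := by
  have hs : ∀ t ∈ Icc (-1 : ℝ) 1, ContDiffAt ℝ ∞ (fun t : ℝ => a + b * t) t := fun t _ => by fun_prop
  have e : ⇑(affineFn (a, b)) = zonal (fun t => a + b * t) hs axis norm_axis := by
    funext x
    rw [affineFn_apply, zonal_apply, real_inner_comm]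
  have hd : ∀ t : ℝ, HasDerivAt (fun t : ℝ => a + b * t) b t := fun t => by
    simpa using ((hasDerivAt_id t).const_mul b).const_add a
  have h1 : ∀ x : S2, ‖roundGrad (affineFn (a, b)) x‖ ^ 2 = b ^ 2 - b ^ 2 * ⟪(x : R3), axis⟫ ^ 2 := by
    intro x
    rw [e, roundGrad_zonal hs norm_axis x (hd _), norm_smul, mul_pow, Real.norm_eq_abs, sq_abs,
      @norm_sub_sq_real, norm_smul, norm_axis, norm_coe_S2, inner_smul_right,
      real_inner_comm (x : R3) axis]
    simp
    ring
  simp only [h1]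
  rw [integral_sub (integrable_const _) (integrable_of_continuous (by fun_prop) _), integral_const_mul,
    (integral_linFn_sq norm_axis).1]
  simp
  ring

/-- Test with the affine functions `a + b t`. Balance removes the cross term from `∫ (a + b t)² dμ`,
and dropping `a²` leaves the quotient of `t` alone. -/
lemma eigenvalue_perturbed_le (hδ : 0 < δ) (hτ : 0 ≤ τ) :
    eigenvalue 1 (perturbed δ τ) ≤ ENNReal.ofReal (8 * Real.pi * (1 + τ)) := by
  have := isProbabilityMeasure_perturbed hδ hτ
  have hs := one_third_le_integral_sq hδ hτ
  have hs0 : 0 < 1 / (3 * (1 + τ)) := by positivity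
  have hzero : ∀ a b, ⇑(affineFn (a, b)) =ᵐ[perturbed δ τ] 0 → a = 0 ∧ b = 0 := by
    intro a b h
    have h0 : ∫ x, affineFn (a, b) x ^ 2 ∂(perturbed δ τ) = 0 := by
      have : (fun x => affineFn (a, b) x ^ 2) =ᵐ[perturbed δ τ] fun _ => 0 := by
        filter_upwards [h] with x hx
        simp [hx]
      rw [integral_congr_ae this, integral_zero]
    rw [affineFn_integral_sq hδ hτ] at h0
    have hs1 := lt_of_lt_of_le hs0 hs
    have hb : b ^ 2 * ∫ x, linFn axis x ^ 2 ∂(perturbed δ τ) = 0 := by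
      have := mul_nonneg (sq_nonneg b) hs1.le
      linarith [sq_nonneg a]
    have ha : a ^ 2 = 0 := by linarith
    exact ⟨pow_eq_zero_iff two_ne_zero |>.1 ha,
      pow_eq_zero_iff two_ne_zero |>.1 ((mul_eq_zero.1 hb).resolve_right hs1.ne')⟩
  have hinj : Function.Injective affineFn := by
    rw [injective_iff_map_eq_zero]
    rintro ⟨a, b⟩ h
    obtain ⟨rfl, rfl⟩ := hzero a b (by rw [h]; rfl)
    rfl
  refine iInf_le_of_le (LinearMap.range affineFn) (iInf_le_of_le ?_ (iInf_le_of_le ?_ ?_))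
  · rw [LinearMap.finrank_range_of_inj hinj]
    simp
  · rintro _ ⟨⟨a, b⟩, rfl⟩ h
    obtain ⟨rfl, rfl⟩ := hzero a b h
    exact map_zero affineFn
  · refine iSup_le fun f => iSup_le fun hf => iSup_le fun _ => ?_
    obtain ⟨⟨a, b⟩, rfl⟩ := hf
    rw [rayleigh, lintegral_sgrad_sq, lintegral_sq]
    refine ENNReal.div_le_of_le_mul ?_
    rw [← ENNReal.ofReal_mul (by positivity)]
    refine ENNReal.ofReal_le_ofReal ?_
    rw [affineFn_integral_sq hδ hτ, affineFn_energy]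
    have h1 : 8 * Real.pi * (1 + τ) * (b ^ 2 * (1 / (3 * (1 + τ)))) = 4 * Real.pi * (2 / 3 * b ^ 2) := by
      field_simp
      ring
    rw [← h1]
    refine mul_le_mul_of_nonneg_left ?_ (by positivity)
    have := mul_le_mul_of_nonneg_left hs (sq_nonneg b)
    linarith [sq_nonneg a]

end Eigenvalue

/-! ### Conformal maps of the plane with linear growth. -/

section PlaneConformal

/-- The difference quotient at `0` extends to a bounded entire function, which is constant by
Liouville's theorem. -/
lemma exists_affine_of_linear_growth {g : ℂ → ℂ} (hg : Differentiable ℂ g) {C : ℝ}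
    (hC : ∀ z, ‖g z‖ ≤ C * (1 + ‖z‖)) : ∃ a, ∀ z, g z = a * z + g 0 := by
  have hC0 : 0 ≤ C := by simpa using (norm_nonneg _).trans (hC 0)
  have hd : Differentiable ℂ (dslope g 0) := by
    rw [← differentiableOn_univ] at hg ⊢
    exact (Complex.differentiableOn_dslope univ_mem).2 hg
  have hb : Bornology.IsBounded (range (dslope g 0)) := by
    have h1 : Bornology.IsBounded (dslope g 0 '' closedBall 0 1) :=
      ((isCompact_closedBall 0 1).image hd.continuous).isBounded
    have h2 : Bornology.IsBounded (closedBall (0 : ℂ) (3 * C)) := isBounded_closedBall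
    refine (h1.union h2).subset ?_
    rintro _ ⟨z, rfl⟩
    by_cases hz : ‖z‖ ≤ 1
    · exact Or.inl ⟨z, by simpa using hz, rfl⟩
    · right
      push Not at hz
      have hz0 : z ≠ 0 := by rintro rfl; simp at hz; linarith
      rw [mem_closedBall_zero_iff, dslope_of_ne _ hz0, slope_def_field, sub_zero, norm_div,
        div_le_iff₀ (by linarith)]
      have h3 := hC z
      have h4 := hC 0
      have h5 := norm_sub_le (g z) (g 0)
      simp only [norm_zero, add_zero, mul_one] at h4
      nlinarith
  refine ⟨dslope g 0 0, fun z => ?_⟩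
  have h := hd.apply_eq_apply_of_bounded hb z 0
  have h2 := sub_smul_dslope g 0 z
  rw [h, sub_zero, smul_eq_mul] at h2
  rw [mul_comm, h2]; ring

/-- `L i` is orthogonal to `L 1` and of the same length, which leaves only `± i L 1`. -/
lemma complex_linear_or_conj {L : ℂ →L[ℝ] ℂ} {c : ℝ} (hc : 0 < c)
    (hL : ∀ u v : ℂ, ⟪L u, L v⟫ = c * ⟪u, v⟫) :
    L 1 ≠ 0 ∧ (L Complex.I = Complex.I * L 1 ∨ L Complex.I = -(Complex.I * L 1)) := by
  have h11 := hL 1 1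
  have h1I := hL 1 Complex.I
  have hII := hL Complex.I Complex.I
  simp only [Complex.inner, Complex.mul_re, Complex.conj_re, Complex.conj_im, Complex.one_re,
    Complex.one_im, Complex.I_re, Complex.I_im] at h11 h1I hII
  have hne : L 1 ≠ 0 := by
    intro h
    rw [h] at h11
    simp at h11
    linarith
  refine ⟨hne, ?_⟩
  set p := (L 1).re
  set q := (L 1).im
  set r := (L Complex.I).re
  set s := (L Complex.I).im
  have hpq : 0 < p ^ 2 + q ^ 2 := by nlinarith
  have e1 : (r + q) * (r - q) = 0 := by
    have : (p ^ 2 + q ^ 2) * ((r + q) * (r - q)) = 0 := by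
      have h3 : p * r + q * s = 0 := by linarith
      have h4 : r ^ 2 + s ^ 2 = p ^ 2 + q ^ 2 := by nlinarith
      have h5 : (p * r) ^ 2 = (q * s) ^ 2 := by
        rw [show p * r = -(q * s) by linarith]; ring
      linear_combination h5 + q ^ 2 * h4
    rcases mul_eq_zero.1 this with h | h
    · exact absurd h hpq.ne'
    · exact h
  have h3 : p * r + q * s = 0 := by linarith
  have h4 : r ^ 2 + s ^ 2 = p ^ 2 + q ^ 2 := by nlinarith
  by_cases hq : q = 0
  · have hp : p ≠ 0 := by rintro h; rw [h, hq] at hpq; simp at hpq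
    have hr : r = 0 := by
      rw [hq] at h3; simp at h3; exact h3.resolve_left hp
    have : (s - p) * (s + p) = 0 := by rw [hr, hq] at h4; linarith
    rcases mul_eq_zero.1 this with h | h
    · left; apply Complex.ext <;> simp <;> linarith
    · right; apply Complex.ext <;> simp <;> linarith
  · rcases mul_eq_zero.1 e1 with h | h
    · left
      have hs : s = p := by
        have : q * (s - p) = 0 := by
          have : r = -q := by linarith
          rw [this] at h3; linarith
        have := (mul_eq_zero.1 this).resolve_left hq
        linarith
      apply Complex.ext <;> simp <;> linarith
    · right
      have hs : s = -p := by
        have : q * (s + p) = 0 := by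
          have : r = q := by linarith
          rw [this] at h3; linarith
        have := (mul_eq_zero.1 this).resolve_left hq
        linarith
      apply Complex.ext <;> simp <;> linarith

/-- The points where the differential is complex linear and those where it is antilinear form two
disjoint closed sets covering the connected plane. Hence `g` or its conjugate is entire, and linear
growth makes it affine. -/
lemma exists_similarity_of_conformal {g : ℂ → ℂ} (hg : ContDiff ℝ 1 g)
    (hconf : ∀ z, ∃ c : ℝ, 0 < c ∧ ∀ u v : ℂ, ⟪fderiv ℝ g z u, fderiv ℝ g z v⟫ = c * ⟪u, v⟫)
    {C : ℝ} (hC : ∀ z, ‖g z‖ ≤ C * (1 + ‖z‖)) :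
    ∃ a : ℝ, 0 < a ∧ ∀ z w, ‖g z - g w‖ = a * ‖z - w‖ := by
  have hd : Differentiable ℝ g := hg.differentiable (by simp)
  have hcont : Continuous (fderiv ℝ g) := hg.continuous_fderiv (by simp)
  have hlin : ∀ z, fderiv ℝ g z 1 ≠ 0 ∧ (fderiv ℝ g z Complex.I = Complex.I * fderiv ℝ g z 1 ∨
      fderiv ℝ g z Complex.I = -(Complex.I * fderiv ℝ g z 1)) := fun z => by
    obtain ⟨c, hc, h⟩ := hconf z
    exact complex_linear_or_conj hc h
  have main : ∀ f : ℂ → ℂ, (∀ z w, ‖f z - f w‖ = ‖g z - g w‖) → (∀ z, ‖f z‖ ≤ C * (1 + ‖z‖)) →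
      Differentiable ℂ f → ∃ a : ℝ, 0 < a ∧ ∀ z w, ‖g z - g w‖ = a * ‖z - w‖ := by
    intro f hfg hfC hf
    obtain ⟨a, ha⟩ := exists_affine_of_linear_growth hf hfC
    have hn : ∀ z w, ‖g z - g w‖ = ‖a‖ * ‖z - w‖ := by
      intro z w
      rw [← hfg, ha z, ha w, ← norm_mul]
      congr 1; ring
    refine ⟨‖a‖, norm_pos_iff.2 ?_, hn⟩
    rintro rfl
    have : g = fun _ => g 0 := by
      funext z
      have := hn z 0
      simpa [sub_eq_zero] using this
    apply (hlin 0).1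
    rw [this]; simp
  set A : Set ℂ := {z | fderiv ℝ g z Complex.I = Complex.I * fderiv ℝ g z 1}
  set B : Set ℂ := {z | fderiv ℝ g z Complex.I = -(Complex.I * fderiv ℝ g z 1)}
  have hA : IsClosed A := isClosed_eq (by fun_prop) (by fun_prop)
  have hB : IsClosed B := isClosed_eq (by fun_prop) (by fun_prop)
  have hAB : A = Bᶜ := by
    ext z
    constructor
    · intro (h1 : _ = _) (h2 : _ = _)
      rw [h1] at h2
      have := self_eq_neg.1 h2
      exact (hlin z).1 ((mul_eq_zero.1 this).resolve_left Complex.I_ne_zero)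
    · intro h
      exact (hlin z).2.resolve_right h
  have hclopen : IsClopen A := ⟨hA, by rw [hAB]; exact hB.isOpen_compl⟩
  rcases isClopen_iff.1 hclopen with h | h
  · have hB' : ∀ z, z ∈ B := by
      intro z
      by_contra hz
      have : z ∈ A := by rw [hAB]; exact hz
      rw [h] at this; exact this
    refine main (fun z => starRingEnd ℂ (g z)) ?_ ?_ ?_
    · intro z w
      rw [← map_sub, Complex.norm_conj]
    · intro z; rw [Complex.norm_conj]; exact hC z
    · intro z
      rw [differentiableAt_complex_iff_differentiableAt_real]
      have h1 : HasFDerivAt (fun z => starRingEnd ℂ (g z))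
          ((Complex.conjCLE : ℂ →L[ℝ] ℂ).comp (fderiv ℝ g z)) z :=
        (Complex.conjCLE : ℂ →L[ℝ] ℂ).hasFDerivAt.comp z (hd z).hasFDerivAt
      refine ⟨h1.differentiableAt, ?_⟩
      rw [h1.fderiv]
      have := hB' z
      simp only [B, Set.mem_ofPred_eq] at this
      simp [this]
  · refine main g (fun _ _ => rfl) hC fun z => ?_
    rw [differentiableAt_complex_iff_differentiableAt_real]
    refine ⟨hd z, ?_⟩
    have : z ∈ A := by rw [h]; trivial
    exact this

end PlaneConformal

/-! ### Stereographic projection and the distance identity for conformal maps. -/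

section Stereographic

lemma exists_tangent_frame (p : S2) : ∃ (ι : ℂ →ₗᵢ[ℝ] R3) (τ : R3 →L[ℝ] ℂ),
    (∀ z, ⟪ι z, (p : R3)⟫ = 0) ∧ (∀ z, τ (ι z) = z) ∧
    ∀ w, ⟪w, (p : R3)⟫ = 0 → ι (τ w) = w := by
  have : Fact (Module.finrank ℝ R3 = 2 + 1) := ⟨by simp⟩
  let K : Submodule ℝ R3 := (Submodule.span ℝ {(p : R3)})ᗮ
  let b : OrthonormalBasis (Fin 2) ℝ K :=
    OrthonormalBasis.fromOrthogonalSpanSingleton 2 (coe_ne_zero p)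
  let e : ℂ ≃ₗᵢ[ℝ] K := Complex.orthonormalBasisOneI.repr.trans b.repr.symm
  refine ⟨K.subtypeₗᵢ.comp e.toLinearIsometry,
    (e.symm.toContinuousLinearEquiv : K →L[ℝ] ℂ).comp K.orthogonalProjectionOnto, ?_, ?_, ?_⟩
  · intro z
    rw [real_inner_comm]
    exact Submodule.mem_orthogonal_singleton_iff_inner_right.1 (e z).2
  · intro z
    simp
  · intro w hw
    have : w ∈ K := Submodule.mem_orthogonal_singleton_iff_inner_right.2 (by rw [real_inner_comm]; exact hw)
    have h2 := K.orthogonalProjectionOnto_mem_subspace_eq_self ⟨w, this⟩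
    simp only at h2
    simp [h2]

end Stereographic

section Stereographic

open EuclideanGeometry

/-- Inversion of radius `√2` about `p` exchanges the plane through the origin orthogonal to `p` with
the sphere minus `p`. It serves as stereographic projection, with conformality and the change of
distances known from the theory of inversions. -/
lemma norm_inversion_of_orthogonal (p : S2) {w : R3} (hw : ⟪w, (p : R3)⟫ = 0) :
    ‖inversion (p : R3) (√2) w‖ = 1 := by
  have hne : w ≠ p := by
    rintro rfl
    rw [inner_self_S2] at hw; norm_num at hw
  have hD : 0 < dist w p := dist_pos.2 hne
  have h1 : dist w p ^ 2 = ‖w‖ ^ 2 + 1 := by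
    rw [dist_eq_norm, norm_sub_sq_real, hw, norm_coe_S2]; ring
  have h2 : ‖inversion (p : R3) (√2) w‖ ^ 2 = 1 := by
    rw [inversion, vsub_eq_sub, vadd_eq_add, norm_add_sq_real, inner_smul_left, inner_sub_left,
      hw, inner_self_S2, norm_smul, ← dist_eq_norm, norm_coe_S2, mul_pow, norm_pow,
      Real.norm_of_nonneg (by positivity)]
    simp only [div_pow, Real.sq_sqrt (zero_le_two : (0 : ℝ) ≤ 2), RCLike.conj_to_real]
    field_simp
    ring
  exact (pow_eq_one_iff_of_nonneg (norm_nonneg _) two_ne_zero).1 h2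

lemma inner_inversion_of_mem_sphere {p x : S2} (hx : x ≠ p) :
    ⟪inversion (p : R3) (√2) x, (p : R3)⟫ = 0 := by
  have hne : (x : R3) ≠ p := fun h => hx (Subtype.ext h)
  have hD : 0 < dist (x : R3) p := dist_pos.2 hne
  have h1 : dist (x : R3) p ^ 2 = 2 - 2 * ⟪(x : R3), (p : R3)⟫ := by
    rw [dist_eq_norm, norm_sub_sq_real, norm_coe_S2, norm_coe_S2]; ring
  rw [inversion, vsub_eq_sub, vadd_eq_add, inner_add_left, inner_smul_left, inner_sub_left,
    inner_self_S2]
  simp only [div_pow, Real.sq_sqrt (zero_le_two : (0 : ℝ) ≤ 2), RCLike.conj_to_real]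
  rw [show ⟪(x : R3), (p : R3)⟫ - 1 = -(dist (x : R3) p ^ 2) / 2 by rw [h1]; ring]
  field_simp
  ring

lemma inner_fderiv_inversion {c x : R3} (hx : x ≠ c) :
    ∃ (k : ℝ) (L : R3 →L[ℝ] R3), 0 < k ∧ HasFDerivAt (inversion c (√2)) L x ∧
      ∀ u v, ⟪L u, L v⟫ = k * ⟪u, v⟫ := by
  have hD : 0 < dist x c := dist_pos.2 hx
  refine ⟨((√2 / dist x c) ^ 2) ^ 2, _, by positivity, hasFDerivAt_inversion hx, fun u v => ?_⟩
  simp only [_root_.smul_apply, inner_smul_left, inner_smul_right,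
    RCLike.conj_to_real]
  have h : ⟪(Submodule.span ℝ {x - c})ᗮ.reflection u, (Submodule.span ℝ {x - c})ᗮ.reflection v⟫
      = ⟪u, v⟫ := LinearIsometryEquiv.inner_map_map _ u v
  change _ * (_ * ⟪(Submodule.span ℝ {x - c})ᗮ.reflection u,
    (Submodule.span ℝ {x - c})ᗮ.reflection v⟫) = _
  rw [h]; ring

lemma contDiffAt_diffeo (Φ : S2 ≃ₘ⟮𝓡 2, 𝓡 2⟯ S2) {y : R3} (hy : y ≠ 0) :
    ContDiffAt ℝ ∞ (fun z : R3 => (Φ (radialProj z) : R3)) y := by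
  have : Fact (Module.finrank ℝ R3 = 2 + 1) := ⟨by simp⟩
  have h1 : ContMDiff (𝓡 2) 𝓘(ℝ, R3) ∞ (fun x : S2 => (Φ x : R3)) :=
    (contMDiff_coe_sphere (n := 2)).comp Φ.contMDiff
  exact contMDiffAt_iff_contDiffAt.1 ((h1 _).comp y (contMDiffAt_radialProj hy))

/-- Differentiability controls `Φ` near `q`; away from `q` the diameter `2` of the sphere does. The
bound is applied to the inverse map, to get linear growth in the plane. -/
lemma exists_dist_diffeo_le (Φ : S2 ≃ₘ⟮𝓡 2, 𝓡 2⟯ S2) (q : S2) :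
    ∃ C : ℝ, 0 ≤ C ∧ ∀ y : S2, dist (Φ y) (Φ q) ≤ C * dist y q := by
  have hd := (contDiffAt_diffeo Φ (coe_ne_zero q)).differentiableAt (by simp)
  obtain ⟨c, hc⟩ := hd.hasFDerivAt.isBigO_sub.bound
  obtain ⟨r, hr, hball⟩ := Metric.eventually_nhds_iff.1 hc
  refine ⟨max c (2 / r), le_max_of_le_right (by positivity), fun y => ?_⟩
  by_cases hy : dist (y : R3) q < r
  · have := hball hy
    rw [radialProj_coe, radialProj_coe, ← dist_eq_norm, ← dist_eq_norm] at this
    exact this.trans (mul_le_mul_of_nonneg_right (le_max_left _ _) dist_nonneg)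
  · push Not at hy
    have h2 : dist (Φ y) (Φ q) ≤ 2 := by
      rw [Subtype.dist_eq, dist_eq_norm]
      refine (norm_sub_le _ _).trans ?_
      rw [norm_coe_S2, norm_coe_S2]; norm_num
    calc dist (Φ y) (Φ q) ≤ 2 / r * r := by rwa [div_mul_cancel₀ _ hr.ne']
      _ ≤ 2 / r * dist y q := by gcongr; exact hy
      _ ≤ _ := mul_le_mul_of_nonneg_right (le_max_right _ _) dist_nonneg

/-- Projecting stereographically from `p` in the source and from `Φ p` in the target turns `Φ` into
a conformal map `g` of the whole plane. It has linear growth, hence is a similarity of some ratio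
`a`. Written back on the sphere by the formula for distances under inversion, `‖g z - g w‖ = a ‖z -
w‖` is the stated identity. -/
theorem IsConformal.exists_dist_eq {Φ : S2 ≃ₘ⟮𝓡 2, 𝓡 2⟯ S2} (hΦ : IsConformal Φ) (p : S2) :
    ∃ a : ℝ, 0 < a ∧ ∀ x y : S2, dist (Φ x) (Φ y) * (dist x p * dist y p) =
      a * (dist x y * (dist (Φ x) (Φ p) * dist (Φ y) (Φ p))) := by
  obtain ⟨ι, τ, hι, hτι, hιτ⟩ := exists_tangent_frame p
  obtain ⟨ι', τ', hι', hτι', hιτ'⟩ := exists_tangent_frame (Φ p)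
  have h2 : (√2 : ℝ) ≠ 0 := by positivity
  have hιp : ∀ z, ι z ≠ (p : R3) := fun z h => by
    have := hι z
    rw [h, inner_self_S2] at this; norm_num at this
  set σ : ℂ → R3 := fun z => inversion (p : R3) (√2) (ι z) with hσ
  have hσn : ∀ z, ‖σ z‖ = 1 := fun z => norm_inversion_of_orthogonal p (hι z)
  have hσ0 : ∀ z, σ z ≠ 0 := fun z h => by
    have := hσn z
    rw [h, norm_zero] at this; norm_num at this
  set S : ℂ → S2 := fun z => radialProj (σ z) with hS
  have hScoe : ∀ z, (S z : R3) = σ z := fun z => by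
    rw [hS]; simp only
    rw [coe_radialProj (hσ0 z), hσn]; simp
  have hSp : ∀ z, S z ≠ p := fun z h => by
    have h1 := hScoe z
    rw [h] at h1
    exact hιp z ((inversion_eq_center h2).1 h1.symm)
  have hΦS : ∀ z, (Φ (S z) : R3) ≠ Φ p := fun z h => hSp z (Φ.injective (Subtype.ext h))
  set G : ℂ → R3 := fun z => inversion (Φ p : R3) (√2) (Φ (S z) : R3) with hG
  have hGq : ∀ z, ⟪G z, (Φ p : R3)⟫ = 0 := fun z =>
    inner_inversion_of_mem_sphere fun h => hSp z (Φ.injective h)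
  set g : ℂ → ℂ := fun z => τ' (G z) with hg
  have hιg : ∀ z, ι' (g z) = G z := fun z => hιτ' _ (hGq z)
  have hσC : ContDiff ℝ 1 σ := by
    rw [contDiff_iff_contDiffAt]
    intro z
    exact contDiffAt_const.inversion contDiffAt_const
      ι.toContinuousLinearMap.contDiff.contDiffAt (hιp z)
  have hGC : ContDiff ℝ 1 G := by
    rw [contDiff_iff_contDiffAt]
    intro z
    refine contDiffAt_const.inversion contDiffAt_const ?_ (hΦS z)
    exact ((contDiffAt_diffeo Φ (hσ0 z)).of_le (by simp)).comp z hσC.contDiffAt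
  have hgC : ContDiff ℝ 1 g := τ'.contDiff.comp hGC
  have hconf : ∀ z, ∃ c : ℝ, 0 < c ∧
      ∀ u v : ℂ, ⟪fderiv ℝ g z u, fderiv ℝ g z v⟫ = c * ⟪u, v⟫ := by
    intro z
    obtain ⟨k, L, hk, hL, hLL⟩ := inner_fderiv_inversion (hιp z)
    obtain ⟨k', L', hk', hL', hLL'⟩ := inner_fderiv_inversion (hΦS z)
    obtain ⟨c, hc, hcc⟩ := hΦ (S z)
    rw [hScoe z] at hcc
    set M := fderiv ℝ (fun y : R3 => (Φ (radialProj y) : R3)) (σ z) with hM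
    have hMd : HasFDerivAt (fun y : R3 => (Φ (radialProj y) : R3)) M (σ z) :=
      ((contDiffAt_diffeo Φ (hσ0 z)).differentiableAt (by simp)).hasFDerivAt
    have hσd : HasFDerivAt σ (L.comp ι.toContinuousLinearMap) z :=
      HasFDerivAt.comp z hL ι.toContinuousLinearMap.hasFDerivAt
    have hGd : HasFDerivAt G (L'.comp (M.comp (L.comp ι.toContinuousLinearMap))) z :=
      HasFDerivAt.comp (f := fun z => (Φ (S z) : R3)) z hL'
        (HasFDerivAt.comp (f := σ) z hMd hσd)
    have hgd : HasFDerivAt g (fderiv ℝ g z) z :=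
      (hgC.differentiable (by simp) z).hasFDerivAt
    have hιgd : HasFDerivAt G (ι'.toContinuousLinearMap.comp (fderiv ℝ g z)) z := by
      have := ι'.toContinuousLinearMap.hasFDerivAt.comp z hgd
      exact this.congr_of_eventuallyEq (Eventually.of_forall fun z => (hιg z).symm)
    have hu := hιgd.unique hGd
    -- Conformality of `Φ` is only known on tangent vectors; these are tangent because `σ` takes
    -- values of norm one.
    have hperp : ∀ u, ⟪σ z, L (ι u)⟫ = 0 := by
      intro u
      have h3 := hσd.norm_sq
      have h4 : HasFDerivAt (fun w => ‖σ w‖ ^ 2) (0 : ℂ →L[ℝ] ℝ) z := by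
        have : (fun w => ‖σ w‖ ^ 2) = fun _ => (1 : ℝ) := by
          funext w; rw [hσn]; norm_num
        rw [this]; exact hasFDerivAt_const _ _
      have h5 := congrArg (fun T : ℂ →L[ℝ] ℝ => T u) (h3.unique h4)
      simpa using h5
    refine ⟨k' * (c * k), by positivity, fun u v => ?_⟩
    have e : ∀ u, ι' (fderiv ℝ g z u) = L' (M (L (ι u))) := fun u =>
      congrArg (fun T : ℂ →L[ℝ] R3 => T u) hu
    rw [← ι'.inner_map_map, e, e, hLL', hcc _ _ (hperp u) (hperp v), hLL, ι.inner_map_map]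
    ring
  obtain ⟨C, hC0, hC⟩ := exists_dist_diffeo_le Φ.symm (Φ p)
  -- Both inversions turn the distance to their centre into twice its inverse, so the Lipschitz
  -- bound for the inverse of `Φ` at `Φ p` becomes linear growth of `g`.
  have hgrow : ∀ z, ‖g z‖ ≤ (C + 1) * (1 + ‖z‖) := by
    intro z
    have h3 : dist (G z) (Φ p) = 2 / dist (Φ (S z) : R3) (Φ p) := by
      rw [hG]; simp only
      rw [dist_inversion_center, Real.sq_sqrt zero_le_two]
    have h4 : dist (S z : R3) p = 2 / dist (ι z) p := by
      rw [hScoe, hσ]; simp only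
      rw [dist_inversion_center, Real.sq_sqrt zero_le_two]
    have h5 := hC (Φ (S z))
    rw [Φ.symm_apply_apply, Φ.symm_apply_apply, Subtype.dist_eq, Subtype.dist_eq, h4] at h5
    have hA : 0 < dist (Φ (S z) : R3) (Φ p) := dist_pos.2 (hΦS z)
    have hB : 0 < dist (ι z) (p : R3) := dist_pos.2 (hιp z)
    have h6 : 2 / dist (Φ (S z) : R3) (Φ p) ≤ C * dist (ι z) (p : R3) := by
      rw [div_le_iff₀ hA]
      rw [div_le_iff₀ hB] at h5
      linarith
    have h7 : dist (ι z) (p : R3) ≤ 1 + ‖z‖ := by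
      rw [dist_eq_norm]
      refine (norm_sub_le _ _).trans ?_
      rw [norm_coe_S2, ι.norm_map]; linarith
    have h8 : ‖g z‖ ≤ dist (G z) (Φ p) + 1 := by
      rw [← ι'.norm_map, hιg, dist_eq_norm]
      have := norm_sub_le (G z - Φ p) (-(Φ p : R3))
      rwa [sub_neg_eq_add, sub_add_cancel, norm_neg, norm_coe_S2] at this
    rw [h3] at h8
    have h9 := mul_le_mul_of_nonneg_left h7 hC0
    nlinarith [norm_nonneg z]
  obtain ⟨a, ha, hsim⟩ := exists_similarity_of_conformal hgC hconf hgrow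
  refine ⟨a, ha, fun x y => ?_⟩
  by_cases hx : x = p
  · simp [hx]
  by_cases hy : y = p
  · simp [hy]
  have key : ∀ x : S2, x ≠ p → ∃ z, ι z = inversion (p : R3) (√2) x ∧ S z = x := by
    intro x hx
    refine ⟨τ (inversion (p : R3) (√2) x), hιτ _ (inner_inversion_of_mem_sphere hx), ?_⟩
    rw [hS]; simp only
    rw [hσ]; simp only
    rw [hιτ _ (inner_inversion_of_mem_sphere hx), inversion_inversion _ h2, radialProj_coe]
  obtain ⟨z, hz, hzS⟩ := key x hx
  obtain ⟨w, hw, hwS⟩ := key y hy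
  have h3 := hsim z w
  rw [← ι.norm_map (z - w), map_sub, hz, hw, ← ι'.norm_map (g z - g w), map_sub, hιg, hιg, ← dist_eq_norm,
    ← dist_eq_norm, hG] at h3
  simp only at h3
  rw [dist_inversion_inversion (hΦS z) (hΦS w), dist_inversion_inversion (fun h => hx (Subtype.ext h))
    (fun h => hy (Subtype.ext h)), hzS, hwS, Real.sq_sqrt zero_le_two] at h3
  have hA : 0 < dist x p := dist_pos.2 hx
  have hB : 0 < dist y p := dist_pos.2 hy
  have hA' : 0 < dist (Φ x) (Φ p) := dist_pos.2 fun h => hx (Φ.injective h)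
  have hB' : 0 < dist (Φ y) (Φ p) := dist_pos.2 fun h => hy (Φ.injective h)
  simp only [← Subtype.dist_eq] at h3
  field_simp at h3
  linarith

end Stereographic

/-! ### The law of the distance to a point. -/

section Distance

lemma dist_sq_S2 (x v : S2) : dist x v ^ 2 = 2 - 2 * ⟪(x : R3), (v : R3)⟫ := by
  rw [Subtype.dist_eq, dist_eq_norm, norm_sub_sq_real, norm_coe_S2, norm_coe_S2]; ring

lemma dist_le_two (x y : S2) : dist x y ≤ 2 := by
  rw [Subtype.dist_eq, dist_eq_norm]
  refine (norm_sub_le _ _).trans ?_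
  rw [norm_coe_S2, norm_coe_S2]; norm_num

lemma dist_neg_self (x : S2) : dist x (-x) = 2 := by
  rw [Subtype.dist_eq, dist_eq_norm, coe_neg_sphere, sub_neg_eq_add, ← two_smul ℝ, norm_smul,
    norm_coe_S2]
  norm_num

/-- The squared distance to a point of the sphere is uniformly distributed on `[0, 4]`. -/
lemma lintegral_dist_sq (v : S2) {G g : ℝ → ℝ} (hG : ContinuousOn G (Icc 0 4))
    (hd : ∀ s ∈ Ioo (0 : ℝ) 4, HasDerivAt G (g s) s) (hg : ∀ s ∈ Ioo (0 : ℝ) 4, 0 ≤ g s)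
    (hm : Measurable g) :
    ∫⁻ x, ENNReal.ofReal (g (dist x v ^ 2)) ∂vg = ENNReal.ofReal ((G 4 - G 0) / 4) := by
  simp only [dist_sq_S2]
  have hmt : Measurable fun t : ℝ => ENNReal.ofReal (g (2 - 2 * t)) :=
    (hm.comp (by fun_prop : Measurable fun t : ℝ => 2 - 2 * t)).ennreal_ofReal
  have h1 : ∫⁻ x : S2, ENNReal.ofReal (g (2 - 2 * ⟪(x : R3), (v : R3)⟫)) ∂vg =
      ∫⁻ t, ENNReal.ofReal (g (2 - 2 * t)) ∂(vg.map fun x : S2 => ⟪(x : R3), (v : R3)⟫) :=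
    (lintegral_map hmt (continuous_inner_coe _).measurable).symm
  have hmaps : MapsTo (fun t : ℝ => 2 - 2 * t) (Icc (-1) 1) (Icc 0 4) := by
    intro t ht; constructor <;> linarith [ht.1, ht.2]
  have hcont : ContinuousOn (fun t => -(G (2 - 2 * t)) / 2) (Icc (-1 : ℝ) 1) :=
    ((hG.comp (by fun_prop) hmaps).neg).div_const 2
  have hder : ∀ t ∈ Ioo (-1 : ℝ) 1,
      HasDerivAt (fun t => -(G (2 - 2 * t)) / 2) (g (2 - 2 * t)) t := by
    intro t ht
    have h2 : HasDerivAt (fun t : ℝ => 2 - 2 * t) (-2) t := by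
      simpa using ((hasDerivAt_id t).const_mul 2).const_sub 2
    have h3 := ((hd (2 - 2 * t) ⟨by linarith [ht.2], by linarith [ht.1]⟩).comp t h2).neg.div_const 2
    exact h3.congr_deriv (by ring)
  have hpos : ∀ t ∈ Ioo (-1 : ℝ) 1, 0 ≤ g (2 - 2 * t) := fun t ht =>
    hg _ ⟨by linarith [ht.2], by linarith [ht.1]⟩
  have hint := intervalIntegral.integrableOn_deriv_of_nonneg hcont hder hpos
  have hval := intervalIntegral.integral_eq_sub_of_hasDerivAt_of_le (by norm_num : (-1 : ℝ) ≤ 1)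
    hcont hder ((intervalIntegrable_iff_integrableOn_Ioc_of_le (by norm_num)).2 hint)
  rw [h1, vg_map_inner (norm_coe_S2 v), lintegral_smul_measure, ← restrict_Ioo_eq_restrict_Icc,
    ← ofReal_integral_eq_lintegral_ofReal (hint.mono_set Ioo_subset_Ioc_self)
      ((ae_restrict_iff' measurableSet_Ioo).2 (.of_forall hpos)), restrict_Ioo_eq_restrict_Ioc,
    ← intervalIntegral.integral_of_le (by norm_num), hval, smul_eq_mul,
    ← ENNReal.ofReal_mul (by norm_num)]
  congr 1
  norm_num
  ring

/-- The squared distance is uniform on `[0, 4]`, and `1/√s` has primitive `2√s`. -/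
lemma lintegral_inv_dist (v : S2) : ∫⁻ x, ENNReal.ofReal (1 / dist x v) ∂vg = 1 := by
  have h := lintegral_dist_sq v (G := fun s => 2 * √s) (g := fun s => 1 / √s)
    (by fun_prop) (fun s hs => by
      refine ((Real.hasDerivAt_sqrt hs.1.ne').const_mul 2).congr_deriv ?_
      have := Real.sqrt_pos.2 hs.1
      field_simp) (fun s _ => by positivity) (by fun_prop)
  simp only [Real.sqrt_sq dist_nonneg] at h
  rw [h, show (4 : ℝ) = 2 ^ 2 by norm_num, Real.sqrt_sq (by norm_num)]
  norm_num

lemma exists_third_point (x p : S2) : ∃ y : S2, y ≠ x ∧ y ≠ p := by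
  obtain ⟨ι, -, hι, -⟩ := exists_tangent_frame p
  have hn : ∀ z : ℂ, ‖z‖ = 1 → ι z ∈ sphere (0 : R3) 1 := fun z hz => by simp [hz]
  have hp : ∀ (z : ℂ) (hz : ‖z‖ = 1), (⟨ι z, hn z hz⟩ : S2) ≠ p := by
    rintro z hz rfl
    have := hι z
    simp [hz] at this
  by_cases h : (⟨ι 1, hn 1 (by simp)⟩ : S2) = x
  · refine ⟨⟨ι (-1), hn (-1) (by simp)⟩, ?_, hp (-1) (by simp)⟩
    rintro rfl
    have h2 := ι.injective (congrArg Subtype.val h)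
    norm_num at h2
  · exact ⟨_, h, hp 1 (by simp)⟩

end Distance

/-! ### Conformal automorphisms: concentrating or bi-Lipschitz. -/

section Dichotomy

variable {Φ : S2 ≃ₘ⟮𝓡 2, 𝓡 2⟯ S2}

/-- Take the identity based at `p` for the pair `x, y` and the one based at `x` for the pair `p, y`,
with `y` any third point. In their product every distance involving `y` cancels. Thus `1 / a p`
plays the role of the conformal factor of `Φ` at `p`. -/
theorem IsConformal.exists_conformal_factor (hΦ : IsConformal Φ) : ∃ a : S2 → ℝ, (∀ p, 0 < a p) ∧
    (∀ p x y : S2, dist (Φ x) (Φ y) * (dist x p * dist y p) =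
      a p * (dist x y * (dist (Φ x) (Φ p) * dist (Φ y) (Φ p)))) ∧
    ∀ p x : S2, a p * a x * dist (Φ x) (Φ p) ^ 2 = dist x p ^ 2 := by
  choose a ha h using hΦ.exists_dist_eq
  refine ⟨a, ha, h, fun p x => ?_⟩
  by_cases hx : x = p
  · simp [hx]
  obtain ⟨y, hyx, hyp⟩ := exists_third_point x p
  have h1 := h p x y
  have h2 := h x p y
  have hA : 0 < dist (Φ y) (Φ p) := dist_pos.2 fun h => hyp (Φ.injective h)
  have hB : 0 < dist (Φ y) (Φ x) := dist_pos.2 fun h => hyx (Φ.injective h)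
  have hC : 0 < dist y p := dist_pos.2 hyp
  have hD : 0 < dist y x := dist_pos.2 hyx
  rw [dist_comm x y, dist_comm (Φ x) (Φ y)] at h1
  rw [dist_comm p y, dist_comm (Φ p) (Φ y), dist_comm p x, dist_comm (Φ p) (Φ x)] at h2
  have h3 : (dist (Φ y) (Φ x) * dist (Φ y) (Φ p) * dist y p * dist y x) * (dist x p ^ 2) =
      (dist (Φ y) (Φ x) * dist (Φ y) (Φ p) * dist y p * dist y x) *
        (a p * a x * dist (Φ x) (Φ p) ^ 2) := by
    linear_combination (dist (Φ y) (Φ p) * (dist x p * dist y x)) * h1 +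
      (a p * (dist y x * (dist (Φ x) (Φ p) * dist (Φ y) (Φ p)))) * h2
  exact (mul_left_cancel₀ (by positivity) h3).symm

lemma continuous_diffeo_coe (Φ : S2 ≃ₘ⟮𝓡 2, 𝓡 2⟯ S2) : Continuous fun x => (Φ x : R3) :=
  continuous_subtype_val.comp Φ.continuous

/-- Either a conformal automorphism moves the centre of mass of the sphere far from the origin,
or it is bi-Lipschitz with a universal constant. -/
theorem IsConformal.half_le_or_biLipschitz (hΦ : IsConformal Φ) :
    1 / 2 ≤ ‖∫ x, (Φ x : R3) ∂vg‖ ∨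
      ∀ x y, dist (Φ x) (Φ y) ≤ 8 * dist x y ∧ dist x y ≤ 8 * dist (Φ x) (Φ y) := by
  obtain ⟨a, ha, h, hsq⟩ := hΦ.exists_conformal_factor
  by_cases hsmall : ∃ p, a p ≤ 1 / 8
  · left
    obtain ⟨p, hp⟩ := hsmall
    -- A small `a p` means strong expansion at `p`, so most of the sphere is sent close to the image
    -- `e` of the antipode. The identity bounds the distance of `Φ x` to `e` by `1 / (2 dist x p)`,
    -- whose integral is `1/2`.
    set e := Φ (-p)
    have hint : Integrable (fun x => (Φ x : R3)) vg :=
      (continuous_diffeo_coe Φ).integrable_of_hasCompactSupport (HasCompactSupport.of_compactSpace _)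
    have hpt : ∀ x, x ≠ p → dist (Φ x) e ≤ 1 / 2 * (1 / dist x p) := by
      intro x hx
      have h1 := h p x (-p)
      rw [dist_comm (-p) p, dist_neg_self] at h1
      have hd : 0 < dist x p := dist_pos.2 hx
      have h2 : dist x (-p) * (dist (Φ x) (Φ p) * dist (Φ (-p)) (Φ p)) ≤ 2 * (2 * 2) := by
        gcongr <;> exact dist_le_two _ _
      have h3 := mul_le_mul hp h2 (by positivity) (by norm_num)
      rw [← h1] at h3
      rw [one_div_mul_one_div, le_div_iff₀ (by positivity)]
      linarith
    have hae : ∀ᵐ x ∂vg, x ≠ p := by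
      have hz : vg {p} = 0 := by
        have h1 : vg {p} ≤ (vg.map fun x : S2 => ⟪(x : R3), (p : R3)⟫) {1} := by
          rw [Measure.map_apply (continuous_inner_coe _).measurable (measurableSet_singleton _)]
          exact measure_mono (by rintro x rfl; simp)
        rw [vg_map_inner (norm_coe_S2 p)] at h1
        simpa using h1
      exact measure_eq_zero_iff_ae_notMem.1 hz
    have hle : ∫⁻ x, ‖(Φ x : R3) - e‖ₑ ∂vg ≤ ENNReal.ofReal (1 / 2) := by
      calc ∫⁻ x, ‖(Φ x : R3) - e‖ₑ ∂vg
          ≤ ∫⁻ x, ENNReal.ofReal (1 / 2) * ENNReal.ofReal (1 / dist x p) ∂vg := by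
            refine lintegral_mono_ae (hae.mono fun x hx => ?_)
            rw [← ofReal_norm, ← ENNReal.ofReal_mul (by norm_num), ← dist_eq_norm,
              ← Subtype.dist_eq]
            exact ENNReal.ofReal_le_ofReal (hpt x hx)
        _ = _ := by
            rw [lintegral_const_mul _ (by fun_prop), lintegral_inv_dist, mul_one]
    have h1 : ‖∫ x, ((Φ x : R3) - e) ∂vg‖ ≤ 1 / 2 := by
      have := (enorm_integral_le_lintegral_enorm _).trans hle
      rw [← ofReal_norm] at this
      exact (ENNReal.ofReal_le_ofReal_iff (by norm_num)).1 this
    rw [integral_sub hint (integrable_const _), integral_const] at h1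
    simp only [probReal_univ, one_smul] at h1
    have h2 := norm_sub_norm_le (e : R3) (e - ∫ x, (Φ x : R3) ∂vg)
    rw [norm_coe_S2, norm_sub_rev, sub_sub_cancel] at h2
    linarith [norm_sub_rev (e : R3) (∫ x, (Φ x : R3) ∂vg)]
  · right
    push Not at hsmall
    have hub : ∀ x, a x ≤ 8 := by
      intro x
      -- With images at the maximal distance `2`, the identity gives `a x · a y ≤ 1`, so the lower
      -- bound `1/8` for `a y` becomes the upper bound `8` for `a x`.
      obtain ⟨y, hy⟩ : ∃ y, Φ y = -Φ x := Φ.surjective (-Φ x)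
      have h1 := hsq x y
      rw [hy, dist_comm, dist_neg_self] at h1
      have h2 := dist_le_two y x
      have h3 : dist y x ^ 2 ≤ 4 := by nlinarith [dist_nonneg (x := y) (y := x)]
      nlinarith [hsmall y, ha x, ha y]
    intro x y
    have h1 := hsq y x
    have hx := hsmall x
    have hy := hsmall y
    constructor
    · refine abs_le_of_sq_le_sq' ?_ (by positivity) |>.2
      have : 1 / 64 ≤ a y * a x := by nlinarith
      nlinarith [sq_nonneg (dist (Φ x) (Φ y))]
    · refine abs_le_of_sq_le_sq' ?_ (by positivity) |>.2
      have : a y * a x ≤ 64 := by nlinarith [hub x, hub y, ha x, ha y]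
      rw [← h1]
      nlinarith [sq_nonneg (dist (Φ x) (Φ y))]

end Dichotomy

/-! ### A criterion for compactness of an operator. -/

section Compactness

/-- A bounded operator which, up to an arbitrarily small multiple of the norm, is controlled by
finitely many functionals on a dense subspace, is compact. -/
theorem isCompactOperator_of_finite_control {E F M : Type*} [NormedAddCommGroup E]
    [NormedSpace ℝ E] [NormedAddCommGroup F] [NormedSpace ℝ F] [CompleteSpace F]
    [AddCommGroup M] [Module ℝ M] (T : E →L[ℝ] F) (i : M →ₗ[ℝ] E) (hi : DenseRange i)
    (H : ∀ ε : ℝ, 0 < ε → ∃ (ι : Type) (_ : Fintype ι) (A : M →ₗ[ℝ] EuclideanSpace ℝ ι) (C : ℝ),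
      (∀ f, ‖A f‖ ≤ C * ‖i f‖) ∧ ∀ f, ‖T (i f)‖ ^ 2 ≤ ‖A f‖ ^ 2 + ε * ‖i f‖ ^ 2) :
    IsCompactOperator T := by
  set s : Set M := {f | ‖i f‖ < 1}
  have hs : TotallyBounded ((fun f => T (i f)) '' s) := by
    refine Metric.totallyBounded_of_finite_discretization fun ε hε => ?_
    -- Differences of points of the unit ball have norm below `2`, so the error is at most `4 ·
    -- ε²/8`; with `(ε/2)²` from the finite part the total stays below `ε²`.
    obtain ⟨ι, _, A, C, hA, hT⟩ := H (ε ^ 2 / 8) (by positivity)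
    have hb : TotallyBounded (A '' s) := by
      refine (isCompact_closedBall (0 : EuclideanSpace ℝ ι) |C|).totallyBounded.subset ?_
      rintro _ ⟨f, hf, rfl⟩
      rw [mem_closedBall_zero_iff]
      have hf' : ‖i f‖ < 1 := hf
      calc ‖A f‖ ≤ C * ‖i f‖ := hA f
        _ ≤ |C| * 1 := mul_le_mul (le_abs_self C) hf'.le (norm_nonneg _) (abs_nonneg _)
        _ = |C| := mul_one _
    obtain ⟨t, ht, hcov⟩ := Metric.totallyBounded_iff.1 hb (ε / 4) (by positivity)
    have : Fintype t := ht.fintype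
    have hch : ∀ x : (fun f => T (i f)) '' s, ∃ f ∈ s, T (i f) = x ∧ ∃ y : t, A f ∈ ball (y : EuclideanSpace ℝ ι) (ε / 4) := by
      rintro ⟨_, f, hf, rfl⟩
      obtain ⟨y, hy, h⟩ := mem_iUnion₂.1 (hcov ⟨f, hf, rfl⟩)
      exact ⟨f, hf, rfl, ⟨y, hy⟩, h⟩
    choose f hfs hfx y hy using hch
    have : Finite t := ht
    refine ⟨ULift (Fin (Nat.card t)), inferInstance,
      fun x => ULift.up (Finite.equivFin t (y x)), fun x x' hxx => ?_⟩
    have hyy : y x = y x' := (Finite.equivFin t).injective (ULift.up_injective hxx)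
    rw [← hfx x, ← hfx x', dist_eq_norm, ← map_sub, ← map_sub]
    have h1 := hT (f x - f x')
    have h2 : ‖A (f x - f x')‖ < ε / 2 := by
      have e1 := hy x
      have e2 := hy x'
      rw [hyy] at e1
      rw [map_sub, ← dist_eq_norm]
      have := dist_triangle_right (A (f x)) (A (f x')) (y x' : EuclideanSpace ℝ ι)
      rw [mem_ball] at e1 e2
      linarith
    have h3 : ‖i (f x - f x')‖ < 2 := by
      rw [map_sub]
      have e1 : ‖i (f x)‖ < 1 := hfs x
      have e2 : ‖i (f x')‖ < 1 := hfs x'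
      linarith [norm_sub_le (i (f x)) (i (f x'))]
    have h4 : ‖A (f x - f x')‖ ^ 2 < (ε / 2) ^ 2 := by gcongr
    have h5 : ‖i (f x - f x')‖ ^ 2 < 2 ^ 2 := by gcongr
    refine lt_of_pow_lt_pow_left₀ 2 hε.le ?_
    nlinarith [sq_nonneg ε, mul_lt_mul_of_pos_left h5 (by positivity : 0 < ε ^ 2 / 8)]
  refine (isCompactOperator_iff_image_ball_subset_compact (T : E →ₛₗ[RingHom.id ℝ] F) one_pos).2
    ⟨_, hs.closure.isCompact_of_isClosed isClosed_closure, ?_⟩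
  rintro _ ⟨u, hu, rfl⟩
  have h1 : u ∈ closure (ball 0 1 ∩ range i) :=
    hi.open_subset_closure_inter isOpen_ball hu
  have h2 := image_closure_subset_closure_image T.continuous ⟨u, h1, rfl⟩
  refine closure_mono ?_ h2
  rintro _ ⟨_, ⟨hf, f, rfl⟩, rfl⟩
  exact ⟨f, mem_ball_zero_iff.1 hf, rfl⟩

end Compactness

/-! ### Subdivision of a cube into small cubes. -/

section Cubes

/-- The uniform probability measure on an interval. -/
def uniformMeasure (a h : ℝ) : Measure ℝ :=
  volume.withDensity ((Ico a (a + h)).indicator fun _ => ENNReal.ofReal h⁻¹)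

lemma uniformMeasure_eq (a h : ℝ) :
    uniformMeasure a h = ENNReal.ofReal h⁻¹ • volume.restrict (Ico a (a + h)) := by
  rw [uniformMeasure, withDensity_indicator measurableSet_Ico, withDensity_const]

lemma isProbabilityMeasure_uniformMeasure (a : ℝ) {h : ℝ} (hh : 0 < h) :
    IsProbabilityMeasure (uniformMeasure a h) := by
  constructor
  rw [uniformMeasure_eq, Measure.smul_apply, Measure.restrict_apply_univ, Real.volume_Ico,
    smul_eq_mul, ← ENNReal.ofReal_mul (by positivity), add_sub_cancel_left, inv_mul_cancel₀ hh.ne',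
    ENNReal.ofReal_one]

lemma sum_restrict_Ico (a : ℝ) {h : ℝ} (hh : 0 < h) (n : ℕ) :
    ∑ i ∈ Finset.range n, (volume : Measure ℝ).restrict (Ico (a + i * h) (a + i * h + h)) =
      volume.restrict (Ico a (a + n * h)) := by
  induction n with
  | zero => simp
  | succ n ih =>
    rw [Finset.sum_range_succ, ih, ← Measure.restrict_union _ measurableSet_Ico,
      Ico_union_Ico_eq_Ico]
    · congr 2; push_cast; ring
    · have : 0 ≤ n * h := by positivity
      linarith
    · linarith
    · rw [Set.disjoint_left]
      intro x hx hx'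
      exact absurd hx.2 (not_lt.2 hx'.1)

/-- The edge of the `(n + 1)³` cubes subdividing the cube `[-1, 1)³`. -/
def cubeEdge (n : ℕ) : ℝ := 2 / (n + 1)

lemma cubeEdge_pos (n : ℕ) : 0 < cubeEdge n := by unfold cubeEdge; positivity

lemma sum_uniformMeasure (n : ℕ) :
    Measure.sum (fun i : Fin (n + 1) => uniformMeasure (-1 + i * cubeEdge n) (cubeEdge n)) =
      ENNReal.ofReal (cubeEdge n)⁻¹ • volume.restrict (Ico (-1) 1) := by
  simp only [uniformMeasure_eq]
  rw [Measure.sum_fintype, ← Finset.smul_sum, Fin.sum_univ_eq_sum_range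
    (fun i => (volume : Measure ℝ).restrict (Ico (-1 + i * cubeEdge n) (-1 + i * cubeEdge n + cubeEdge n))),
    sum_restrict_Ico _ (cubeEdge_pos n)]
  congr 3
  unfold cubeEdge
  push_cast
  field_simp
  ring

/-- The index set of the cubes of the subdivision. -/
abbrev CubeIndex (n : ℕ) : Type := Fin (n + 1) × Fin (n + 1) × Fin (n + 1)

/-- The uniform probability measure on a cube of the subdivision. -/
def cubeMeasure (n : ℕ) (t : CubeIndex n) : Measure R3 :=
  ((uniformMeasure (-1 + t.1 * cubeEdge n) (cubeEdge n)).prod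
    ((uniformMeasure (-1 + t.2.1 * cubeEdge n) (cubeEdge n)).prod
      (uniformMeasure (-1 + t.2.2 * cubeEdge n) (cubeEdge n)))).map ofCoords

instance (n : ℕ) (t : CubeIndex n) : IsProbabilityMeasure (cubeMeasure n t) := by
  have h := fun a : ℝ => isProbabilityMeasure_uniformMeasure a (cubeEdge_pos n)
  have h1 := h (-1 + t.1 * cubeEdge n)
  have h2 := h (-1 + t.2.1 * cubeEdge n)
  have h3 := h (-1 + t.2.2 * cubeEdge n)
  exact Measure.isProbabilityMeasure_map measurable_ofCoords.aemeasurable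

lemma spread_cubeMeasure_le (n : ℕ) (t : CubeIndex n) {F : R3 → ℝ} (hFm : Measurable F)
    (hF : ∀ y, y ≠ 0 → ContDiffAt ℝ 1 F y) :
    spread (cubeMeasure n t) F ≤ ENNReal.ofReal (cubeEdge n ^ 2) *
      ∫⁻ y, ENNReal.ofReal (‖gradient F y‖ ^ 2) ∂(cubeMeasure n t) := by
  have h := fun a : ℝ => isProbabilityMeasure_uniformMeasure a (cubeEdge_pos n)
  have h1 := h (-1 + t.1 * cubeEdge n)
  have h2 := h (-1 + t.2.1 * cubeEdge n)
  have h3 := h (-1 + t.2.2 * cubeEdge n)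
  have h0 : ∀ a, uniformMeasure a (cubeEdge n) {0} = 0 := fun a => by
    rw [uniformMeasure_eq, Measure.smul_apply]
    simp
  have hP : ∀ a, HasPoincare (uniformMeasure a (cubeEdge n)) (ENNReal.ofReal (cubeEdge n ^ 2)) :=
    fun a => hasPoincare_uniform a (cubeEdge_pos n)
  exact spread_le_gradient (h0 _) (h0 _) (hP _) (hP _) (hP _) hFm hF

/-- The cube `[-1, 1)³`. -/
def unitCube : Set (ℝ × ℝ × ℝ) := Ico (-1) 1 ×ˢ (Ico (-1) 1 ×ˢ Ico (-1) 1)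

lemma sum_cubeMeasure (n : ℕ) : Measure.sum (cubeMeasure n) =
    ENNReal.ofReal ((cubeEdge n)⁻¹ ^ 3) • (volume.restrict unitCube).map ofCoords := by
  have h := fun a : ℝ => isProbabilityMeasure_uniformMeasure a (cubeEdge_pos n)
  have e := sum_uniformMeasure n
  set u : Fin (n + 1) → Measure ℝ := fun i => uniformMeasure (-1 + i * cubeEdge n) (cubeEdge n)
  have : ∀ i, IsProbabilityMeasure (u i) := fun i => h _
  have h1 : Measure.sum (cubeMeasure n) =
      ((Measure.sum u).prod ((Measure.sum u).prod (Measure.sum u))).map ofCoords := by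
    rw [Measure.prod_sum, Measure.prod_sum, Measure.map_sum measurable_ofCoords.aemeasurable]
    rfl
  rw [h1, e]
  have h2 : ENNReal.ofReal ((cubeEdge n)⁻¹ ^ 3) = ENNReal.ofReal (cubeEdge n)⁻¹ ^ 3 :=
    ENNReal.ofReal_pow (by have := cubeEdge_pos n; positivity) 3
  rw [h2]
  set c := ENNReal.ofReal (cubeEdge n)⁻¹
  simp only [Measure.prod_smul_left, Measure.prod_smul_right, Measure.prod_restrict, smul_smul,
    Measure.map_smul]
  congr 1
  ring

lemma norm_ofCoords_sq (w : ℝ × ℝ × ℝ) :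
    ‖ofCoords w‖ ^ 2 = w.1 ^ 2 + w.2.1 ^ 2 + w.2.2 ^ 2 := by
  rw [EuclideanSpace.norm_sq_eq, Fin.sum_univ_three]
  simp [ofCoords]

/-- The cube lies between the balls of radius `1` and `2`. On balls, integrals of homogeneous
extensions factor into a radial constant and an integral over the sphere. -/
lemma lintegral_map_unitCube_le {g : R3 → ℝ≥0∞} (hg : Measurable g) :
    ∫⁻ y, g y ∂((volume.restrict unitCube).map ofCoords) ≤ ∫⁻ y, (ball 0 2).indicator g y := by
  have hs : unitCube ⊆ ofCoords ⁻¹' ball 0 2 := by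
    rintro w ⟨h1, h2, h3⟩
    rw [mem_preimage, mem_ball_zero_iff]
    refine lt_of_pow_lt_pow_left₀ 2 (by norm_num) ?_
    rw [norm_ofCoords_sq]
    have : ∀ t ∈ Ico (-1 : ℝ) 1, t ^ 2 ≤ 1 := fun t ht => by nlinarith [ht.1, ht.2]
    linarith [this _ h1, this _ h2, this _ h3]
  rw [lintegral_map hg measurable_ofCoords, lintegral_indicator measurableSet_ball,
    ← measurePreserving_ofCoords.setLIntegral_comp_preimage measurableSet_ball hg]
  exact lintegral_mono_set hs

lemma le_lintegral_map_unitCube {g : R3 → ℝ≥0∞} (hg : Measurable g) :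
    ∫⁻ y, (ball 0 1).indicator g y ≤ ∫⁻ y, g y ∂((volume.restrict unitCube).map ofCoords) := by
  have hs : ofCoords ⁻¹' ball 0 1 ⊆ unitCube := by
    intro w hw
    rw [mem_preimage, mem_ball_zero_iff] at hw
    have h : ‖ofCoords w‖ ^ 2 < 1 := by nlinarith [norm_nonneg (ofCoords w)]
    rw [norm_ofCoords_sq] at h
    refine ⟨⟨?_, ?_⟩, ⟨?_, ?_⟩, ⟨?_, ?_⟩⟩ <;>
      nlinarith [sq_nonneg w.1, sq_nonneg w.2.1, sq_nonneg w.2.2]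
  rw [lintegral_map hg measurable_ofCoords, lintegral_indicator measurableSet_ball,
    ← measurePreserving_ofCoords.setLIntegral_comp_preimage measurableSet_ball hg]
  exact lintegral_mono_set hs

end Cubes

/-! ### Finite-dimensional control of the `L²` norm on the sphere. -/

section Rellich

lemma lintegral_sum_cubeMeasure_le (n : ℕ) {g : R3 → ℝ≥0∞} (hg : Measurable g) :
    ∫⁻ y, g y ∂(Measure.sum (cubeMeasure n)) ≤
      ENNReal.ofReal ((cubeEdge n)⁻¹ ^ 3) * ∫⁻ y, (ball 0 2).indicator g y := by
  rw [sum_cubeMeasure, lintegral_smul_measure, smul_eq_mul]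
  exact mul_le_mul_right (lintegral_map_unitCube_le hg) _

lemma lintegral_cubeMeasure_le (n : ℕ) (t : CubeIndex n) {g : R3 → ℝ≥0∞} (hg : Measurable g) :
    ∫⁻ y, g y ∂(cubeMeasure n t) ≤
      ENNReal.ofReal ((cubeEdge n)⁻¹ ^ 3) * ∫⁻ y, (ball 0 2).indicator g y :=
  (lintegral_mono' (Measure.le_sum _ t) le_rfl).trans (lintegral_sum_cubeMeasure_le n hg)

lemma memLp_coneExt_cubeMeasure (f : SmoothFn) (n : ℕ) (t : CubeIndex n) :
    MemLp (coneExt f) 2 (cubeMeasure n t) := by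
  obtain ⟨C, hC0, hC⟩ := f.exists_bound
  have hae : ∀ᵐ y ∂(cubeMeasure n t), y ∈ ball (0 : R3) 2 := by
    rw [← compl_compl (ball (0 : R3) 2)]
    refine measure_eq_zero_iff_ae_notMem.1 (le_antisymm ?_ zero_le)
    rw [← lintegral_indicator_one measurableSet_ball.compl]
    refine (lintegral_cubeMeasure_le n t (measurable_one.indicator measurableSet_ball.compl)).trans
      (le_of_eq ?_)
    rw [indicator_indicator, inter_compl_self]
    simp
  refine MemLp.of_bound (measurable_coneExt f).aestronglyMeasurable (2 * C) (hae.mono fun y hy => ?_)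
  rw [mem_ball_zero_iff] at hy
  rw [coneExt, norm_mul, norm_norm]
  exact mul_le_mul hy.le (hC _) (norm_nonneg _) (by norm_num)

lemma indicator_ball_radial (r : ℝ) (a : ℝ → ℝ≥0∞) (b : S2 → ℝ≥0∞) (y : R3) :
    (ball (0 : R3) r).indicator (fun y => a ‖y‖ * b (radialProj y)) y =
      (Iio r).indicator a ‖y‖ * b (radialProj y) := by
  by_cases h : ‖y‖ < r
  · rw [indicator_of_mem (mem_ball_zero_iff.2 h), indicator_of_mem (mem_Iio.2 h)]
  · rw [indicator_of_notMem (fun h' => h (mem_ball_zero_iff.1 h')), indicator_of_notMem (s := Iio r) h, zero_mul]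

lemma lintegral_ball_radial (r : ℝ) {a : ℝ → ℝ≥0∞} (ha : Measurable a) {b : S2 → ℝ≥0∞}
    (hb : Measurable b) :
    ∫⁻ y : R3, (ball 0 r).indicator (fun y => a ‖y‖ * b (radialProj y)) y =
      (∫⁻ y : R3, (ball 0 r).indicator (fun y => a ‖y‖) y) * ∫⁻ x, b x ∂vg := by
  simp only [indicator_ball_radial]
  rw [lintegral_norm_radialProj (ha.indicator measurableSet_Iio) hb]
  congr 1
  refine lintegral_congr fun y => ?_
  have := indicator_ball_radial r a 1 y
  simpa using this.symm

/-- The second moment of the ball of radius `r`. -/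
def ballMoment (r : ℝ) : ℝ≥0∞ :=
  ∫⁻ y : R3, (ball 0 r).indicator (fun y => ENNReal.ofReal (‖y‖ ^ 2)) y

lemma ballMoment_lt_top (r : ℝ) : ballMoment r < ⊤ := by
  calc ballMoment r ≤ ∫⁻ y : R3, (ball 0 r).indicator (fun _ => ENNReal.ofReal (r ^ 2)) y := by
        refine lintegral_mono fun y => indicator_le_indicator' fun hy => ?_
        rw [mem_ball_zero_iff] at hy
        gcongr
    _ = ENNReal.ofReal (r ^ 2) * volume (ball (0 : R3) r) := lintegral_indicator_const measurableSet_ball _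
    _ < ⊤ := ENNReal.mul_lt_top ENNReal.ofReal_lt_top measure_ball_lt_top

lemma ballMoment_pos {r : ℝ} (hr : 0 < r) : 0 < ballMoment r := by
  rw [ballMoment, lintegral_pos_iff_support ((by fun_prop : Measurable fun y : R3 =>
    ENNReal.ofReal (‖y‖ ^ 2)).indicator measurableSet_ball)]
  have : ball (0 : R3) r \ {0} ⊆ Function.support
      ((ball (0 : R3) r).indicator fun y => ENNReal.ofReal (‖y‖ ^ 2)) := by
    rintro y ⟨hy, hy0⟩
    have h : 0 < ‖y‖ := norm_pos_iff.2 hy0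
    rw [Function.mem_support, indicator_of_mem hy]
    simpa using hy0
  refine lt_of_lt_of_le ?_ (measure_mono this)
  rw [measure_sdiff_null (measure_singleton 0)]
  exact measure_ball_pos _ _ hr

lemma coneExt_sq (f : S2 → ℝ) (y : R3) : ENNReal.ofReal (coneExt f y ^ 2) =
    ENNReal.ofReal (‖y‖ ^ 2) * ENNReal.ofReal (f (radialProj y) ^ 2) := by
  rw [coneExt, mul_pow, ENNReal.ofReal_mul (by positivity)]

lemma lintegral_ball_coneExt_sq (f : SmoothFn) (r : ℝ) :
    ∫⁻ y, (ball 0 r).indicator (fun y => ENNReal.ofReal (coneExt f y ^ 2)) y =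
      ballMoment r * ENNReal.ofReal (∫ x, f x ^ 2 ∂vg) := by
  have hfc : Continuous f := f.contMDiff.continuous
  simp only [coneExt_sq]
  rw [lintegral_ball_radial r (a := fun s => ENNReal.ofReal (s ^ 2)) (by fun_prop)
    (b := fun x => ENNReal.ofReal (f x ^ 2)) (by fun_prop), lintegral_sq]
  rfl

/-- The Dirichlet energy plus the `L²` norm squared, for the metric of the unit sphere. -/
def roundEnergy (f : SmoothFn) : ℝ := ∫ x, f x ^ 2 ∂vg + ∫ x, ‖roundGrad f x‖ ^ 2 ∂vg

lemma roundEnergy_nonneg (f : SmoothFn) : 0 ≤ roundEnergy f :=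
  add_nonneg (integral_nonneg fun _ => sq_nonneg _) (integral_nonneg fun _ => sq_nonneg _)

lemma lintegral_ball_gradient_coneExt (f : SmoothFn) (r : ℝ) :
    ∫⁻ y, (ball 0 r).indicator (fun y => ENNReal.ofReal (‖gradient (coneExt f) y‖ ^ 2)) y =
      volume (ball (0 : R3) r) * ENNReal.ofReal (roundEnergy f) := by
  have hfc : Continuous f := f.contMDiff.continuous
  have hgc := continuous_roundGrad f
  have hb : Measurable fun x => ENNReal.ofReal (f x ^ 2 + ‖roundGrad f x‖ ^ 2) := by
    have : Continuous fun x => f x ^ 2 + ‖roundGrad f x‖ ^ 2 := by fun_prop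
    exact this.measurable.ennreal_ofReal
  have h1 : ∀ᵐ y : R3, (ball (0 : R3) r).indicator
      (fun y => ENNReal.ofReal (‖gradient (coneExt f) y‖ ^ 2)) y =
      (ball 0 r).indicator (fun y => (fun _ => (1 : ℝ≥0∞)) ‖y‖ *
        (fun x => ENNReal.ofReal (f x ^ 2 + ‖roundGrad f x‖ ^ 2)) (radialProj y)) y := by
    have h0 : ∀ᵐ y : R3, y ≠ 0 := measure_eq_zero_iff_ae_notMem.1 (measure_singleton 0)
    refine h0.mono fun y hy => ?_
    by_cases h : y ∈ ball (0 : R3) r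
    · rw [indicator_of_mem h, indicator_of_mem h, norm_gradient_coneExt_sq f hy, one_mul]
    · rw [indicator_of_notMem h, indicator_of_notMem h]
  rw [lintegral_congr_ae h1, lintegral_ball_radial r measurable_const hb,
    ← ofReal_integral_eq_lintegral_ofReal (integrable_of_continuous (by fun_prop) _)
      (.of_forall fun x => by positivity), integral_add (integrable_of_continuous (by fun_prop) _)
      (integrable_of_continuous (by fun_prop) _), lintegral_indicator_const measurableSet_ball,
    one_mul]
  rfl

lemma measurable_norm_gradient_sq (F : R3 → ℝ) :
    Measurable fun y => ENNReal.ofReal (‖gradient F y‖ ^ 2) := by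
  have : Measurable fun y => fderiv ℝ F y := measurable_fderiv ℝ F
  have h2 : Measurable fun y => gradient F y :=
    (InnerProductSpace.toDual ℝ R3).symm.continuous.measurable.comp this
  exact (h2.norm.pow_const 2).ennreal_ofReal

/-- By Jensen the squared mean over a cube is at most the mean square; the cube has density at most
`h⁻³` and lies in the ball of radius `2`. This makes the cube means continuous functionals on `L²`.
-/
lemma sq_integral_coneExt_le (f : SmoothFn) (n : ℕ) (t : CubeIndex n) :
    (∫ y, coneExt f y ∂(cubeMeasure n t)) ^ 2 ≤
      (cubeEdge n)⁻¹ ^ 3 * (ballMoment 2).toReal * ∫ x, f x ^ 2 ∂vg := by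
  have hL := memLp_coneExt_cubeMeasure f n t
  have h1 : (∫ y, coneExt f y ∂(cubeMeasure n t)) ^ 2 ≤ ∫ y, coneExt f y ^ 2 ∂(cubeMeasure n t) := by
    have h2 := ProbabilityTheory.variance_nonneg (coneExt f) (cubeMeasure n t)
    rw [ProbabilityTheory.variance_eq_sub hL] at h2
    simpa using h2
  refine h1.trans ?_
  have h3 := lintegral_cubeMeasure_le n t ((measurable_coneExt f).pow_const 2).ennreal_ofReal
  have hX : 0 ≤ ∫ x, f x ^ 2 ∂vg := integral_nonneg fun _ => sq_nonneg _
  rw [lintegral_ball_coneExt_sq, ← ofReal_integral_eq_lintegral_ofReal hL.integrable_sq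
    (.of_forall fun y => sq_nonneg _), ← ENNReal.ofReal_toReal (ballMoment_lt_top 2).ne,
    ← ENNReal.ofReal_mul ENNReal.toReal_nonneg, ← ENNReal.ofReal_mul
      (by have := cubeEdge_pos n; positivity)] at h3
  rw [mul_assoc]
  refine (ENNReal.ofReal_le_ofReal_iff ?_).1 h3
  have := cubeEdge_pos n
  positivity

/-- On each cube of edge `h`, the mean square of the extension is at most its squared mean plus `h²`
times the mean energy. Summing over the cubes and multiplying by their volume `h³` gives the
estimate, with the ball of radius `1` on the left and that of radius `2` on the right. -/
lemma integral_sq_le_sum_cubes (f : SmoothFn) (n : ℕ) :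
    (ballMoment 1).toReal * ∫ x, f x ^ 2 ∂vg ≤
      cubeEdge n ^ 3 * ∑ t, (∫ y, coneExt f y ∂(cubeMeasure n t)) ^ 2 +
        cubeEdge n ^ 2 * ((volume (ball (0 : R3) 2)).toReal * roundEnergy f) := by
  have hh := cubeEdge_pos n
  have hD := roundEnergy_nonneg f
  have hX : 0 ≤ ∫ x, f x ^ 2 ∂vg := integral_nonneg fun _ => sq_nonneg _
  have hFm : Measurable fun y => ENNReal.ofReal (coneExt f y ^ 2) :=
    ((measurable_coneExt f).pow_const 2).ennreal_ofReal
  have hGm := measurable_norm_gradient_sq (coneExt f)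
  have hcube : ∀ t, ∫⁻ y, ENNReal.ofReal (coneExt f y ^ 2) ∂(cubeMeasure n t) ≤
      ENNReal.ofReal ((∫ y, coneExt f y ∂(cubeMeasure n t)) ^ 2) + ENNReal.ofReal (cubeEdge n ^ 2) *
        ∫⁻ y, ENNReal.ofReal (‖gradient (coneExt f) y‖ ^ 2) ∂(cubeMeasure n t) := by
    intro t
    have hL := memLp_coneExt_cubeMeasure f n t
    have h1 := spread_cubeMeasure_le n t (measurable_coneExt f) fun y hy => contDiffAt_coneExt f hy
    rw [spread_eq hL (measurable_coneExt f)] at h1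
    rw [← ofReal_integral_eq_lintegral_ofReal hL.integrable_sq (.of_forall fun y => sq_nonneg _)]
    refine le_trans ?_ (add_le_add le_rfl h1)
    set I := ∫ y, coneExt f y ^ 2 ∂(cubeMeasure n t)
    set J := (∫ y, coneExt f y ∂(cubeMeasure n t)) ^ 2
    rcases le_total J I with h | h
    · refine (ENNReal.ofReal_le_ofReal ?_).trans ENNReal.ofReal_add_le
      linarith
    · exact (ENNReal.ofReal_le_ofReal h).trans le_self_add
  have hsum : ∫⁻ y, ENNReal.ofReal (coneExt f y ^ 2) ∂(Measure.sum (cubeMeasure n)) ≤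
      ENNReal.ofReal (∑ t, (∫ y, coneExt f y ∂(cubeMeasure n t)) ^ 2) +
        ENNReal.ofReal (cubeEdge n ^ 2) * ∫⁻ y, ENNReal.ofReal (‖gradient (coneExt f) y‖ ^ 2)
          ∂(Measure.sum (cubeMeasure n)) := by
    rw [lintegral_sum_measure, lintegral_sum_measure, tsum_fintype, tsum_fintype, Finset.mul_sum,
      ENNReal.ofReal_sum_of_nonneg fun t _ => sq_nonneg _, ← Finset.sum_add_distrib]
    exact Finset.sum_le_sum fun t _ => hcube t
  have hupper := lintegral_map_unitCube_le hGm
  have hlower := le_lintegral_map_unitCube hFm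
  rw [lintegral_ball_coneExt_sq] at hlower
  rw [lintegral_ball_gradient_coneExt] at hupper
  rw [sum_cubeMeasure, lintegral_smul_measure, lintegral_smul_measure, smul_eq_mul, smul_eq_mul] at hsum
  have e3 : ENNReal.ofReal (cubeEdge n ^ 3) * ENNReal.ofReal ((cubeEdge n)⁻¹ ^ 3) = 1 := by
    rw [← ENNReal.ofReal_mul (by positivity), ← mul_pow, mul_inv_cancel₀ hh.ne', one_pow,
      ENNReal.ofReal_one]
  have h4 := mul_le_mul_right hsum (ENNReal.ofReal (cubeEdge n ^ 3))
  rw [← mul_assoc, e3, one_mul, mul_add, mul_left_comm, ← mul_assoc (ENNReal.ofReal (cubeEdge n ^ 3))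
    (ENNReal.ofReal ((cubeEdge n)⁻¹ ^ 3)), e3, one_mul] at h4
  have h5 := hlower.trans (h4.trans (add_le_add le_rfl (mul_le_mul_right hupper _)))
  rw [← ENNReal.ofReal_toReal (ballMoment_lt_top 1).ne,
    ← ENNReal.ofReal_toReal (measure_ball_lt_top (μ := (volume : Measure R3)) (x := 0) (r := 2)).ne,
    ← ENNReal.ofReal_mul ENNReal.toReal_nonneg, ← ENNReal.ofReal_mul ENNReal.toReal_nonneg,
    ← ENNReal.ofReal_mul (by positivity), ← ENNReal.ofReal_mul (by positivity),
    ← ENNReal.ofReal_add (by positivity) (by positivity)] at h5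
  exact (ENNReal.ofReal_le_ofReal_iff (by positivity)).1 h5

theorem exists_finite_control {ε : ℝ} (hε : 0 < ε) :
    ∃ (ι : Type) (_ : Fintype ι) (A : SmoothFn →ₗ[ℝ] EuclideanSpace ℝ ι) (C : ℝ),
      (∀ f, ‖A f‖ ^ 2 ≤ C * ∫ x, f x ^ 2 ∂vg) ∧
      ∀ f, ∫ x, f x ^ 2 ∂vg ≤ ‖A f‖ ^ 2 + ε * roundEnergy f := by
  set c := (ballMoment 1).toReal
  have hc : 0 < c := ENNReal.toReal_pos (ballMoment_pos one_pos).ne' (ballMoment_lt_top 1).ne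
  set V := (volume (ball (0 : R3) 2)).toReal
  have hlim : Tendsto (fun n => cubeEdge n ^ 2 * V / c) atTop (𝓝 0) := by
    have h1 : Tendsto cubeEdge atTop (𝓝 0) := by
      have := (tendsto_one_div_add_atTop_nhds_zero_nat (𝕜 := ℝ)).const_mul 2
      rw [mul_zero] at this
      refine this.congr fun n => ?_
      rw [cubeEdge, mul_one_div]
    simpa using ((h1.pow 2).mul_const V).div_const c
  obtain ⟨n, hn⟩ := (hlim.eventually_lt_const hε).exists
  have hh := cubeEdge_pos n
  -- The normalisation for which the sum of squared means, divided by `c`, is exactly `‖A f‖²`.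
  set s := √(cubeEdge n ^ 3 / c)
  have hs : s ^ 2 = cubeEdge n ^ 3 / c := Real.sq_sqrt (by positivity)
  have hint := fun (f : SmoothFn) t => (memLp_coneExt_cubeMeasure f n t).integrable (by norm_num)
  let A : SmoothFn →ₗ[ℝ] EuclideanSpace ℝ (CubeIndex n) :=
    { toFun := fun f => WithLp.toLp 2 fun t => s * ∫ y, coneExt f y ∂(cubeMeasure n t)
      map_add' := fun f g => by
        ext t
        change s * _ = s * _ + s * _
        rw [← mul_add, ← integral_add (hint f t) (hint g t)]
        congr 2
        funext y
        exact mul_add _ _ _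
      map_smul' := fun r f => by
        ext t
        change s * _ = r * (s * _)
        rw [mul_left_comm, ← integral_const_mul r]
        congr 2
        funext y
        exact mul_left_comm _ _ _ }
  have hA : ∀ f, ‖A f‖ ^ 2 = cubeEdge n ^ 3 / c * ∑ t, (∫ y, coneExt f y ∂(cubeMeasure n t)) ^ 2 := by
    intro f
    rw [EuclideanSpace.norm_sq_eq, ← hs, Finset.mul_sum]
    refine Finset.sum_congr rfl fun t _ => ?_
    change ‖s * _‖ ^ 2 = _
    rw [Real.norm_eq_abs, sq_abs, mul_pow]
  refine ⟨CubeIndex n, inferInstance, A, cubeEdge n ^ 3 / c * (∑ _t : CubeIndex n,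
    (cubeEdge n)⁻¹ ^ 3 * (ballMoment 2).toReal), fun f => ?_, fun f => ?_⟩
  · rw [hA, mul_assoc, Finset.sum_mul]
    gcongr with t _
    exact sq_integral_coneExt_le f n t
  · have h1 := integral_sq_le_sum_cubes f n
    rw [hA]
    have h2 : cubeEdge n ^ 2 * V / c * roundEnergy f ≤ ε * roundEnergy f :=
      mul_le_mul_of_nonneg_right hn.le (roundEnergy_nonneg f)
    refine le_trans ?_ (add_le_add le_rfl h2)
    rw [← mul_le_mul_iff_right₀ hc]
    refine h1.trans (le_of_eq ?_)
    change _ + _ * (V * _) = _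
    field_simp

end Rellich

/-! ### Rellich's theorem and admissibility. -/

section Admissible

lemma norm_sq_toLp {E : Type*} [NormedAddCommGroup E] [InnerProductSpace ℝ E]
    [CompleteSpace E] [SecondCountableTopologyEither S2 E] (f : C(S2, E)) :
    ‖ContinuousMap.toLp (E := E) 2 vg ℝ f‖ ^ 2 = ∫ x, ‖f x‖ ^ 2 ∂vg := by
  rw [← real_inner_self_eq_norm_sq, L2.inner_def]
  refine integral_congr_ae ?_
  filter_upwards [ContinuousMap.coeFn_toLp (p := 2) vg (𝕜 := ℝ) f] with x hx
  rw [hx, real_inner_self_eq_norm_sq]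

lemma norm_sq_toW12 (f : SmoothFn) :
    ‖f.toW12‖ ^ 2 = ∫ x, f x ^ 2 ∂vg + ∫ x, ‖sgrad f x‖ ^ 2 ∂vg := by
  change ‖smoothJet f‖ ^ 2 = _
  rw [WithLp.prod_norm_sq_eq_of_L2]
  change ‖ContinuousMap.toLp 2 vg ℝ (⟨f, f.contMDiff.continuous⟩ : C(S2, ℝ))‖ ^ 2 +
    ‖ContinuousMap.toLp 2 vg ℝ (⟨sgrad f, continuous_sgrad f⟩ : C(S2, R3))‖ ^ 2 = _
  rw [norm_sq_toLp, norm_sq_toLp]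
  simp

lemma roundEnergy_le (f : SmoothFn) : roundEnergy f ≤ ‖f.toW12‖ ^ 2 := by
  have hgc := continuous_roundGrad f
  rw [norm_sq_toW12, roundEnergy]
  simp only [norm_sgrad_sq]
  rw [integral_const_mul]
  have h : 0 ≤ ∫ x, ‖roundGrad f x‖ ^ 2 ∂vg := integral_nonneg fun _ => sq_nonneg _
  nlinarith [Real.pi_gt_three]

/-- The map `C^∞(S²) → W^{1,2}(S²)`. -/
def toW12Linear : SmoothFn →ₗ[ℝ] W12 :=
  smoothJet.codRestrict W12 fun f => Submodule.le_topologicalClosure _ ⟨f, rfl⟩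

lemma denseRange_toW12Linear : DenseRange toW12Linear := by
  rw [DenseRange, Subtype.dense_iff]
  intro u hu
  have h : u ∈ closure (range smoothJet) := by
    have h2 : u ∈ (LinearMap.range smoothJet).topologicalClosure := hu
    rwa [← SetLike.mem_coe, Submodule.topologicalClosure_coe, LinearMap.coe_range] at h2
  refine closure_mono ?_ h
  rintro _ ⟨f, rfl⟩
  exact ⟨toW12Linear f, ⟨f, rfl⟩, rfl⟩

/-- The embedding `W^{1,2}(S²) → L²(S²)`. -/
def embedL2 : W12 →L[ℝ] Lp ℝ 2 vg :=
  (WithLp.fstL 2 ℝ (Lp ℝ 2 vg) (Lp R3 2 vg)).comp W12.subtypeL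

lemma embedL2_toW12 (f : SmoothFn) :
    embedL2 f.toW12 = ContinuousMap.toLp 2 vg ℝ (⟨f, f.contMDiff.continuous⟩ : C(S2, ℝ)) := rfl

/-- Rellich's theorem on the sphere. -/
theorem isCompactOperator_embedL2 : IsCompactOperator embedL2 := by
  refine isCompactOperator_of_finite_control embedL2 toW12Linear denseRange_toW12Linear
    fun ε hε => ?_
  obtain ⟨ι, hι, A, C, hC, hA⟩ := exists_finite_control hε
  have e : ∀ f, ‖embedL2 (toW12Linear f)‖ ^ 2 = ∫ x, f x ^ 2 ∂vg := fun f => by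
    change ‖embedL2 f.toW12‖ ^ 2 = _
    rw [embedL2_toW12, norm_sq_toLp]
    simp
  refine ⟨ι, hι, A, √|C|, fun f => ?_, fun f => ?_⟩
  · refine (sq_le_sq₀ (norm_nonneg _) (by positivity)).1 ?_
    rw [mul_pow, Real.sq_sqrt (abs_nonneg _)]
    have h1 : ∫ x, f x ^ 2 ∂vg ≤ ‖toW12Linear f‖ ^ 2 := by
      have h2 : 0 ≤ ∫ x, ‖roundGrad f x‖ ^ 2 ∂vg := integral_nonneg fun _ => sq_nonneg _
      have h3 : roundEnergy f ≤ ‖toW12Linear f‖ ^ 2 := roundEnergy_le f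
      rw [roundEnergy] at h3
      linarith
    exact (hC f).trans (mul_le_mul (le_abs_self C) h1 (integral_nonneg fun _ => sq_nonneg _)
      (abs_nonneg _))
  · rw [e]
    have h3 : roundEnergy f ≤ ‖toW12Linear f‖ ^ 2 := roundEnergy_le f
    exact (hA f).trans (by gcongr)

/-- Under a bounded density the identity is bounded from `L²(v_g)` to `L²(μ)`; it is composed with
the compact embedding of `W^{1,2}` into `L²(v_g)`. -/
theorem admissible_of_le {μ : Measure S2} {c : ℝ≥0∞} (hc : c ≠ ⊤) (h : μ ≤ c • vg) :
    Admissible μ := by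
  have hac : μ ≪ vg := Measure.absolutelyContinuous_of_le_smul h
  have hae := ContinuousMap.coeFn_toLp (E := ℝ) (p := 2) vg (𝕜 := ℝ)
  refine ⟨⟨(h univ).trans_lt ?_⟩, (Lp.LpToLpOfMeasureLeSMul hc h).comp embedL2,
    isCompactOperator_embedL2.clm_comp (Lp.LpToLpOfMeasureLeSMul hc h), fun f => ?_⟩
  · rw [Measure.smul_apply, measure_univ, smul_eq_mul, mul_one]
    exact hc.lt_top
  · refine (Lp.coeFn_LpToLpOfMeasureLeSMul hc h _).trans (hac.ae_le ?_)
    exact hae ⟨f, f.contMDiff.continuous⟩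

end Admissible

/-! ### The Luxemburg norm of functions with a regularised inverse-distance singularity. -/

section Orlicz

/-- The Young function of `L²(Log L)^{-1/2}`. -/
def youngFn (t : ℝ) : ℝ := t ^ 2 / Real.log (2 + t)

lemma log_two_le {t : ℝ} (ht : 0 ≤ t) : 1 / 2 ≤ Real.log (2 + t) := by
  have h1 : Real.log 2 ≤ Real.log (2 + t) := Real.log_le_log (by norm_num) (by linarith)
  linarith [Real.log_two_gt_d9]

lemma youngFn_nonneg {t : ℝ} (ht : 0 ≤ t) : 0 ≤ youngFn t :=
  div_nonneg (sq_nonneg _) (by linarith [log_two_le ht])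

/-- The tangent line bound for the logarithm at `2 + s` shows that the denominator grows more slowly
than the square. -/
lemma youngFn_mono {s t : ℝ} (hs : 0 ≤ s) (hst : s ≤ t) : youngFn s ≤ youngFn t := by
  have h1 := log_two_le hs
  have h2 := log_two_le (hs.trans hst)
  rw [youngFn, youngFn, div_le_div_iff₀ (by linarith) (by linarith)]
  have hs2 : 0 < 2 + s := by linarith
  have ht2 : 0 < 2 + t := by linarith
  have h3 : Real.log (2 + t) ≤ Real.log (2 + s) + (t - s) / (2 + s) := by
    have h4 := Real.log_le_sub_one_of_pos (show 0 < (2 + t) / (2 + s) by positivity)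
    rw [Real.log_div (by positivity) (by positivity)] at h4
    have h5 : (2 + t) / (2 + s) - 1 = (t - s) / (2 + s) := by field_simp; ring
    linarith
  have h6 : s ^ 2 * ((t - s) / (2 + s)) ≤ s * (t - s) := by
    rw [← mul_div_assoc, div_le_iff₀ (by positivity)]
    nlinarith [mul_nonneg hs (sub_nonneg.2 hst)]
  nlinarith [mul_le_mul_of_nonneg_left h3 (sq_nonneg s), mul_nonneg hs (sub_nonneg.2 hst),
    mul_nonneg (mul_nonneg (add_nonneg hs (hs.trans hst)) (sub_nonneg.2 hst)) (sub_nonneg.2 h1)]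

lemma measurable_youngFn : Measurable youngFn := by
  unfold youngFn; fun_prop

lemma luxemburg_le {u : S2 → ℝ} {η : ℝ} (hη : 0 < η)
    (h : ∫⁻ x, ENNReal.ofReal (youngFn (|u x| / η)) ∂vg ≤ 1) : luxemburg u ≤ ENNReal.ofReal η :=
  iInf_le_of_le η (iInf_le_of_le hη (iInf_le _ h))

lemma exists_of_luxemburg_lt {u : S2 → ℝ} {b : ℝ≥0∞} (h : luxemburg u < b) :
    ∃ η : ℝ, 0 < η ∧ ∫⁻ x, ENNReal.ofReal (youngFn (|u x| / η)) ∂vg ≤ 1 ∧ ENNReal.ofReal η < b := by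
  simp only [luxemburg, iInf_lt_iff] at h
  obtain ⟨η, hη, h1, h2⟩ := h
  exact ⟨η, hη, h1, h2⟩

lemma luxemburg_le_half_of_bound {u : S2 → ℝ} (h : ∀ x, |u x| ≤ 1 / 2) :
    luxemburg u ≤ ENNReal.ofReal (1 / 2) := by
  refine luxemburg_le (by norm_num) ?_
  have h1 : youngFn 1 ≤ 1 := by
    have h2 : (1 : ℝ) / 2 ≤ Real.log (2 + 1) := log_two_le (by norm_num)
    rw [youngFn, div_le_one (lt_of_lt_of_le (by norm_num) h2)]
    rw [one_pow, Real.le_log_iff_exp_le (by norm_num)]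
    linarith [Real.exp_one_lt_d9]
  calc ∫⁻ x, ENNReal.ofReal (youngFn (|u x| / (1 / 2))) ∂vg ≤ ∫⁻ _, 1 ∂vg := by
        refine lintegral_mono fun x => ?_
        rw [← ENNReal.ofReal_one]
        refine ENNReal.ofReal_le_ofReal ((youngFn_mono (by positivity) ?_).trans h1)
        linarith [h x]
    _ = 1 := by simp

/-- With `x` a squared distance, the first term is the critical one: its integral diverges only like
`log log`. It is used where `κ / √x` is at least `x^(-1/4)`, so that `log (2 + κ/√x)` is comparable
to `log (16/x)`. Elsewhere the logarithm is dropped and the bound is integrable. -/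
lemma youngFn_inv_sqrt_le {κ x : ℝ} (hκ : 0 ≤ κ) (hx : 0 < x) (hx5 : x ≤ 5) :
    youngFn (κ / √x) ≤ 8 * κ ^ 2 * (1 / (x * Real.log (16 / x))) + 2 * κ * x ^ (-(3 / 4) : ℝ) := by
  set t := κ / √x with ht
  have ht0 : 0 ≤ t := by positivity
  have hl := log_two_le ht0
  have hL : 0 < Real.log (16 / x) := Real.log_pos (by rw [lt_div_iff₀ hx]; linarith)
  have hA : 0 ≤ 8 * κ ^ 2 * (1 / (x * Real.log (16 / x))) := by positivity
  have hB : 0 ≤ 2 * κ * x ^ (-(3 / 4) : ℝ) := by positivity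
  have hsq : t ^ 2 = κ ^ 2 / x := by rw [ht, div_pow, Real.sq_sqrt hx.le]
  rcases le_or_gt (x ^ (-(1 / 4) : ℝ)) t with h | h
  · have h1 : Real.log (16 / x) ≤ 8 * Real.log (2 + t) := by
      rw [← Nat.cast_ofNat (R := ℝ) (n := 8), ← Real.log_pow]
      refine Real.log_le_log (by positivity) ?_
      rcases le_or_gt x (1 / 16) with hx' | hx'
      · have h2 : (x ^ (-(1 / 4) : ℝ)) ^ 8 ≤ t ^ 8 := by gcongr
        rw [← Real.rpow_natCast, ← Real.rpow_mul hx.le] at h2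
        norm_num at h2
        have h3 : t ^ 8 ≤ (2 + t) ^ 8 := by gcongr; linarith
        refine le_trans ?_ (h2.trans h3)
        rw [← one_div, div_le_div_iff₀ hx (by positivity)]
        nlinarith
      · calc 16 / x ≤ 2 ^ 8 := by rw [div_le_iff₀ hx]; linarith
          _ ≤ (2 + t) ^ 8 := by gcongr; linarith
    refine le_trans ?_ (le_add_of_nonneg_right hB)
    rw [youngFn, hsq, div_div, mul_one_div, div_le_div_iff₀ (by positivity) (by positivity)]
    have : 0 ≤ κ ^ 2 * x := by positivity
    nlinarith [mul_le_mul_of_nonneg_left h1 this]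
  · refine le_trans ?_ (le_add_of_nonneg_left hA)
    have h1 : youngFn t ≤ 2 * t ^ 2 := by
      rw [youngFn, div_le_iff₀ (by linarith)]
      nlinarith [sq_nonneg t]
    have h2 : t ^ 2 ≤ t * x ^ (-(1 / 4) : ℝ) := by rw [sq]; gcongr
    have h3 : t * x ^ (-(1 / 4) : ℝ) = κ * x ^ (-(3 / 4) : ℝ) := by
      rw [ht, Real.sqrt_eq_rpow, div_eq_mul_inv, ← Real.rpow_neg hx.le, mul_assoc,
        ← Real.rpow_add hx]
      norm_num
    linarith

/-- The regularisation parameter `exp (- exp N)`. -/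
def regParam (N : ℝ) : ℝ := Real.exp (-Real.exp N)

lemma regParam_pos (N : ℝ) : 0 < regParam N := Real.exp_pos _

lemma regParam_le_one (N : ℝ) : regParam N ≤ 1 :=
  Real.exp_le_one_iff.2 (neg_nonpos.2 (Real.exp_pos _).le)

lemma log_log_regParam_le {N : ℝ} (hN : 1 ≤ N) :
    Real.log (Real.log (16 / regParam N)) ≤ 3 * N := by
  have h1 : Real.log (16 / regParam N) = Real.log 16 + Real.exp N := by
    rw [Real.log_div (by norm_num) (regParam_pos N).ne', regParam, Real.log_exp]; ring
  have h2 : Real.log 16 ≤ 3 := by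
    rw [show (16 : ℝ) = 2 ^ 4 by norm_num, Real.log_pow]
    push_cast
    linarith [Real.log_two_lt_d9]
  have h3 : (1 : ℝ) ≤ Real.exp N := Real.one_le_exp (by linarith)
  have h4 : (0 : ℝ) < Real.log 16 := Real.log_pos (by norm_num)
  rw [h1, Real.log_le_iff_le_exp (by linarith)]
  have h5 : Real.exp (3 * N) = Real.exp N * Real.exp (2 * N) := by rw [← Real.exp_add]; ring_nf
  have h6 : 4 ≤ Real.exp (2 * N) := by
    have := Real.add_one_le_exp N
    rw [show 2 * N = N + N by ring, Real.exp_add]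
    nlinarith
  nlinarith

/-- The squared distance to `q` is uniform on `[0, 4]`, and the majorant has the explicit primitive
`G`, made of `-log log (16/x)` and `x^(1/4)`. At the regularisation scale the double logarithm is at
most `3 N`. -/
lemma lintegral_youngFn_pole_le {N κ : ℝ} (hN : 1 ≤ N) (hκ : 0 ≤ κ) (q : S2) :
    ∫⁻ y, ENNReal.ofReal (youngFn (κ / √(dist y q ^ 2 + regParam N))) ∂vg ≤
      ENNReal.ofReal (6 * κ ^ 2 * N + 3 * κ) := by
  set δ := regParam N with hδ
  have hδ0 : 0 < δ := regParam_pos N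
  have hδ1 : δ ≤ 1 := regParam_le_one N
  have hpos : ∀ s ∈ Icc (0 : ℝ) 4, 0 < s + δ ∧ s + δ ≤ 5 := fun s hs =>
    ⟨by linarith [hs.1], by linarith [hs.2]⟩
  have hlog : ∀ s ∈ Icc (0 : ℝ) 4, 0 < Real.log (16 / (s + δ)) := fun s hs =>
    Real.log_pos (by rw [lt_div_iff₀ (hpos s hs).1]; linarith [(hpos s hs).2])
  set G : ℝ → ℝ := fun s => 8 * κ ^ 2 * -Real.log (Real.log (16 / (s + δ))) +
    2 * κ * (4 * (s + δ) ^ (1 / 4 : ℝ)) with hG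
  set g : ℝ → ℝ := fun s => 8 * κ ^ 2 * (1 / ((s + δ) * Real.log (16 / (s + δ)))) +
    2 * κ * (s + δ) ^ (-(3 / 4) : ℝ) with hg
  have hd : ∀ s ∈ Icc (0 : ℝ) 4, HasDerivAt G (g s) s := by
    intro s hs
    have hp := (hpos s hs).1
    have hl := hlog s hs
    have h1 : HasDerivAt (fun s : ℝ => s + δ) 1 s := (hasDerivAt_id s).add_const δ
    have h2 := ((h1.fun_inv hp.ne').const_mul 16).log (by positivity)
    have h3 := (h2.log (by simpa [div_eq_mul_inv] using hl.ne')).neg.const_mul (8 * κ ^ 2)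
    have h4 := ((h1.rpow_const (p := 1 / 4) (Or.inl hp.ne')).const_mul 4).const_mul (2 * κ)
    have h5 := h3.add h4
    refine (h5.congr_deriv ?_).congr_of_eventuallyEq (Eventually.of_forall fun s => ?_)
    · simp only [hg, div_eq_mul_inv]
      rw [show ((1 * 4⁻¹ : ℝ) - 1) = -(3 * 4⁻¹) by norm_num]
      have hl' : Real.log (16 * (s + δ)⁻¹) ≠ 0 := by simpa [div_eq_mul_inv] using hl.ne'
      field_simp
    · simp [hG, div_eq_mul_inv]
  have hg0 : ∀ s ∈ Ioo (0 : ℝ) 4, 0 ≤ g s := fun s hs => by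
    have hs' := Ioo_subset_Icc_self hs
    have := (hpos s hs').1
    have := hlog s hs'
    positivity
  have key := lintegral_dist_sq q (G := G) (g := g)
    (fun s hs => (hd s hs).continuousAt.continuousWithinAt)
    (fun s hs => hd s (Ioo_subset_Icc_self hs)) hg0 (by fun_prop)
  calc _ ≤ ∫⁻ y, ENNReal.ofReal (g (dist y q ^ 2)) ∂vg := by
        refine lintegral_mono fun y => ENNReal.ofReal_le_ofReal ?_
        have hm : dist y q ^ 2 ∈ Icc (0 : ℝ) 4 :=
          ⟨sq_nonneg _, by nlinarith [dist_le_two y q, dist_nonneg (x := y) (y := q)]⟩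
        exact youngFn_inv_sqrt_le hκ (hpos _ hm).1 (hpos _ hm).2
    _ = ENNReal.ofReal ((G 4 - G 0) / 4) := key
    _ ≤ _ := by
        refine ENNReal.ofReal_le_ofReal ?_
        have h1 : Real.log (Real.log (16 / (0 + δ))) ≤ 3 * N := by
          rw [zero_add]; exact log_log_regParam_le hN
        -- The number `16` is large enough that `16 / 5` exceeds `e`, so the endpoint `s = 4`
        -- contributes with the right sign.
        have h2 : 0 ≤ Real.log (Real.log (16 / (4 + δ))) := by
          refine Real.log_nonneg ?_
          rw [Real.le_log_iff_exp_le (by positivity), le_div_iff₀ (by positivity)]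
          nlinarith [Real.exp_one_lt_d9]
        have h3 : (4 + δ) ^ (1 / 4 : ℝ) ≤ 3 / 2 := by
          have h4 : (4 + δ) ^ (1 / 4 : ℝ) ≤ ((3 / 2 : ℝ) ^ (4 : ℝ)) ^ (1 / 4 : ℝ) := by
            refine Real.rpow_le_rpow (by positivity) ?_ (by norm_num)
            norm_num; linarith
          rw [← Real.rpow_mul (by norm_num)] at h4
          norm_num at h4
          norm_num
          exact h4
        have h5 : 0 ≤ (0 + δ) ^ (1 / 4 : ℝ) := by positivity
        simp only [hG]
        nlinarith [mul_le_mul_of_nonneg_left h1 (sq_nonneg κ), mul_nonneg (sq_nonneg κ) h2,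
          mul_le_mul_of_nonneg_left h3 hκ, mul_nonneg hκ h5]

/-- A function which blows up at most like the inverse of the distance to one of two points,
regularised at scale `√(exp (- exp N))`, has norm of order `√N` in `L²(Log L)^{-1/2}`. -/
lemma luxemburg_le_half_of_poles {N : ℝ} (hN : 1 ≤ N) {q₁ q₂ : S2} {u : S2 → ℝ}
    (h : ∀ y, |u y| ≤ 1 / (20 * √N) / √(dist y q₁ ^ 2 + regParam N) ∨
      |u y| ≤ 1 / (20 * √N) / √(dist y q₂ ^ 2 + regParam N)) :
    luxemburg u ≤ ENNReal.ofReal (1 / 2) := by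
  refine luxemburg_le (by norm_num) ?_
  -- Twice the constant of the hypothesis, since the modular is evaluated at `η = 1/2`. Then `6 κ² N
  -- + 3 κ ≤ 0.06 + 0.3`, so each pole uses at most half of the budget `1`.
  set κ := 1 / (10 * √N) with hκ
  have hs : 1 ≤ √N := Real.one_le_sqrt.2 hN
  have hκ0 : 0 ≤ κ := by positivity
  have hκ1 : κ ≤ 1 / 10 := by
    rw [hκ, div_le_div_iff₀ (by positivity) (by norm_num)]; linarith
  have hκ2 : κ ^ 2 * N = 1 / 100 := by
    rw [hκ, div_pow, mul_pow, Real.sq_sqrt (by linarith)]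
    field_simp
    norm_num
  have hpt : ∀ (y : S2) (v d : ℝ), 0 < d → |v| ≤ 1 / (20 * √N) / d →
      youngFn (|v| / (1 / 2)) ≤ youngFn (κ / d) := by
    intro y v d hd hv
    refine youngFn_mono (by positivity) ?_
    have : κ / d = 2 * (1 / (20 * √N) / d) := by rw [hκ]; field_simp; norm_num
    rw [this]; linarith
  have hb : ∀ q : S2, ∫⁻ y, ENNReal.ofReal (youngFn (κ / √(dist y q ^ 2 + regParam N))) ∂vg ≤
      ENNReal.ofReal (1 / 2) := fun q => by
    refine (lintegral_youngFn_pole_le hN hκ0 q).trans (ENNReal.ofReal_le_ofReal ?_)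
    linarith
  have hm : ∀ q : S2, Measurable fun y : S2 =>
      ENNReal.ofReal (youngFn (κ / √(dist y q ^ 2 + regParam N))) := fun q =>
    (measurable_youngFn.comp (by fun_prop)).ennreal_ofReal
  calc _ ≤ ∫⁻ y, (ENNReal.ofReal (youngFn (κ / √(dist y q₁ ^ 2 + regParam N))) +
        ENNReal.ofReal (youngFn (κ / √(dist y q₂ ^ 2 + regParam N)))) ∂vg := by
        refine lintegral_mono fun y => ?_
        have hd : ∀ q : S2, 0 < √(dist y q ^ 2 + regParam N) := fun q => by
          have := regParam_pos N
          positivity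
        rcases h y with h | h
        · exact (ENNReal.ofReal_le_ofReal (hpt y _ _ (hd _) h)).trans le_self_add
        · exact (ENNReal.ofReal_le_ofReal (hpt y _ _ (hd _) h)).trans le_add_self
    _ ≤ ENNReal.ofReal (1 / 2) + ENNReal.ofReal (1 / 2) := by
        rw [lintegral_add_left (hm q₁)]
        exact add_le_add (hb q₁) (hb q₂)
    _ = 1 := by
        rw [← ENNReal.ofReal_add (by norm_num) (by norm_num)]
        norm_num

end Orlicz

/-! ### Comparison of the dual norms. -/

section DualNorms

lemma le_one_add_youngFn {t : ℝ} (ht : 0 ≤ t) : t ≤ 1 + youngFn t := by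
  have h1 := log_two_le ht
  have h2 : Real.log (2 + t) ≤ 1 + t := by
    have := Real.log_le_sub_one_of_pos (show 0 < 2 + t by linarith)
    linarith
  have h3 : t ^ 2 / (1 + t) ≤ youngFn t := by
    rw [youngFn]
    exact div_le_div_of_nonneg_left (sq_nonneg t) (by linarith) h2
  have h4 : t - 1 ≤ t ^ 2 / (1 + t) := by
    rw [le_div_iff₀ (by linarith)]
    nlinarith
  linarith

/-- For `t > 1` the logarithm in the Young function is at most `3 t^ε / ε`; for `t ≤ 1` the constant
term suffices. -/
lemma rpow_le_youngFn {ε : ℝ} (hε : 0 < ε) (hε1 : ε ≤ 1) {t : ℝ} (ht : 0 ≤ t) :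
    t ^ (2 - ε) ≤ 3 / ε * (1 + youngFn t) := by
  have hy := youngFn_nonneg ht
  have h3 : 3 ≤ 3 / ε := by rw [le_div_iff₀ hε]; linarith
  rcases le_or_gt t 1 with h | h
  · have : t ^ (2 - ε) ≤ 1 := Real.rpow_le_one ht h (by linarith)
    nlinarith
  · have ht0 : 0 < t := by linarith
    have hl := log_two_le ht
    have h1 : Real.log (2 + t) ≤ 3 * t ^ ε / ε := by
      refine (Real.log_le_rpow_div (by linarith) hε).trans ?_
      gcongr
      calc (2 + t) ^ ε ≤ (3 * t) ^ ε := Real.rpow_le_rpow (by linarith) (by linarith) hε.le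
        _ = 3 ^ ε * t ^ ε := Real.mul_rpow (by norm_num) ht
        _ ≤ 3 ^ (1 : ℝ) * t ^ ε := by gcongr; norm_num
        _ = 3 * t ^ ε := by rw [Real.rpow_one]
    have h2 : t ^ (2 - ε) ≤ 3 / ε * youngFn t := by
      rw [youngFn, mul_div_assoc', le_div_iff₀ (by linarith)]
      calc t ^ (2 - ε) * Real.log (2 + t) ≤ t ^ (2 - ε) * (3 * t ^ ε / ε) := by gcongr
        _ = 3 / ε * (t ^ (2 - ε) * t ^ ε) := by ring
        _ = 3 / ε * t ^ 2 := by
          rw [← Real.rpow_add ht0, sub_add_cancel]; norm_num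
    nlinarith

lemma lintegral_add_youngFn_le {u : S2 → ℝ} {η : ℝ}
    (h : ∫⁻ x, ENNReal.ofReal (youngFn (|u x| / η)) ∂vg ≤ 1) :
    ∫⁻ x, (1 + ENNReal.ofReal (youngFn (|u x| / η))) ∂vg ≤ 2 := by
  rw [lintegral_add_left measurable_const]
  refine (add_le_add le_rfl h).trans ?_
  simp
  norm_num

lemma lintegral_abs_le_of_luxemburg {u : S2 → ℝ} (hu : luxemburg u ≤ 1) :
    ∫⁻ x, ENNReal.ofReal |u x| ∂vg ≤ 4 := by
  obtain ⟨η, hη, h1, h2⟩ := exists_of_luxemburg_lt (hu.trans_lt (by norm_num : (1 : ℝ≥0∞) < 2))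
  calc ∫⁻ x, ENNReal.ofReal |u x| ∂vg
      ≤ ∫⁻ x, ENNReal.ofReal η * (1 + ENNReal.ofReal (youngFn (|u x| / η))) ∂vg := by
        refine lintegral_mono fun x => ?_
        have ht : 0 ≤ |u x| / η := by positivity
        rw [← ENNReal.ofReal_one, ← ENNReal.ofReal_add zero_le_one (youngFn_nonneg ht),
          ← ENNReal.ofReal_mul hη.le]
        refine ENNReal.ofReal_le_ofReal ?_
        have := mul_le_mul_of_nonneg_left (le_one_add_youngFn ht) hη.le
        rwa [mul_div_cancel₀ _ hη.ne'] at this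
    _ = ENNReal.ofReal η * ∫⁻ x, (1 + ENNReal.ofReal (youngFn (|u x| / η))) ∂vg :=
        lintegral_const_mul' _ _ ENNReal.ofReal_ne_top
    _ ≤ 2 * 2 := mul_le_mul' h2.le (lintegral_add_youngFn_le h1)
    _ = 4 := by norm_num

lemma eLpNorm_le_luxemburg {E : Type*} [NormedAddCommGroup E] {ε : ℝ} (hε : 0 < ε) (hε1 : ε ≤ 1)
    (u : S2 → E) :
    eLpNorm u (ENNReal.ofReal (2 - ε)) vg ≤ ENNReal.ofReal (6 / ε) * luxemburg fun x => ‖u x‖ := by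
  have hp : 0 < 2 - ε := by linarith
  have hc0 : ENNReal.ofReal (6 / ε) ≠ 0 := by simpa using hε
  rw [mul_comm, ← ENNReal.div_le_iff_le_mul (Or.inl hc0) (Or.inl ENNReal.ofReal_ne_top)]
  refine le_of_forall_gt fun b hb => ?_
  obtain ⟨η, hη, h1, h2⟩ := exists_of_luxemburg_lt hb
  refine lt_of_le_of_lt ?_ h2
  rw [ENNReal.div_le_iff_le_mul (Or.inl hc0) (Or.inl ENNReal.ofReal_ne_top),
    ← ENNReal.ofReal_mul hη.le,
    eLpNorm_eq_lintegral_rpow_enorm_toReal (by simpa using by linarith) ENNReal.ofReal_ne_top,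
    ENNReal.toReal_ofReal hp.le]
  have h3 : ∫⁻ x, ‖u x‖ₑ ^ (2 - ε) ∂vg ≤ ENNReal.ofReal (η ^ (2 - ε) * (6 / ε)) := by
    calc ∫⁻ x, ‖u x‖ₑ ^ (2 - ε) ∂vg
        ≤ ∫⁻ x, ENNReal.ofReal (η ^ (2 - ε) * (3 / ε)) *
          (1 + ENNReal.ofReal (youngFn (|‖u x‖| / η))) ∂vg := by
          refine lintegral_mono fun x => ?_
          have ht : 0 ≤ ‖u x‖ / η := by positivity
          rw [abs_norm, ← ofReal_norm, ENNReal.ofReal_rpow_of_nonneg (norm_nonneg _) hp.le,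
            ← ENNReal.ofReal_one, ← ENNReal.ofReal_add zero_le_one (youngFn_nonneg ht),
            ← ENNReal.ofReal_mul (by positivity)]
          refine ENNReal.ofReal_le_ofReal ?_
          have h4 := mul_le_mul_of_nonneg_left (rpow_le_youngFn hε hε1 ht)
            (Real.rpow_nonneg hη.le (2 - ε))
          rw [← Real.mul_rpow hη.le ht, mul_div_cancel₀ _ hη.ne'] at h4
          linarith
      _ ≤ ENNReal.ofReal (η ^ (2 - ε) * (3 / ε)) * 2 := by
          rw [lintegral_const_mul' _ _ ENNReal.ofReal_ne_top]
          exact mul_le_mul' le_rfl (lintegral_add_youngFn_le h1)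
      _ = ENNReal.ofReal (η ^ (2 - ε) * (6 / ε)) := by
          rw [← ENNReal.ofReal_ofNat, ← ENNReal.ofReal_mul (by positivity)]
          congr 1; ring
  refine (ENNReal.rpow_le_rpow h3 (by positivity)).trans ?_
  rw [ENNReal.ofReal_rpow_of_nonneg (by positivity) (by positivity)]
  refine ENNReal.ofReal_le_ofReal ?_
  rw [Real.mul_rpow (by positivity) (by positivity), ← Real.rpow_mul hη.le,
    mul_one_div_cancel hp.ne', Real.rpow_one]
  gcongr
  have h6 : 1 ≤ 6 / ε := by rw [le_div_iff₀ hε]; linarith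
  calc (6 / ε) ^ (1 / (2 - ε)) ≤ (6 / ε) ^ (1 : ℝ) := by
        refine Real.rpow_le_rpow_of_exponent_le h6 ?_
        rw [div_le_one hp]; linarith
    _ = 6 / ε := Real.rpow_one _

lemma luxemburg_norm (u : S2 → ℝ) : luxemburg (fun x => ‖u x‖) = luxemburg u := by
  simp only [luxemburg, Real.norm_eq_abs, abs_abs]

lemma sobolevNorm_le {ε : ℝ} (hε : 0 < ε) (hε1 : ε ≤ 1) (f : SmoothFn) :
    sobolevNorm (2 - ε) f ≤ ENNReal.ofReal (6 / ε) * orliczSobolevNorm f := by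
  rw [sobolevNorm, orliczSobolevNorm, mul_add]
  refine add_le_add ?_ (eLpNorm_le_luxemburg hε hε1 _)
  rw [← luxemburg_norm]
  exact eLpNorm_le_luxemburg hε hε1 _

lemma sobolevNorm_smul (p c : ℝ) (f : SmoothFn) :
    sobolevNorm p (c • f) = ‖c‖ₑ * sobolevNorm p f := by
  have h : sgrad (⇑(c • f)) = c • sgrad f := funext fun x => sgrad_smul c f x
  rw [sobolevNorm, sobolevNorm, h, eLpNorm_const_smul, mul_add,
    show ⇑(c • f) = c • ⇑f from rfl, eLpNorm_const_smul]

/-- The Orlicz–Sobolev norm is the stronger one on functions, so its dual norm is the weaker one: a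
lower bound for it passes to the dual of `W^{1,2-ε}`. -/
lemma dualDist_orlicz_le {ε : ℝ} (hε : 0 < ε) (hε1 : ε ≤ 1) (μ ν : Measure S2) :
    dualDist orliczSobolevNorm μ ν ≤ ENNReal.ofReal (6 / ε) * dualDist (sobolevNorm (2 - ε)) μ ν := by
  have hc : 0 < 6 / ε := by positivity
  refine iSup₂_le fun f hf => ?_
  set g : SmoothFn := (6 / ε)⁻¹ • f
  have hg : sobolevNorm (2 - ε) g ≤ 1 := by
    rw [sobolevNorm_smul, enorm_inv hc.ne', Real.enorm_of_nonneg hc.le]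
    refine (mul_le_mul' le_rfl ((sobolevNorm_le hε hε1 f).trans (mul_le_mul' le_rfl hf))).trans ?_
    rw [mul_one, ENNReal.inv_mul_cancel (by simpa using hε) ENNReal.ofReal_ne_top]
  refine le_trans (le_of_eq ?_) (mul_le_mul' le_rfl (le_iSup₂_of_le g hg le_rfl))
  have e : ∀ m : Measure S2, ∫ x, g x ∂m = (6 / ε)⁻¹ * ∫ x, f x ∂m := fun m => integral_const_mul _ _
  rw [e, e, ← mul_sub, abs_mul, abs_of_pos (inv_pos.2 hc), ← ENNReal.ofReal_mul hc.le,
    mul_inv_cancel_left₀ hc.ne']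

/-- The Luxemburg norm controls the `L¹` norm, and a measure with bounded density acts continuously
on `L¹(v_g)`. -/
lemma dualDist_lt_top {μ : Measure S2} [IsFiniteMeasure μ] {C : ℝ} (h : μ ≤ ENNReal.ofReal C • vg) :
    dualDist orliczSobolevNorm μ vg < ⊤ := by
  refine lt_of_le_of_lt (b := (ENNReal.ofReal C + 1) * 4) (iSup₂_le fun f hf => ?_)
    (ENNReal.mul_lt_top (by simp) (by simp))
  have hl : luxemburg f ≤ 1 := le_self_add.trans hf
  have h4 := lintegral_abs_le_of_luxemburg hl
  have hb : ∀ m : Measure S2, ENNReal.ofReal |∫ x, f x ∂m| ≤ ∫⁻ x, ENNReal.ofReal |f x| ∂m := by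
    intro m
    have := enorm_integral_le_lintegral_enorm (μ := m) (f := f)
    simpa only [← ofReal_norm, Real.norm_eq_abs] using this
  have hμ : ∫⁻ x, ENNReal.ofReal |f x| ∂μ ≤ ENNReal.ofReal C * 4 := by
    refine (lintegral_mono' h le_rfl).trans ?_
    rw [lintegral_smul_measure, smul_eq_mul]
    exact mul_le_mul' le_rfl h4
  calc ENNReal.ofReal |∫ x, f x ∂μ - ∫ x, f x ∂vg|
      ≤ ENNReal.ofReal (|∫ x, f x ∂μ| + |∫ x, f x ∂vg|) := ENNReal.ofReal_le_ofReal (abs_sub _ _)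
    _ ≤ ENNReal.ofReal |∫ x, f x ∂μ| + ENNReal.ofReal |∫ x, f x ∂vg| := ENNReal.ofReal_add_le
    _ ≤ ENNReal.ofReal C * 4 + 4 := add_le_add ((hb μ).trans hμ) ((hb vg).trans h4)
    _ = _ := by ring

end DualNorms

/-! ### Gradients of Lipschitz functions. -/

section GradientBound

/-- A local Lipschitz bound for `f` at `x` bounds its gradient there. -/
lemma norm_sgrad_le_of_lipschitz {f : SmoothFn} {x : S2} {C : ℝ} (hC : 0 ≤ C)
    (h : ∀ᶠ y in 𝓝 x, |f y - f x| ≤ C * dist y x) : ‖sgrad f x‖ ≤ 8 * C := by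
  have hd := (contDiffAt_comp_radialProj f (coe_ne_zero x)).differentiableAt (by simp)
  have hcont : ContinuousAt radialProj (x : R3) := (contMDiffAt_radialProj (coe_ne_zero x)).continuousAt
  have hx : ‖(x : R3)‖ = 1 := norm_coe_S2 x
  have h1 : ∀ᶠ z in 𝓝 (x : R3), |f (radialProj z) - f x| ≤ C * dist (radialProj z) x := by
    have : Tendsto radialProj (𝓝 (x : R3)) (𝓝 x) := by
      simpa [ContinuousAt, radialProj_coe] using hcont
    exact this.eventually h
  have h0 : ∀ᶠ z in 𝓝 (x : R3), z ≠ 0 := isOpen_ne.mem_nhds (coe_ne_zero x)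
  have h2 : ‖fderiv ℝ (fun z : R3 => f (radialProj z)) (x : R3)‖ ≤ 2 * C := by
    refine hd.hasFDerivAt.le_of_lip' (by positivity) ?_
    filter_upwards [h1, h0] with z hz hz0
    rw [radialProj_coe, Real.norm_eq_abs]
    refine hz.trans ?_
    have h3 : dist (radialProj z) x ≤ 2 * ‖z - x‖ := by
      rw [Subtype.dist_eq, dist_eq_norm]
      have h4 : ‖(radialProj z : R3) - z‖ ≤ ‖z - x‖ := by
        have e : (radialProj z : R3) - z = (1 - ‖z‖) • (radialProj z : R3) := by
          rw [sub_smul, one_smul, norm_smul_radialProj]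
        rw [e, norm_smul, norm_coe_S2, mul_one, Real.norm_eq_abs, abs_sub_comm]
        have := abs_norm_sub_norm_le z (x : R3)
        rwa [hx] at this
      have h5 := norm_add_le ((radialProj z : R3) - z) (z - x)
      rw [sub_add_sub_cancel] at h5
      linarith
    nlinarith
  have h6 : ‖gradient (fun y : R3 => f (radialProj y)) (x : R3)‖ ≤ 2 * C := by
    rw [gradient, LinearIsometryEquiv.norm_map]; exact h2
  have h7 : √(4 * Real.pi) ≤ 4 := by
    rw [Real.sqrt_le_left (by norm_num)]
    linarith [Real.pi_le_four]
  rw [sgrad, norm_smul, Real.norm_of_nonneg (Real.sqrt_nonneg _)]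
  nlinarith [norm_nonneg (gradient (fun y : R3 => f (radialProj y)) (x : R3)), Real.sqrt_nonneg (4 * Real.pi)]

end GradientBound

/-! ### The logarithmic test function and its transport by a bi-Lipschitz map. -/

section TestFunction

variable {δ : ℝ}

/-- The regularized distance to the polar axis. -/
def axisDist (δ : ℝ) (x : S2) : ℝ := √(1 - ⟪(x : R3), axis⟫ ^ 2 + δ)

lemma axisDist_pos (hδ : 0 < δ) (x : S2) : 0 < axisDist δ x :=
  Real.sqrt_pos.2 (base_pos hδ (inner_mem_Icc x norm_axis))

lemma axisDist_sq (hδ : 0 < δ) (x : S2) : axisDist δ x ^ 2 = 1 - ⟪(x : R3), axis⟫ ^ 2 + δ :=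
  Real.sq_sqrt (base_pos hδ (inner_mem_Icc x norm_axis)).le

lemma norm_sub_axis_sq (v : R3) : ‖v - ⟪v, axis⟫ • axis‖ ^ 2 = ‖v‖ ^ 2 - ⟪v, axis⟫ ^ 2 := by
  rw [norm_sub_sq_real, inner_smul_right, norm_smul, norm_axis, mul_one, Real.norm_eq_abs, sq_abs]
  ring

/-- The distance to the axis is the norm of an orthogonal projection, hence `1`-Lipschitz, and `a ↦
√(a² + δ)` does not increase differences. -/
lemma abs_axisDist_sub_le (hδ : 0 < δ) (x y : S2) :
    |axisDist δ x - axisDist δ y| ≤ dist x y := by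
  set a := ‖(x : R3) - ⟪(x : R3), axis⟫ • axis‖ with ha
  set b := ‖(y : R3) - ⟪(y : R3), axis⟫ • axis‖ with hb
  have ha2 : axisDist δ x ^ 2 = a ^ 2 + δ := by
    rw [axisDist_sq hδ, ha, norm_sub_axis_sq, norm_coe_S2]; ring
  have hb2 : axisDist δ y ^ 2 = b ^ 2 + δ := by
    rw [axisDist_sq hδ, hb, norm_sub_axis_sq, norm_coe_S2]; ring
  have hab : |a - b| ≤ dist x y := by
    refine (abs_norm_sub_norm_le _ _).trans ?_
    have e : (x : R3) - ⟪(x : R3), axis⟫ • axis - ((y : R3) - ⟪(y : R3), axis⟫ • axis) =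
        ((x : R3) - y) - ⟪(x : R3) - y, axis⟫ • axis := by
      rw [inner_sub_left, sub_smul]; abel
    rw [e, Subtype.dist_eq, dist_eq_norm]
    refine (sq_le_sq₀ (norm_nonneg _) (norm_nonneg _)).1 ?_
    rw [norm_sub_axis_sq]
    linarith [sq_nonneg ⟪(x : R3) - y, axis⟫]
  have hx := axisDist_pos hδ x
  have hy := axisDist_pos hδ y
  have ha0 : 0 ≤ a := norm_nonneg _
  have hb0 : 0 ≤ b := norm_nonneg _
  have hax : a ≤ axisDist δ x := (sq_le_sq₀ ha0 hx.le).1 (by linarith)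
  have hby : b ≤ axisDist δ y := (sq_le_sq₀ hb0 hy.le).1 (by linarith)
  have h1 : |axisDist δ x - axisDist δ y| * (axisDist δ x + axisDist δ y) = |a - b| * (a + b) := by
    rw [← abs_of_pos (add_pos hx hy), ← abs_mul, ← abs_of_nonneg (add_nonneg ha0 hb0), ← abs_mul]
    congr 1
    linear_combination ha2 - hb2
  have h2 : |a - b| * (a + b) ≤ |a - b| * (axisDist δ x + axisDist δ y) := by gcongr
  rw [← h1] at h2
  exact (le_of_mul_le_mul_right h2 (by positivity)).trans hab

lemma logProfile_eq (hδ : 0 < δ) (x : S2) : logProfile δ ⟪(x : R3), axis⟫ =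
    1 + Real.log (1 + δ) - 2 * Real.log (axisDist δ x) := by
  rw [logProfile, ← axisDist_sq hδ, Real.log_pow]
  push_cast
  rfl

lemma logProfile_le (hδ : 0 < δ) (hδ1 : δ ≤ 1) (x : S2) :
    logProfile δ ⟪(x : R3), axis⟫ ≤ 2 / axisDist δ x := by
  have hx := axisDist_pos hδ x
  have h1 := Real.log_le_sub_one_of_pos (show 0 < 1 + δ by linarith)
  have h2 := Real.log_le_sub_one_of_pos (inv_pos.2 hx)
  rw [Real.log_inv] at h2
  rw [logProfile_eq hδ, div_eq_mul_inv]
  linarith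

variable {Φ : S2 ≃ₘ⟮𝓡 2, 𝓡 2⟯ S2}

/-- The squared distance to the nearer pole is `2 - 2|t| ≤ 2 (1 - t²)`. After `Φ` it is at most `128
(1 - t²)`, and `128 ≤ 12²`. -/
lemma inv_axisDist_le (hδ : 0 < δ) (hΦ : ∀ x y, dist (Φ x) (Φ y) ≤ 8 * dist x y) (x : S2) :
    1 / axisDist δ x ≤ 12 / √(dist (Φ x) (Φ basePoint) ^ 2 + δ) ∨
      1 / axisDist δ x ≤ 12 / √(dist (Φ x) (Φ (-basePoint)) ^ 2 + δ) := by
  have key : ∀ q : S2, dist x q ^ 2 ≤ 2 * (1 - ⟪(x : R3), axis⟫ ^ 2) →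
      1 / axisDist δ x ≤ 12 / √(dist (Φ x) (Φ q) ^ 2 + δ) := by
    intro q hq
    rw [div_le_div_iff₀ (axisDist_pos hδ x) (by positivity), one_mul]
    refine Real.sqrt_le_iff.2 ⟨by have := axisDist_pos hδ x; positivity, ?_⟩
    rw [mul_pow, axisDist_sq hδ]
    have h1 : dist (Φ x) (Φ q) ^ 2 ≤ (8 * dist x q) ^ 2 := by gcongr; exact hΦ x q
    nlinarith
  have ht := inner_mem_Icc x norm_axis
  rcases le_total 0 ⟪(x : R3), axis⟫ with h | h
  · refine Or.inl (key basePoint ?_)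
    rw [dist_sq_S2]
    nlinarith [ht.1, ht.2]
  · refine Or.inr (key (-basePoint) ?_)
    rw [dist_sq_S2, coe_neg_sphere, inner_neg_right]
    nlinarith [ht.1, ht.2]

/-- The logarithmic profile transported by a diffeomorphism. -/
def poleFn (hδ : 0 < δ) (Φ : S2 ≃ₘ⟮𝓡 2, 𝓡 2⟯ S2) : SmoothFn :=
  ⟨fun y => zonal (logProfile δ) (fun _ ht => contDiffAt_logProfile hδ ht) axis norm_axis (Φ.symm y),
    (zonal (logProfile δ) (fun _ ht => contDiffAt_logProfile hδ ht) axis norm_axis).contMDiff.comp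
      Φ.symm.contMDiff⟩

lemma poleFn_apply (hδ : 0 < δ) (y : S2) :
    poleFn hδ Φ y = logProfile δ ⟪(Φ.symm y : R3), axis⟫ := rfl

lemma poleFn_nonneg (hδ : 0 < δ) (y : S2) : 0 ≤ poleFn hδ Φ y := by
  rw [poleFn_apply]
  linarith [one_le_logProfile hδ (inner_mem_Icc (Φ.symm y) norm_axis)]

/-- The test function is a constant minus `2 log w`, where the regularised axis distance `w`, pulled
back by the inverse of `Φ`, is `8`-Lipschitz. In the ball of radius `w/16` the distance stays above
`w/2`, so the local Lipschitz constant is at most `32/w`. -/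
lemma norm_sgrad_poleFn_le (hδ : 0 < δ) (hΦ : ∀ x y, dist x y ≤ 8 * dist (Φ x) (Φ y)) (y : S2) :
    ‖sgrad (poleFn hδ Φ) y‖ ≤ 256 * (1 / axisDist δ (Φ.symm y)) := by
  set w := axisDist δ (Φ.symm y) with hw
  have hw0 : 0 < w := axisDist_pos hδ _
  have hlip : ∀ z, |axisDist δ (Φ.symm z) - w| ≤ 8 * dist z y := by
    intro z
    have h1 := hΦ (Φ.symm z) (Φ.symm y)
    rw [Φ.apply_symm_apply, Φ.apply_symm_apply] at h1
    exact (abs_axisDist_sub_le hδ _ _).trans h1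
  have hmain : ∀ᶠ z in 𝓝 y, |poleFn hδ Φ z - poleFn hδ Φ y| ≤ 32 * (1 / w) * dist z y := by
    filter_upwards [Metric.ball_mem_nhds y (by positivity : 0 < w / 16)] with z hz
    rw [mem_ball] at hz
    set w' := axisDist δ (Φ.symm z) with hw'
    have hw'0 : 0 < w' := axisDist_pos hδ _
    have h2 := hlip z
    have h3 := abs_le.1 h2
    have hhalf : w / 2 ≤ w' := by linarith
    rw [poleFn_apply, poleFn_apply, logProfile_eq hδ, logProfile_eq hδ, ← hw, ← hw']
    have hlog : ∀ a b : ℝ, 0 < a → 0 < b → w / 2 ≤ a → Real.log b - Real.log a ≤ 2 / w * |b - a| := by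
      intro a b ha hb hab
      have h4 := Real.log_le_sub_one_of_pos (div_pos hb ha)
      rw [Real.log_div hb.ne' ha.ne'] at h4
      have h5 : b / a - 1 = (b - a) / a := by field_simp
      refine (h4.trans (le_of_eq h5)).trans ?_
      calc (b - a) / a ≤ |b - a| / (w / 2) := by gcongr; exact le_abs_self _
        _ = 2 / w * |b - a| := by field_simp
    have hA := hlog w w' hw0 hw'0 (by linarith)
    have hB := hlog w' w hw'0 hw0 hhalf
    rw [abs_sub_comm w w'] at hB
    have hC : 2 / w * |w' - w| ≤ 2 / w * (8 * dist z y) := by gcongr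
    have hD : 32 * (1 / w) * dist z y = 2 * (2 / w * (8 * dist z y)) := by ring
    rw [hD, abs_le]
    constructor <;> linarith
  have := norm_sgrad_le_of_lipschitz (by positivity) hmain
  linarith

lemma lintegral_inv_sqrt_dist_le (hδ : 0 < δ) (hδ1 : δ ≤ 1) (q : S2) :
    ∫⁻ y, ENNReal.ofReal (1 / √(dist y q ^ 2 + δ)) ∂vg ≤ ENNReal.ofReal (3 / 2) := by
  have h := lintegral_dist_sq q (G := fun s => 2 * √(s + δ)) (g := fun s => 1 / √(s + δ))
    (by fun_prop) (fun s hs => by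
      have h0 : 0 < s + δ := by linarith [hs.1]
      refine ((((hasDerivAt_id s).add_const δ).sqrt h0.ne').const_mul 2).congr_deriv ?_
      have := Real.sqrt_pos.2 h0
      simp only [id]
      field_simp) (fun s _ => by positivity) (by fun_prop)
  rw [h]
  refine ENNReal.ofReal_le_ofReal ?_
  have h1 : √(4 + δ) ≤ 3 := Real.sqrt_le_iff.2 ⟨by norm_num, by linarith⟩
  have h2 := Real.sqrt_nonneg (0 + δ)
  linarith

lemma integral_poleFn_le (hδ : 0 < δ) (hδ1 : δ ≤ 1)
    (hΦ : ∀ x y, dist (Φ x) (Φ y) ≤ 8 * dist x y) : ∫ y, poleFn hδ Φ y ∂vg ≤ 72 := by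
  have hc : Continuous (poleFn hδ Φ) := (poleFn hδ Φ).contMDiff.continuous
  have hm : ∀ q : S2, Measurable fun y : S2 => ENNReal.ofReal (1 / √(dist y q ^ 2 + δ)) := fun q => by
    fun_prop
  have h1 : ∫⁻ y, ENNReal.ofReal (poleFn hδ Φ y) ∂vg ≤ ENNReal.ofReal 72 := by
    calc ∫⁻ y, ENNReal.ofReal (poleFn hδ Φ y) ∂vg
        ≤ ∫⁻ y, ENNReal.ofReal 24 * (ENNReal.ofReal (1 / √(dist y (Φ basePoint) ^ 2 + δ)) +
            ENNReal.ofReal (1 / √(dist y (Φ (-basePoint)) ^ 2 + δ))) ∂vg := by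
          refine lintegral_mono fun y => ?_
          rw [← ENNReal.ofReal_add (by positivity) (by positivity),
            ← ENNReal.ofReal_mul (by norm_num)]
          refine ENNReal.ofReal_le_ofReal ?_
          have h2 := logProfile_le hδ hδ1 (Φ.symm y)
          rw [← poleFn_apply (Φ := Φ) hδ] at h2
          have h3 := inv_axisDist_le hδ hΦ (Φ.symm y)
          rw [Φ.apply_symm_apply] at h3
          have e1 : 0 ≤ 1 / √(dist y (Φ basePoint) ^ 2 + δ) := by positivity
          have e2 : 0 ≤ 1 / √(dist y (Φ (-basePoint)) ^ 2 + δ) := by positivity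
          have e3 : ∀ a b : ℝ, a / b = a * (1 / b) := fun a b => by ring
          rw [e3 2] at h2
          rw [e3 12, e3 12] at h3
          rcases h3 with h3 | h3 <;> linarith
      _ ≤ ENNReal.ofReal 24 * (ENNReal.ofReal (3 / 2) + ENNReal.ofReal (3 / 2)) := by
          rw [lintegral_const_mul' _ _ ENNReal.ofReal_ne_top, lintegral_add_left (hm _)]
          exact mul_le_mul' le_rfl (add_le_add (lintegral_inv_sqrt_dist_le hδ hδ1 _)
            (lintegral_inv_sqrt_dist_le hδ hδ1 _))
      _ = ENNReal.ofReal 72 := by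
          rw [← ENNReal.ofReal_add (by norm_num) (by norm_num), ← ENNReal.ofReal_mul (by norm_num)]
          norm_num
  rw [← ofReal_integral_eq_lintegral_ofReal (integrable_of_continuous hc _)
    (.of_forall (poleFn_nonneg hδ))] at h1
  exact (ENNReal.ofReal_le_ofReal_iff (by norm_num)).1 h1

end TestFunction

/-! ### Pairing the weight with the test function; closeness in total variation. -/

section Pairing

variable {N : ℝ}

/-- The product is `t² / ((1 - t² + δ) ℓ)`. On `[1/2, 1]` it is at least a quarter of `ℓ'/ℓ`, the
derivative of `log ℓ`. At `t = 1` one has `ℓ ≥ exp N`, so `log ℓ ≥ N`, while `log ℓ ≤ 1` at `t =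
1/2`. -/
lemma le_integral_hardyWeight_mul_logProfile :
    (N - 1) / 8 ≤ ∫ x : S2, hardyWeight (regParam N) ⟪(x : R3), axis⟫ *
      logProfile (regParam N) ⟪(x : R3), axis⟫ ∂vg := by
  set δ := regParam N with hδdef
  have hδ : 0 < δ := regParam_pos N
  set h : ℝ → ℝ := fun t => hardyWeight δ t * logProfile δ t
  have hcont : ContinuousOn h (Icc (-1) 1) :=
    (continuousOn_hardyWeight hδ).mul (continuousOn_logProfile hδ)
  have hnn : ∀ t ∈ Icc (-1 : ℝ) 1, 0 ≤ h t := fun t ht =>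
    mul_nonneg (hardyWeight_nonneg hδ ht) (by linarith [one_le_logProfile hδ ht])
  have h1 : ∫ x : S2, h ⟪(x : R3), axis⟫ ∂vg = (1 / 2) * ∫ t in Icc (-1 : ℝ) 1, h t := by
    have hm : AEStronglyMeasurable h (vg.map fun x : S2 => ⟪(x : R3), axis⟫) := by
      rw [vg_map_inner norm_axis]
      exact (hcont.aestronglyMeasurable measurableSet_Icc).smul_measure _
    rw [← integral_map (continuous_inner_coe _).aemeasurable hm, vg_map_inner norm_axis,
      integral_smul_measure]
    simp
  have hsub : Icc (1 / 2 : ℝ) 1 ⊆ Icc (-1) 1 := Icc_subset_Icc_left (by norm_num)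
  have h2 : ∫ t in Icc (1 / 2 : ℝ) 1, h t ≤ ∫ t in Icc (-1 : ℝ) 1, h t :=
    setIntegral_mono_set hcont.integrableOn_Icc
      ((ae_restrict_iff' measurableSet_Icc).2 (.of_forall hnn)) hsub.eventuallyLE
  have hder : ∀ t ∈ Icc (1 / 2 : ℝ) 1, HasDerivAt (fun t => Real.log (logProfile δ t) / 4)
      (2 * t / (1 - t ^ 2 + δ) / logProfile δ t / 4) t := fun t ht =>
    ((hasDerivAt_logProfile hδ (hsub ht)).log
      (by linarith [one_le_logProfile hδ (hsub ht)])).div_const 4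
  have hdc : ContinuousOn (fun t => 2 * t / (1 - t ^ 2 + δ) / logProfile δ t / 4) (Icc (1 / 2 : ℝ) 1) := by
    refine ((ContinuousOn.div (by fun_prop) (by fun_prop) fun t ht =>
      (base_pos hδ (hsub ht)).ne').div ((continuousOn_logProfile hδ).mono hsub) fun t ht =>
        ?_).div_const 4
    linarith [one_le_logProfile hδ (hsub ht)]
  have hii : IntervalIntegrable (fun t => 2 * t / (1 - t ^ 2 + δ) / logProfile δ t / 4) volume (1 / 2) 1 :=
    ContinuousOn.intervalIntegrable_of_Icc (by norm_num) hdc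
  have h3 : ∫ t in (1 / 2 : ℝ)..1, 2 * t / (1 - t ^ 2 + δ) / logProfile δ t / 4 =
      Real.log (logProfile δ 1) / 4 - Real.log (logProfile δ (1 / 2)) / 4 := by
    refine intervalIntegral.integral_eq_sub_of_hasDerivAt (fun t ht => hder t ?_) hii
    rwa [uIcc_of_le (by norm_num)] at ht
  have h4 : ∫ t in Icc (1 / 2 : ℝ) 1, 2 * t / (1 - t ^ 2 + δ) / logProfile δ t / 4 ≤
      ∫ t in Icc (1 / 2 : ℝ) 1, h t := by
    refine setIntegral_mono_on hdc.integrableOn_Icc (hcont.mono hsub).integrableOn_Icc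
      measurableSet_Icc fun t ht => ?_
    have hb := base_pos hδ (hsub ht)
    have hl : 0 < logProfile δ t := by linarith [one_le_logProfile hδ (hsub ht)]
    have e : h t = t ^ 2 / ((1 - t ^ 2 + δ) * logProfile δ t) := by
      simp only [h, hardyWeight]; field_simp
    rw [e, div_div, div_div, div_le_div_iff₀ (by positivity) (by positivity)]
    have : 0 < (1 - t ^ 2 + δ) * logProfile δ t := by positivity
    nlinarith [ht.1, mul_nonneg this.le (show 0 ≤ 2 * t ^ 2 - t by nlinarith [ht.1])]
  rw [integral_Icc_eq_integral_Ioc (x := (1 / 2 : ℝ)) (f := fun t => 2 * t / (1 - t ^ 2 + δ) / logProfile δ t / 4),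
    ← intervalIntegral.integral_of_le (by norm_num), h3] at h4
  have h5 : N ≤ Real.log (logProfile δ 1) := by
    have hl : 0 < logProfile δ 1 := by linarith [one_le_logProfile (t := 1) hδ (by norm_num)]
    rw [Real.le_log_iff_exp_le hl, logProfile]
    have e1 : Real.log (1 - 1 ^ 2 + δ) = -Real.exp N := by
      rw [show (1 : ℝ) - 1 ^ 2 + δ = δ by ring, hδdef, regParam, Real.log_exp]
    have e2 : 0 ≤ Real.log (1 + δ) := Real.log_nonneg (by linarith)
    rw [e1]; linarith
  have h6 : Real.log (logProfile δ (1 / 2)) ≤ 1 := by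
    have hl : 1 ≤ logProfile δ (1 / 2) := one_le_logProfile hδ (by norm_num)
    have e1 : Real.log (1 + δ) - Real.log (1 - (1 / 2) ^ 2 + δ) ≤ 1 / 3 := by
      have hp : (0 : ℝ) < 1 - (1 / 2) ^ 2 + δ := by norm_num; linarith
      rw [← Real.log_div (by positivity) hp.ne']
      have := Real.log_le_sub_one_of_pos (show 0 < (1 + δ) / (1 - (1 / 2) ^ 2 + δ) by positivity)
      refine this.trans ?_
      rw [sub_le_iff_le_add, div_le_iff₀ hp]
      norm_num
      linarith
    have h7 := Real.log_le_sub_one_of_pos (show 0 < logProfile δ (1 / 2) by linarith)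
    rw [logProfile] at h7 ⊢
    linarith
  change _ ≤ ∫ x : S2, h ⟪(x : R3), axis⟫ ∂vg
  rw [h1]
  linarith

/-- The normalising denominator is at most `2`, so the density is at least `τ q / 2`; the profile is
positive. -/
lemma le_integral_logProfile_perturbed {τ : ℝ} (hτ : 0 ≤ τ) (hτ1 : τ ≤ 1) :
    τ * (N - 1) / 16 ≤ ∫ x : S2, logProfile (regParam N) ⟪(x : R3), axis⟫
      ∂(perturbed (regParam N) τ) := by
  have hδ := regParam_pos N
  have hpair := le_integral_hardyWeight_mul_logProfile (N := N)
  set δ := regParam N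
  have hlc := continuous_zonal (continuousOn_logProfile hδ)
  have hwc := continuous_hardyWeight hδ
  rw [integral_perturbed hδ hτ]
  have h1 : ∫ x : S2, τ / 2 * (hardyWeight δ ⟪(x : R3), axis⟫ * logProfile δ ⟪(x : R3), axis⟫) ∂vg ≤
      ∫ x : S2, density δ τ ⟪(x : R3), axis⟫ • logProfile δ ⟪(x : R3), axis⟫ ∂vg := by
    refine integral_mono (integrable_of_continuous (by fun_prop) _)
      (integrable_of_continuous ((continuous_density hδ).smul hlc) _) fun x => ?_
    have ht := inner_mem_Icc x norm_axis
    have hl := one_le_logProfile hδ ht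
    have hw := hardyWeight_nonneg hδ ht
    have hD := denom_pos hδ hτ
    have hd : τ / 2 * hardyWeight δ ⟪(x : R3), axis⟫ ≤ density δ τ ⟪(x : R3), axis⟫ := by
      rw [density, le_div_iff₀ hD]
      have h2 : 1 + τ * hardyMass δ ≤ 2 := by nlinarith [hardyMass_le_one hδ, hardyMass_nonneg hδ]
      have h3 : 0 ≤ τ * hardyWeight δ ⟪(x : R3), axis⟫ := mul_nonneg hτ hw
      nlinarith
    simp only [smul_eq_mul]
    rw [← mul_assoc]
    exact mul_le_mul_of_nonneg_right hd (by linarith)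
  rw [integral_const_mul] at h1
  nlinarith

/-- The density differs from `1` by at most `τ (q + m)`, where `m ≤ 1` is the mass of `q`. -/
lemma norm_integral_perturbed_sub_le {δ τ : ℝ} (hδ : 0 < δ) (hτ : 0 ≤ τ) {g : S2 → R3}
    (hg : Continuous g) (hg1 : ∀ x, ‖g x‖ ≤ 1) :
    ‖∫ x, g x ∂(perturbed δ τ) - ∫ x, g x ∂vg‖ ≤ 2 * τ := by
  have hI : ∀ {f : S2 → R3}, Continuous f → Integrable f vg := fun hf =>
    hf.integrable_of_hasCompactSupport (HasCompactSupport.of_compactSpace _)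
  have hdc := continuous_density (τ := τ) hδ
  have hwc := continuous_hardyWeight hδ
  have hm := hardyMass_nonneg hδ
  have hD := denom_pos hδ hτ
  have hdg : Continuous fun x : S2 => density δ τ ⟪(x : R3), axis⟫ • g x := hdc.smul hg
  rw [integral_perturbed hδ hτ, ← integral_sub (hI hdg) (hI hg)]
  calc _ ≤ ∫ x : S2, τ * (hardyWeight δ ⟪(x : R3), axis⟫ + hardyMass δ) ∂vg := by
        refine norm_integral_le_of_norm_le (integrable_of_continuous (by fun_prop) _)
          (.of_forall fun x => ?_)
        have hw := hardyWeight_nonneg hδ (inner_mem_Icc x norm_axis)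
        have e : density δ τ ⟪(x : R3), axis⟫ • g x - g x =
            (density δ τ ⟪(x : R3), axis⟫ - 1) • g x := by rw [sub_smul, one_smul]
        rw [e, norm_smul, Real.norm_eq_abs]
        refine (mul_le_of_le_one_right (abs_nonneg _) (hg1 x)).trans ?_
        have e2 : density δ τ ⟪(x : R3), axis⟫ - 1 =
            τ * (hardyWeight δ ⟪(x : R3), axis⟫ - hardyMass δ) / (1 + τ * hardyMass δ) := by
          rw [density, div_sub_one hD.ne']; congr 1; ring
        rw [e2, abs_div, abs_of_pos hD]
        refine (div_le_self (abs_nonneg _) (by nlinarith)).trans ?_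
        rw [abs_mul, abs_of_nonneg hτ]
        refine mul_le_mul_of_nonneg_left ?_ hτ
        rw [abs_le]
        constructor <;> linarith
    _ = τ * (hardyMass δ + hardyMass δ) := by
        rw [integral_const_mul, integral_add (integrable_of_continuous hwc _) (integrable_const _)]
        simp [hardyMass]
    _ ≤ 2 * τ := by nlinarith [hardyMass_le_one hδ]

end Pairing

/-! ### Lower bounds for the dual distance along the conformal group. -/

section LowerBound

lemma le_dualDist {M : SmoothFn → ℝ≥0∞} {μ ν : Measure S2} {f : SmoothFn} (hf : M f ≤ 1) {c : ℝ}
    (h : c ≤ ∫ x, f x ∂μ - ∫ x, f x ∂ν) : ENNReal.ofReal c ≤ dualDist M μ ν :=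
  le_iSup₂_of_le f hf (ENNReal.ofReal_le_ofReal (h.trans (le_abs_self _)))

lemma orliczSobolevNorm_smul_le_one {f : SmoothFn} {c : ℝ}
    (h1 : luxemburg (fun x => c * f x) ≤ ENNReal.ofReal (1 / 2))
    (h2 : luxemburg (fun x => |c| * ‖sgrad f x‖) ≤ ENNReal.ofReal (1 / 2)) :
    orliczSobolevNorm (c • f) ≤ 1 := by
  have e : (fun x => ‖sgrad (⇑(c • f)) x‖) = fun x => |c| * ‖sgrad f x‖ := by
    funext x
    rw [sgrad_smul, norm_smul, Real.norm_eq_abs]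
  rw [orliczSobolevNorm, e]
  refine (add_le_add h1 h2).trans (le_of_eq ?_)
  rw [← ENNReal.ofReal_add (by norm_num) (by norm_num)]
  norm_num

lemma integral_smul_fn (c : ℝ) (f : SmoothFn) (m : Measure S2) :
    ∫ x, (c • f) x ∂m = c * ∫ x, f x ∂m := integral_const_mul _ _

lemma integral_map_diffeo (Φ : S2 ≃ₘ⟮𝓡 2, 𝓡 2⟯ S2) (f : SmoothFn) (μ : Measure S2) :
    ∫ x, f x ∂(μ.map Φ) = ∫ x, f (Φ x) ∂μ :=
  integral_map Φ.continuous.aemeasurable f.contMDiff.continuous.aestronglyMeasurable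

/-- The measures `(1 + τ q) v_g`, suitably normalised, where `q` is the critical Hardy weight
regularised at scale `exp (- exp N)` and `τ = N^{-1/2}`. -/
def concentrated (N : ℝ) : Measure S2 := perturbed (regParam N) (1 / √N)

variable {N : ℝ} {Φ : S2 ≃ₘ⟮𝓡 2, 𝓡 2⟯ S2}

/-- Test with `ℓ ∘ Φ⁻¹` divided by a multiple of `√N`. Its integral against `Φ_* μ` is that of `ℓ`
against `μ`, of order at least `√N`, and its integral against `v_g` is at most `72` before scaling.
The requirement on `N` makes the first dominate. -/
lemma le_dualDist_of_biLipschitz (hN : 10 ^ 8 ≤ N)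
    (hΦ : ∀ x y, dist (Φ x) (Φ y) ≤ 8 * dist x y ∧ dist x y ≤ 8 * dist (Φ x) (Φ y)) :
    ENNReal.ofReal (1 / 10 ^ 7) ≤ dualDist orliczSobolevNorm ((concentrated N).map Φ) vg := by
  have hδ := regParam_pos N
  have hδ1 := regParam_le_one N
  have hN1 : 1 ≤ N := by linarith
  have hs : 10 ^ 4 ≤ √N := Real.le_sqrt_of_sq_le (by linarith)
  have hs0 : 0 < √N := by linarith
  set F := poleFn hδ Φ
  -- `61440 = 20 · 256 · 12`: the bound of the two-pole estimate, the gradient constant and the loss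
  -- in passing to the image poles.
  set c := 1 / (61440 * √N) with hc
  have hc0 : 0 < c := by positivity
  have hpole : ∀ (y : S2) (v : ℝ), 0 ≤ v → v ≤ 256 * (1 / axisDist (regParam N) (Φ.symm y)) →
      |c * v| ≤ 1 / (20 * √N) / √(dist y (Φ basePoint) ^ 2 + regParam N) ∨
      |c * v| ≤ 1 / (20 * √N) / √(dist y (Φ (-basePoint)) ^ 2 + regParam N) := by
    intro y v hv0 hv
    have h1 := inv_axisDist_le hδ (fun x y => (hΦ x y).1) (Φ.symm y)
    rw [Φ.apply_symm_apply] at h1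
    rw [abs_of_nonneg (by positivity)]
    have key : ∀ d : ℝ, 1 / axisDist (regParam N) (Φ.symm y) ≤ 12 / d → c * v ≤ 1 / (20 * √N) / d := by
      intro d hd
      have h2 : v ≤ 256 * (12 / d) := hv.trans (by gcongr)
      calc c * v ≤ c * (256 * (12 / d)) := by gcongr
        _ = 1 / (20 * √N) / d := by rw [hc]; field_simp; norm_num
    exact h1.imp (key _) (key _)
  have hFnorm : orliczSobolevNorm (c • F) ≤ 1 := by
    refine orliczSobolevNorm_smul_le_one (luxemburg_le_half_of_poles (q₁ := Φ basePoint)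
      (q₂ := Φ (-basePoint)) hN1 fun y => hpole y _ (poleFn_nonneg hδ y) ?_) (luxemburg_le_half_of_poles (q₁ := Φ basePoint)
      (q₂ := Φ (-basePoint)) hN1 fun y => ?_)
    · have h1 := logProfile_le hδ hδ1 (Φ.symm y)
      rw [← poleFn_apply (Φ := Φ) hδ] at h1
      have h2 : 0 < 1 / axisDist (regParam N) (Φ.symm y) := one_div_pos.2 (axisDist_pos hδ _)
      rw [show ∀ a : ℝ, 2 / a = 2 * (1 / a) from fun a => by ring] at h1
      linarith
    · rw [abs_of_pos hc0]
      exact hpole y _ (norm_nonneg _) (norm_sgrad_poleFn_le hδ (fun x y => (hΦ x y).2) y)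
  refine le_dualDist hFnorm ?_
  rw [integral_smul_fn, integral_smul_fn, integral_map_diffeo, ← mul_sub]
  have e : ∀ x, F (Φ x) = logProfile (regParam N) ⟪(x : R3), axis⟫ := fun x => by
    rw [poleFn_apply, Φ.symm_apply_apply]
  simp only [e]
  have hτ1 : 1 / √N ≤ 1 := by rw [div_le_one hs0]; linarith
  have h1 := le_integral_logProfile_perturbed (N := N) (by positivity : 0 ≤ 1 / √N) hτ1
  have h2 := integral_poleFn_le hδ hδ1 (fun x y => (hΦ x y).1)
  have h3 : 1 / √N * (N - 1) / 16 - 72 ≤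
      ∫ x : S2, logProfile (regParam N) ⟪(x : R3), axis⟫ ∂(concentrated N) - ∫ x, F x ∂vg :=
    sub_le_sub h1 h2
  refine le_trans ?_ (mul_le_mul_of_nonneg_left h3 hc0.le)
  have hNs : N = √N ^ 2 := (Real.sq_sqrt (by linarith)).symm
  have h4 : c * (1 / √N * (N - 1) / 16 - 72) = ((√N ^ 2 - 1) / 16 - 72 * √N) / (61440 * √N ^ 2) := by
    rw [hc]
    nth_rewrite 3 [hNs]
    field_simp
  rw [h4, div_le_div_iff₀ (by norm_num) (by positivity)]
  nlinarith

/-- Test with the linear function in the direction of the centre of mass of `Φ_* v_g`. It has mean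
zero for `v_g`, mean at least `1/2` for `Φ_* v_g`, and replacing `v_g` by `μ` inside costs at most
`2 τ ≤ 1/4`. -/
lemma le_dualDist_of_center (hN : 10 ^ 8 ≤ N) (hΦ : 1 / 2 ≤ ‖∫ x, (Φ x : R3) ∂vg‖) :
    ENNReal.ofReal (1 / 10 ^ 7) ≤ dualDist orliczSobolevNorm ((concentrated N).map Φ) vg := by
  have hδ := regParam_pos N
  have hs : 10 ^ 4 ≤ √N := Real.le_sqrt_of_sq_le (by linarith)
  have hτ : 0 ≤ 1 / √N := by positivity
  have hτ1 : 1 / √N ≤ 1 / 8 := one_div_le_one_div_of_le (by norm_num) (by linarith)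
  set b := ∫ x, (Φ x : R3) ∂vg with hb
  set e := ‖b‖⁻¹ • b with he
  have hb0 : 0 < ‖b‖ := by linarith
  have hen : ‖e‖ = 1 := by rw [he, norm_smul, norm_inv, norm_norm, inv_mul_cancel₀ hb0.ne']
  have hlip : ∀ x y : S2, |linFn e x - linFn e y| ≤ 1 * dist x y := by
    intro x y
    rw [linFn_apply, linFn_apply, ← inner_sub_right]
    refine (abs_real_inner_le_norm _ _).trans ?_
    rw [hen, Subtype.dist_eq, dist_eq_norm]
  -- A `1`-Lipschitz function has gradient at most `8`; the factor `1/16` brings it and the values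
  -- of the function below `1/2`.
  have hnorm : orliczSobolevNorm ((1 / 16 : ℝ) • linFn e) ≤ 1 := by
    refine orliczSobolevNorm_smul_le_one (luxemburg_le_half_of_bound fun x => ?_)
      (luxemburg_le_half_of_bound fun x => ?_)
    · have h1 := abs_real_inner_le_norm e (x : R3)
      rw [hen, norm_coe_S2] at h1
      rw [abs_mul, linFn_apply, abs_of_pos (by norm_num)]
      linarith
    · have h1 := norm_sgrad_le_of_lipschitz zero_le_one (Eventually.of_forall fun y => hlip y x)
      rw [abs_mul, abs_abs, abs_norm, abs_of_pos (by norm_num)]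
      linarith
  refine le_dualDist hnorm ?_
  have hlin : ∀ (m : Measure S2) [IsFiniteMeasure m] (g : S2 → R3), Continuous g →
      ∫ x, ⟪e, g x⟫ ∂m = ⟪e, ∫ x, g x ∂m⟫ := fun m _ g hg =>
    integral_inner (hg.integrable_of_hasCompactSupport (HasCompactSupport.of_compactSpace _)) e
  have hΦc := continuous_diffeo_coe Φ
  have hprob := isProbabilityMeasure_perturbed hδ hτ
  have hfin : IsFiniteMeasure (concentrated N) := by unfold concentrated; infer_instance
  have h0 : ∫ x : S2, (x : R3) ∂vg = 0 := by
    have h1 : ∫ x : S2, (x : R3) ∂vg = -∫ x : S2, (x : R3) ∂vg := by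
      conv_lhs => rw [← vg_map_neg]
      rw [integral_map (by fun_prop) (by fun_prop), ← integral_neg]
      rfl
    rw [eq_neg_iff_add_eq_zero, ← two_smul ℝ] at h1
    exact (smul_eq_zero.1 h1).resolve_left two_ne_zero
  rw [integral_smul_fn, integral_smul_fn, integral_map_diffeo]
  simp only [linFn_apply]
  rw [hlin _ _ hΦc, hlin _ _ continuous_subtype_val, h0, inner_zero_right, mul_zero, sub_zero]
  have h1 := norm_integral_perturbed_sub_le hδ hτ hΦc fun x => (norm_coe_S2 (Φ x)).le
  have h2 : ⟪e, b⟫ = ‖b‖ := by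
    rw [he, inner_smul_left, real_inner_self_eq_norm_sq, conj_trivial]
    field_simp
  have h3 := abs_real_inner_le_norm e (∫ x, (Φ x : R3) ∂(concentrated N) - b)
  rw [hen, one_mul, inner_sub_right, h2] at h3
  have h4 := (abs_le.1 (h3.trans h1)).1
  norm_num
  linarith

/-- The measures `concentrated N` stay away from the orbit of `v_g` under the conformal group. -/
theorem le_dualDist_concentrated (hN : 10 ^ 8 ≤ N) (hΦ : IsConformal Φ) :
    ENNReal.ofReal (1 / 10 ^ 7) ≤ dualDist orliczSobolevNorm ((concentrated N).map Φ) vg :=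
  hΦ.half_le_or_biLipschitz.elim (le_dualDist_of_center hN) (le_dualDist_of_biLipschitz hN)

lemma isConformal_refl : IsConformal (Diffeomorph.refl (𝓡 2) S2 ∞) := by
  intro x
  have key : ∀ u : R3, ⟪(x : R3), u⟫ = 0 → fderiv ℝ (fun y : R3 =>
      (Diffeomorph.refl (𝓡 2) S2 ∞ (radialProj y) : R3)) x u = u := fun u hu => by
    have h1 := ((contDiffAt_diffeo (Diffeomorph.refl (𝓡 2) S2 ∞) (coe_ne_zero x)).differentiableAt
      (by simp)).hasFDerivAt
    have h2 := HasFDerivAt.comp_hasDerivAt (0 : ℝ) (f := fun t : ℝ => (x : R3) + t • u)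
      (by simpa using h1) (hasDerivAt_line (x : R3) u 0)
    have h3 := h2.unique (hasFDerivAt_radialProj_apply x u)
    rwa [hu, zero_smul, sub_zero] at h3
  exact ⟨1, one_pos, fun u v hu hv => by rw [key u hu, key v hv, one_mul]⟩

end LowerBound

end HerschStability

end

open HerschStability in
theorem theorem7p5 :
    ∃ μ : ℕ → Measure S2,
      (∀ n, IsProbabilityMeasure (μ n) ∧ Admissible (μ n) ∧ Balanced (μ n)) ∧
      Tendsto (fun n => eigenvalue 1 (μ n)) atTop (𝓝 (ENNReal.ofReal (8 * Real.pi))) ∧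
      (∀ n, dualDist orliczSobolevNorm (μ n) vg < ⊤) ∧
      0 < liminf (fun n => dualDist orliczSobolevNorm (μ n) vg) atTop ∧
      0 < liminf (fun n => conformalDualDist orliczSobolevNorm (μ n)) atTop ∧
      ∀ ε : ℝ, 0 < ε → ε ≤ 1 →
        0 < liminf (fun n => conformalDualDist (sobolevNorm (2 - ε)) (μ n)) atTop := by
  have hc : 0 < ENNReal.ofReal (1 / 10 ^ 7) := ENNReal.ofReal_pos.2 (by norm_num)
  have hev : ∀ᶠ n : ℕ in atTop, (10 : ℝ) ^ 8 ≤ n + 1 := by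
    filter_upwards [eventually_ge_atTop (10 ^ 8)] with n hn
    have : ((10 ^ 8 : ℕ) : ℝ) ≤ n := Nat.cast_le.2 hn
    push_cast at this
    linarith
  have hτ : ∀ n : ℕ, 0 ≤ 1 / √((n : ℝ) + 1) := fun n => by positivity
  refine ⟨fun n => concentrated (n + 1), fun n => ⟨?_, ?_, ?_⟩, ?_, fun n => ?_, ?_, ?_,
    fun ε hε hε1 => ?_⟩
  · exact isProbabilityMeasure_perturbed (regParam_pos _) (hτ n)
  · obtain ⟨C, -, hC⟩ := perturbed_le (τ := 1 / √((n : ℝ) + 1)) (regParam_pos (n + 1))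
    exact admissible_of_le ENNReal.ofReal_ne_top hC
  · exact balanced_perturbed (regParam_pos _) (hτ n)
  · have h0 : Tendsto (fun n : ℕ => 1 / √((n : ℝ) + 1)) atTop (𝓝 0) := by
      have h1 : Tendsto (fun n : ℕ => (n : ℝ) + 1) atTop atTop :=
        tendsto_atTop_add_const_right _ _ tendsto_natCast_atTop_atTop
      simp only [one_div]
      exact (Real.tendsto_sqrt_atTop.comp h1).inv_tendsto_atTop
    refine tendsto_of_tendsto_of_tendsto_of_le_of_le ?_ ?_
      (fun n => le_eigenvalue_perturbed (regParam_pos _) (hτ n))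
      (fun n => eigenvalue_perturbed_le (regParam_pos _) (hτ n))
    · refine ENNReal.tendsto_ofReal ?_
      have h2 : Tendsto (fun n : ℕ => 1 + 3 * (1 / √((n : ℝ) + 1))) atTop (𝓝 1) := by
        simpa using (h0.const_mul 3).const_add 1
      have h3 := (tendsto_const_nhds (x := 8 * Real.pi)).div h2 one_ne_zero
      rwa [div_one] at h3
    · refine ENNReal.tendsto_ofReal ?_
      simpa using (h0.const_add 1).const_mul (8 * Real.pi)
  · have : IsProbabilityMeasure (concentrated (n + 1)) :=
      isProbabilityMeasure_perturbed (regParam_pos _) (hτ n)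
    obtain ⟨C, -, hC⟩ := perturbed_le (τ := 1 / √((n : ℝ) + 1)) (regParam_pos (n + 1))
    exact dualDist_lt_top (μ := concentrated (n + 1)) hC
  -- The bound without a conformal map is the case of the identity.
  · refine hc.trans_le (le_liminf_of_le (by isBoundedDefault) (hev.mono fun n hn => ?_))
    have := le_dualDist_concentrated hn isConformal_refl
    rwa [Diffeomorph.coe_refl, Measure.map_id] at this
  · refine hc.trans_le (le_liminf_of_le (by isBoundedDefault) (hev.mono fun n hn => ?_))
    exact le_iInf₂ fun Φ hΦ => le_dualDist_concentrated hn hΦ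
  · have hK : ENNReal.ofReal (6 / ε) ≠ 0 := (ENNReal.ofReal_pos.2 (by positivity)).ne'
    refine lt_of_lt_of_le (b := ENNReal.ofReal (1 / 10 ^ 7) / ENNReal.ofReal (6 / ε))
      (ENNReal.div_pos hc.ne' ENNReal.ofReal_ne_top)
      (le_liminf_of_le (by isBoundedDefault) (hev.mono fun n hn => ?_))
    refine le_iInf₂ fun Φ hΦ => ?_
    rw [ENNReal.div_le_iff_le_mul (Or.inl hK) (Or.inl ENNReal.ofReal_ne_top), mul_comm]
    exact (le_dualDist_concentrated hn hΦ).trans (dualDist_orlicz_le hε hε1 _ _)
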